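/- Let $d\in\{1,2,3\}$, let $\Omega\subset\mathbb R^d$ be a bounded open set, $s,\alpha\in(0,1)$ and $T>0$. Write $\|\cdot\|$ and $(\cdot,\cdot)$ for the norm and inner product of $L^2(\Omega)$, put $c_{d,s}=\frac{2^{2s}s\,\Gamma(d/2+s)}{\pi^{d/2}\Gamma(1-s)}$ and $$\langle u,v\rangle_s=\frac{c_{d,s}}2\iint_{(\mathbb R^d\times\mathbb R^d)\setminus(\Omega^c\times\Omega^c)}\frac{(u(x)-u(y))(v(x)-v(y))}{|x-y|^{d+2s}}\,dx\,dy,$$ and let ${}_0\partial_t^\alpha w(t)=\frac1{\Gamma(1-\alpha)}\frac{d}{dt}\int_0^t(t-\xi)^{-\alpha}w(\xi)\,d\xi$ be the Riemann–Liouville derivative. Then there is a constant $C>0$, depending only on $d,\Omega,s,\alpha,T$, such that the following holds. Let $\mathcal T_h$ be any finite conforming simplicial mesh whose simplices lie in $\overline\Omega$, let $X_h$ be the space of continuous functions on $\mathbb R^d$ that are affine on each simplex of $\mathcal T_h$ and vanish outside $\Omega$ and outside the union of the simplices, and let $P_h:L^2(\Omega)\to X_h$ be the $L^2$ projection, $(P_hg,v)=(g,v)$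 for all $v\in X_h$. Let $u_0\in L^2(\Omega)$ and let $f:[0,T]\to L^2(\Omega)$ satisfy $f(0)\in L^2(\Omega)$ and $f(t)=f(0)+\int_0^tf'(r)\,dr$ with $\int_0^T\|f'(r)\|\,dr<\infty$. Let $u_h:[0,T]\to X_h$ be the solution of the semi-discrete problem, that is, $u_h$ is continuous, $u_h(0)=P_hu_0$ and $$({}_0\partial_t^\alpha(u_h-u_h(0)),v)+(\nabla u_h,\nabla v)+\langle u_h,v\rangle_s=(f,v)\qquad\text{for all }v\in X_h,\ t\in(0,T].$$ Let $\tau>0$, $t_n=n\tau$, $b_j=\frac{(j+1)^{1-\alpha}-j^{1-\alpha}}{\Gamma(2-\alpha)}$, $d_0=\tau^{-\alpha}b_0$ and $d_j=\tau^{-\alpha}(b_j-b_{j-1})$ for $j\ge1$, and let $u_h^n\in X_h$ be the solution of the fully discrete L1 scheme, that is, $u_h^0=P_hu_0$ and $$\Big(\sum_{j=0}^{n-1}d_j\,(u_h^{n-j}-u_h^0),v\Big)+(\nabla u_h^n,\nabla v)+\langle u_h^n,v\rangle_s=(f(t_n),v)\qquad\text{for all }v\in X_h,\ n\ge1,\ t_n\le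 T.$$ Then, with $f_h^0=P_hf(0)$, for every $n\ge1$ with $t_n\le T$, $$\|u_h(t_n)-u_h^n\|\le C\tau t_n^{-1}\|u_h^0\|+C\tau t_n^{-1}\|f_h^0\|+C\tau\int_0^{t_n}(t_n-r)^{\alpha-1}\|f'(r)\|\,dr,$$ where the last integral may be $+\infty$. -/

import Mathlib

open MeasureTheory Set
open scoped ENNReal

noncomputable section

namespace TwoScaleFPE

/-- The space `ℝᵈ` with the Euclidean norm. -/
abbrev Sp (d : ℕ) : Type := EuclideanSpace ℝ (Fin d)

/-- The real Hilbert space `L²(Ω)`. -/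
abbrev L2 {d : ℕ} (Ω : Set (Sp d)) : Type := Lp ℝ 2 (volume.restrict Ω)

/-- The finite element space `X_h` over the simplicial mesh `K`: the continuous functions that are
affine on every simplex of `K` and vanish outside `Ω` and outside the polyhedron filled by `K`. -/
def femSpace {d : ℕ} (Ω : Set (Sp d)) (K : Geometry.SimplicialComplex ℝ (Sp d)) :
    Submodule ℝ (Sp d → ℝ) where
  carrier := {v | Continuous v ∧
    (∀ σ ∈ K.faces, ∃ a : Sp d →ᵃ[ℝ] ℝ, ∀ x ∈ convexHull ℝ (σ : Set (Sp d)), v x = a x) ∧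
    ∀ x, x ∉ Ω ∩ K.space → v x = 0}
  add_mem' := by
    rintro u v ⟨hu, hu', hu''⟩ ⟨hv, hv', hv''⟩
    refine ⟨hu.add hv, fun σ hσ => ?_, fun x hx => ?_⟩
    · obtain ⟨a, ha⟩ := hu' σ hσ
      obtain ⟨b, hb⟩ := hv' σ hσ
      exact ⟨a + b, fun x hx => by simp [ha x hx, hb x hx]⟩
    · simp [hu'' x hx, hv'' x hx]
  zero_mem' := ⟨continuous_const, fun _ _ => ⟨0, fun _ _ => by simp⟩, fun _ _ => rfl⟩
  smul_mem' := by
    rintro c v ⟨hv, hv', hv''⟩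
    refine ⟨hv.const_smul c, fun σ hσ => ?_, fun x hx => ?_⟩
    · obtain ⟨b, hb⟩ := hv' σ hσ
      exact ⟨c • b, fun x hx => by simp [hb x hx]⟩
    · simp [hv'' x hx]

/-- The `L²(Ω)` inner product `(u, v)`. -/
def l2Inner {d : ℕ} (Ω : Set (Sp d)) (u v : Sp d → ℝ) : ℝ := ∫ x in Ω, u x * v x

/-- The `L²(Ω)` norm. -/
def l2Norm {d : ℕ} (Ω : Set (Sp d)) (u : Sp d → ℝ) : ℝ≥0∞ := eLpNorm u 2 (volume.restrict Ω)

/-- The Dirichlet form `(∇u, ∇v)`. -/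
def gradForm {d : ℕ} (Ω : Set (Sp d)) (u v : Sp d → ℝ) : ℝ :=
  ∫ x in Ω, inner ℝ (gradient u x) (gradient v x)

/-- The normalising constant of the fractional Laplacian of order `2s` in `ℝᵈ`. -/
def cConst (d : ℕ) (s : ℝ) : ℝ :=
  2 ^ (2 * s) * s * Real.Gamma ((d : ℝ) / 2 + s) /
    (Real.pi ^ ((d : ℝ) / 2) * Real.Gamma (1 - s))

/-- The bilinear form `⟨u, v⟩ₛ` of the integral fractional Laplacian with zero exterior values. -/
def fracForm {d : ℕ} (Ω : Set (Sp d)) (s : ℝ) (u v : Sp d → ℝ) : ℝ :=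
  cConst d s / 2 * ∫ p in (Ωᶜ ×ˢ Ωᶜ : Set (Sp d × Sp d))ᶜ,
    (u p.1 - u p.2) * (v p.1 - v p.2) / ‖p.1 - p.2‖ ^ ((d : ℝ) + 2 * s)

/-- `p` is the `L²` projection `P_h g` of `g ∈ L²(Ω)` onto `X_h`. -/
def IsL2Projection {d : ℕ} {Ω : Set (Sp d)} {K : Geometry.SimplicialComplex ℝ (Sp d)}
    (p : femSpace Ω K) (g : L2 Ω) : Prop :=
  ∀ v : femSpace Ω K, l2Inner Ω p v = l2Inner Ω g v

/-- The function `w` on `[0, T]` has at `t` the Riemann-Liouville derivative `D` of order `α`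
(with lower limit `0`; one-sided at `t = T`). -/
def HasRLDerivAt (α T : ℝ) (w : ℝ → ℝ) (D t : ℝ) : Prop :=
  HasDerivWithinAt
    (fun t' => (Real.Gamma (1 - α))⁻¹ * ∫ ξ in (0 : ℝ)..t', (t' - ξ) ^ (-α) * w ξ)
    D (Icc 0 T) t

/-- `u : [0, T] → X_h` solves the spatially semi-discrete problem with data `u₀`, `f`: it is
continuous (`X_h` is finite dimensional and carries its only Hausdorff vector space topology),
`u(0) = P_h u₀`, and for all `t ∈ (0, T]` and `v ∈ X_h`
`(∂ᵗ^α (u - u(0)), v) + (∇u, ∇v) + ⟨u, v⟩ₛ = (f, v)`. -/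
structure IsSemidiscreteSolution {d : ℕ} {Ω : Set (Sp d)}
    {K : Geometry.SimplicialComplex ℝ (Sp d)} (s α T : ℝ) (u₀ : L2 Ω) (f : ℝ → L2 Ω)
    (u : ℝ → femSpace Ω K) : Prop where
  continuousOn : ContinuousOn u (Icc 0 T)
  initial : IsL2Projection (u 0) u₀
  equation : ∀ t ∈ Ioc 0 T, ∀ v : femSpace Ω K,
    HasRLDerivAt α T (fun ξ => l2Inner Ω (u ξ - u 0 : femSpace Ω K) v)
      (l2Inner Ω (f t) v - gradForm Ω (u t) v - fracForm Ω s (u t) v) t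

/-- The numbers `b_j` of the L1 scheme. -/
def bCoeff (α : ℝ) (j : ℕ) : ℝ :=
  (((j : ℝ) + 1) ^ (1 - α) - (j : ℝ) ^ (1 - α)) / Real.Gamma (2 - α)

/-- The weights `d_j` of the L1 scheme with step size `τ`. -/
def dCoeff (α τ : ℝ) : ℕ → ℝ
  | 0 => τ ^ (-α) * bCoeff α 0
  | j + 1 => τ ^ (-α) * (bCoeff α (j + 1) - bCoeff α j)

/-- `U⁰, U¹, …` solves the fully discrete L1 finite element scheme with step size `τ` at all grid
points `tₙ = nτ ≤ T`: `U⁰ = P_h u₀`, and for all `n ≥ 1` with `tₙ ≤ T` and all `v ∈ X_h`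
`(∑_{j<n} d_j (Uⁿ⁻ʲ - U⁰), v) + (∇Uⁿ, ∇v) + ⟨Uⁿ, v⟩ₛ = (f(tₙ), v)`. -/
structure IsFullyDiscreteSolution {d : ℕ} {Ω : Set (Sp d)}
    {K : Geometry.SimplicialComplex ℝ (Sp d)} (s α T τ : ℝ) (u₀ : L2 Ω) (f : ℝ → L2 Ω)
    (U : ℕ → femSpace Ω K) : Prop where
  initial : IsL2Projection (U 0) u₀
  equation : ∀ n : ℕ, 1 ≤ n → (n : ℝ) * τ ≤ T → ∀ v : femSpace Ω K,
    l2Inner Ω (∑ j ∈ Finset.range n, dCoeff α τ j • (U (n - j) - U 0) : femSpace Ω K) v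
      + gradForm Ω (U n) v + fracForm Ω s (U n) v = l2Inner Ω (f ((n : ℝ) * τ)) v

end TwoScaleFPE

end

/-! ### Kaluza's theorem and discrete resolvents. -/

namespace TwoScaleFPE

/-! Choose a basis of the finite element space that is L²-orthonormal and diagonalises the energy
form (`exists_diagonal_family`). Both problems decouple into scalar ones with eigenvalues l ≥ 0.
Estimates of the scalar errors with constants independent of l carry over to the vector problem by
Bessel and Cauchy–Schwarz (`norm_le_of_forall_inner_eq`), so neither the mesh nor the number of
modes enters the constant.

For fixed l everything is expressed by the step response Φ, the solution of Φ = I^α(1 - lΦ), and by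
its L1 counterpart τ^α ∑_{i<n} G_i. Here G = ((1 - X)B + lτ^α)⁻¹ and B is the generating series of
the b_j. The two Duhamel formulas (`IsFracStep.duhamel`, `l1_duhamel`) turn the error at t_n into
-lE·y(0) + E·g(0) plus an integral of a kernel difference against g', where E is the difference of
the step responses at t_n. It remains to show l|E| ≤ Cτ/t_n and |E| ≤ Cτ t_n^(α-1), the latter also
between grid points for the kernel difference (`exists_kernel_error_le`).

These bounds rest on sign and convexity. Kaluza's theorem for log-convex sequences makes G
nonnegative and nonincreasing; an identity of power series bounds its partial sums by 1/μ, with μ =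
lτ^α, and by 1/b_n. The continuous analogues, namely that Φ is increasing and concave with lΦ ≤ 1,
are obtained as limits of a second scheme, convolution quadrature with generating series (1 -
X)^(-α), to which the same discrete theory applies.

For the concave rescaled step response P, the truncation error of the L1 formula is at most a
convolution of the cell variations of t^(-α) with second differences of P
(`IsFracStep.abs_truncation_le`). Masses and first moments of these sequences are controlled by
telescoping. Convolving with G and splitting the factor n + 1 between the convolved sequences gives
n|error| ≤ C·M for every common bound M of the exact and discrete step responses
(`exists_mul_abs_sub_l1Step_le`). The choices M = 1/μ and M proportional to n^α yield the two
required estimates. -/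

open PowerSeries Finset in
/-- Kaluza's theorem: the reciprocal of a power series with positive log-convex coefficients has
nonpositive coefficients from the first one on. -/
theorem kaluza {c p : PowerSeries ℝ} (hpos : ∀ n, 0 < coeff n c)
    (hlog : ∀ n, coeff (n + 1) c ^ 2 ≤ coeff n c * coeff (n + 2) c) (h : c * p = 1) (n : ℕ) :
    coeff (n + 1) p ≤ 0 := by
  -- Log-convexity says that the ratios c_{n+1}/c_n increase; this compares the ratios at k and k +
  -- i in cross-multiplied form.
  have hratio : ∀ k i : ℕ, coeff (k + 1) c * coeff (k + i) c ≤ coeff k c * coeff (k + i + 1) c := by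
    intro k i
    induction i with
    | zero => simp [mul_comm]
    | succ i ih =>
      have h1 := hlog (k + i)
      have p0 := hpos (k + i)
      have p1 := hpos (k + i + 1)
      have p2 := hpos (k + i + 2)
      have pk := hpos k
      have pk1 := hpos (k + 1)
      rw [show k + (i + 1) = k + i + 1 by ring, show k + i + 1 + 1 = k + i + 2 by ring]
      refine le_of_mul_le_mul_right ?_ (mul_pos p0 p1)
      have e1 := mul_le_mul_of_nonneg_right ih (mul_pos p1 p1).le
      have e2 := mul_le_mul_of_nonneg_left h1 (mul_pos pk p1).le
      nlinarith
  have h0 : coeff 0 c * coeff 0 p = 1 := by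
    have := congrArg (coeff 0) h
    simpa [coeff_mul] using this
  have hp0 : 0 < coeff 0 p := by
    have := hpos 0
    by_contra hcon
    nlinarith [mul_nonpos_of_nonneg_of_nonpos this.le (not_lt.1 hcon)]
  have hsum : ∀ m, ∑ i ∈ range (m + 2), coeff i p * coeff (m + 1 - i) c = 0 := by
    intro m
    have := congrArg (coeff (m + 1)) h
    rw [mul_comm, coeff_mul, Nat.sum_antidiagonal_eq_sum_range_succ_mk] at this
    simpa using this
  induction n using Nat.strong_induction_on with
  | _ n ih =>
    rcases n with _ | n
    · have := hsum 0
      simp only [zero_add, sum_range_succ, range_zero, sum_empty, Nat.sub_zero, Nat.sub_self] at this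
      have h1 := mul_pos hp0 (hpos 1)
      have h2 := hpos 0
      have : coeff 1 p * coeff 0 c ≤ 0 := by linarith
      simpa using nonpos_of_mul_nonpos_left this h2
    · have e1 := hsum n
      have e2 := hsum (n + 1)
      rw [sum_range_succ, sum_range_succ'] at e2
      rw [sum_range_succ'] at e1
      simp only [Nat.sub_zero, Nat.sub_self] at e1 e2
      -- Multiply the equation of order n + 1 by c_{n+2}, that of order n + 2 by c_{n+1}, and
      -- subtract: p_0 cancels. What remains expresses p_{n+2} c_0 c_{n+1} through the earlier
      -- p_{i+1}, nonpositive by induction, with weights that are nonnegative by `hratio`.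
      have key : 0 ≥ coeff (n + 2) p * coeff 0 c * coeff (n + 1) c := by
        have hle : ∑ i ∈ range (n + 1), (coeff (n + 2) c * (coeff (i + 1) p *
            coeff (n + 1 - (i + 1)) c) - coeff (n + 1) c *
            (coeff (i + 1) p * coeff (n + 1 + 1 - (i + 1)) c)) ≤ 0 := by
          refine sum_nonpos fun i hi => ?_
          have hi' : i < n + 1 := mem_range.1 hi
          have hpi := ih i (by omega)
          obtain ⟨j, rfl⟩ : ∃ j, n = i + j := ⟨n - i, by omega⟩
          have := hratio j (i + 1)
          rw [show i + j + 1 - (i + 1) = j by omega, show i + j + 1 + 1 - (i + 1) = j + 1 by omega]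
          rw [show j + (i + 1) + 1 = i + j + 2 by ring, show j + (i + 1) = i + j + 1 by ring] at this
          have := mul_le_mul_of_nonpos_left this hpi
          linarith
        rw [sum_sub_distrib, ← mul_sum, ← mul_sum] at hle
        have : n + 1 + 1 = n + 2 := rfl
        simp only [this] at *
        linear_combination (-coeff (n + 2) c) * e1 + coeff (n + 1) c * e2 + hle
      have h1 := mul_pos (hpos 0) (hpos (n + 1))
      rw [mul_assoc] at key
      exact nonpos_of_mul_nonpos_left key h1

/-- Positive, nonincreasing and log-convex coefficients. -/
structure IsKaluzaKernel (B : PowerSeries ℝ) : Prop where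
  pos : ∀ n, 0 < PowerSeries.coeff n B
  anti : ∀ n, PowerSeries.coeff (n + 1) B ≤ PowerSeries.coeff n B
  logconvex : ∀ n, PowerSeries.coeff (n + 1) B ^ 2 ≤
    PowerSeries.coeff n B * PowerSeries.coeff (n + 2) B

/-- The resolvent `((1 - X) B + μ)⁻¹`. -/
noncomputable def discreteResolvent (B : PowerSeries ℝ) (μ : ℝ) : PowerSeries ℝ :=
  ((1 - PowerSeries.X) * B + PowerSeries.C μ)⁻¹

section Resolvent

open PowerSeries Finset

variable {B : PowerSeries ℝ} {μ : ℝ}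

theorem coeff_one_sub_X_mul_succ (A : PowerSeries ℝ) (n : ℕ) :
    coeff (n + 1) ((1 - X) * A) = coeff (n + 1) A - coeff n A := by
  rw [sub_mul, one_mul, map_sub, coeff_succ_X_mul]

theorem coeff_one_sub_X_mul_zero (A : PowerSeries ℝ) :
    coeff 0 ((1 - X) * A) = coeff 0 A := by
  simp

theorem coeff_mk_one_mul (A : PowerSeries ℝ) (n : ℕ) :
    coeff n (PowerSeries.mk 1 * A) = ∑ i ∈ range (n + 1), coeff i A := by
  rw [mul_comm, coeff_mul, Nat.sum_antidiagonal_eq_sum_range_succ_mk]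
  simp

theorem mul_discreteResolvent (hB : IsKaluzaKernel B) (hμ : 0 ≤ μ) :
    ((1 - X) * B + C μ) * discreteResolvent B μ = 1 := by
  refine PowerSeries.mul_inv_cancel _ ?_
  have := hB.pos 0
  rw [coeff_zero_eq_constantCoeff] at this
  simp
  linarith

/-- This is the defining identity of the resolvent divided by 1 - X. The factor on the left now has
only nonnegative coefficients, which makes partial sums of the resolvent accessible. -/
theorem kernel_add_mul_resolvent (hB : IsKaluzaKernel B) (hμ : 0 ≤ μ) :
    (B + C μ * PowerSeries.mk 1) * discreteResolvent B μ = PowerSeries.mk 1 := by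
  have h := mul_discreteResolvent hB hμ
  have h1 := PowerSeries.mk_one_mul_one_sub_eq_one ℝ
  calc (B + C μ * PowerSeries.mk 1) * discreteResolvent B μ
      = (PowerSeries.mk 1 * (1 - X) * B + C μ * PowerSeries.mk 1) * discreteResolvent B μ := by
        rw [h1, one_mul]
    _ = PowerSeries.mk 1 * (((1 - X) * B + C μ) * discreteResolvent B μ) := by ring
    _ = _ := by rw [h, mul_one]

/-- As B is nonincreasing, all coefficients of (1 - X)B + μ after the first are nonpositive, and the
first is positive. The recursion for the inverse therefore preserves nonnegativity, as for an
M-matrix. -/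
theorem discreteResolvent_nonneg (hB : IsKaluzaKernel B) (hμ : 0 ≤ μ) (n : ℕ) :
    0 ≤ coeff n (discreteResolvent B μ) := by
  have h := mul_discreteResolvent hB hμ
  have h0 : 0 < coeff 0 B + μ := add_pos_of_pos_of_nonneg (hB.pos 0) hμ
  induction n using Nat.strong_induction_on with
  | _ n ih =>
    have e := congrArg (coeff n) h
    rw [mul_comm, coeff_mul, Nat.sum_antidiagonal_eq_sum_range_succ_mk, sum_range_succ] at e
    have hrest : ∑ k ∈ range n, coeff k (discreteResolvent B μ) *
        coeff (n - k) ((1 - X) * B + C μ) ≤ 0 := by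
      refine sum_nonpos fun k hk => ?_
      have hk' := mem_range.1 hk
      obtain ⟨j, hj⟩ : ∃ j, n - k = j + 1 := ⟨n - k - 1, by omega⟩
      rw [hj, map_add, coeff_one_sub_X_mul_succ, coeff_C]
      have := hB.anti j
      exact mul_nonpos_of_nonneg_of_nonpos (ih k hk') (by simp; linarith)
    have hone : (0 : ℝ) ≤ coeff n (1 : PowerSeries ℝ) := by
      rw [coeff_one]; split_ifs <;> norm_num
    rw [Nat.sub_self, map_add, coeff_one_sub_X_mul_zero, coeff_C, if_pos rfl] at e
    have : 0 ≤ coeff n (discreteResolvent B μ) * (coeff 0 B + μ) := by linarith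
    exact nonneg_of_mul_nonneg_left this h0

/-- The series (1 - X)G is the reciprocal of B + μ/(1 - X), whose coefficients are b_n + μ. Adding a
constant keeps log-convexity because a positive log-convex sequence is convex, so Kaluza's theorem
makes the differences of G nonpositive. -/
theorem discreteResolvent_anti (hB : IsKaluzaKernel B) (hμ : 0 ≤ μ) (n : ℕ) :
    coeff (n + 1) (discreteResolvent B μ) ≤ coeff n (discreteResolvent B μ) := by
  have h : (B + C μ * PowerSeries.mk 1) * ((1 - X) * discreteResolvent B μ) = 1 := by
    rw [mul_left_comm, kernel_add_mul_resolvent hB hμ, mul_comm,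
      PowerSeries.mk_one_mul_one_sub_eq_one]
  have hc : ∀ n, coeff n (B + C μ * PowerSeries.mk 1) = coeff n B + μ := by
    intro n; simp
  have := kaluza (fun n => ?_) (fun n => ?_) h n
  · rw [coeff_one_sub_X_mul_succ] at this
    linarith
  · rw [hc]; exact add_pos_of_pos_of_nonneg (hB.pos n) hμ
  · rw [hc, hc, hc]
    have h1 := hB.logconvex n
    have : 2 * coeff (n + 1) B ≤ coeff n B + coeff (n + 2) B := by
      have := hB.pos n
      have := hB.pos (n + 2)
      refine abs_le_of_sq_le_sq' ?_ (by positivity) |>.2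
      nlinarith [sq_nonneg (coeff n B - coeff (n + 2) B)]
    nlinarith

theorem discreteResolvent_antitone (hB : IsKaluzaKernel B) (hμ : 0 ≤ μ) :
    Antitone fun n => coeff n (discreteResolvent B μ) :=
  antitone_nat_of_succ_le (discreteResolvent_anti hB hμ)

/-- Both terms on the left are nonnegative, so each is at most 1. The second gives the bound 1/μ for
the sums of G; the first, with b_{n-i} ≥ b_n, gives the bound 1/b_n, which does not involve μ. -/
theorem sum_kernel_mul_resolvent (hB : IsKaluzaKernel B) (hμ : 0 ≤ μ) (n : ℕ) :
    ∑ i ∈ range (n + 1), coeff i (discreteResolvent B μ) * coeff (n - i) B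
      + μ * ∑ i ∈ range (n + 1), coeff i (discreteResolvent B μ) = 1 := by
  have e := congrArg (coeff n) (kernel_add_mul_resolvent hB hμ)
  rw [add_mul, map_add, mul_assoc, coeff_C_mul, coeff_mk_one_mul, mul_comm, coeff_mul,
    Nat.sum_antidiagonal_eq_sum_range_succ_mk] at e
  simpa using e

theorem mul_sum_discreteResolvent_le_one (hB : IsKaluzaKernel B) (hμ : 0 ≤ μ) (n : ℕ) :
    μ * ∑ i ∈ range n, coeff i (discreteResolvent B μ) ≤ 1 := by
  rcases n with _ | n
  · simp
  have h := sum_kernel_mul_resolvent hB hμ n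
  have : 0 ≤ ∑ i ∈ range (n + 1), coeff i (discreteResolvent B μ) * coeff (n - i) B :=
    sum_nonneg fun i _ => mul_nonneg (discreteResolvent_nonneg hB hμ i) (hB.pos _).le
  linarith

theorem kernel_mul_sum_discreteResolvent_le_one (hB : IsKaluzaKernel B) (hμ : 0 ≤ μ) (n : ℕ) :
    coeff n B * ∑ i ∈ range (n + 1), coeff i (discreteResolvent B μ) ≤ 1 := by
  have h := sum_kernel_mul_resolvent hB hμ n
  have hanti : Antitone fun n => coeff n B := antitone_nat_of_succ_le hB.anti
  have h1 : ∑ i ∈ range (n + 1), coeff i (discreteResolvent B μ) * coeff n B ≤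
      ∑ i ∈ range (n + 1), coeff i (discreteResolvent B μ) * coeff (n - i) B :=
    sum_le_sum fun i _ => mul_le_mul_of_nonneg_left (hanti (Nat.sub_le n i))
      (discreteResolvent_nonneg hB hμ i)
  have h2 : 0 ≤ μ * ∑ i ∈ range (n + 1), coeff i (discreteResolvent B μ) :=
    mul_nonneg hμ (sum_nonneg fun i _ => discreteResolvent_nonneg hB hμ i)
  rw [mul_comm, sum_mul]
  linarith

theorem discreteResolvent_mul_le_sum (hB : IsKaluzaKernel B) (hμ : 0 ≤ μ) (n : ℕ) :
    coeff n (discreteResolvent B μ) * (n + 1) ≤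
      ∑ i ∈ range (n + 1), coeff i (discreteResolvent B μ) := by
  have : ∑ i ∈ range (n + 1), coeff n (discreteResolvent B μ) ≤
      ∑ i ∈ range (n + 1), coeff i (discreteResolvent B μ) :=
    sum_le_sum fun i hi => discreteResolvent_antitone hB hμ (by simpa [Nat.lt_succ_iff] using hi)
  simpa [mul_comm] using this

theorem discreteResolvent_zero_le (hB : IsKaluzaKernel B) (hμ : 0 ≤ μ) (n : ℕ) :
    coeff n (discreteResolvent B μ) ≤ (coeff 0 B)⁻¹ := by
  refine (discreteResolvent_antitone hB hμ (Nat.zero_le n)).trans ?_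
  have := kernel_mul_sum_discreteResolvent_le_one hB hμ 0
  rw [zero_add, sum_range_one] at this
  exact (le_inv_mul_iff₀ (hB.pos 0)).2 this |>.trans_eq (mul_one _)

/-- Discrete Duhamel formula: the solution of a convolution equation on an initial section. -/
theorem eq_sum_discreteResolvent (hB : IsKaluzaKernel B) (hμ : 0 ≤ μ) {W h : ℕ → ℝ} {N : ℕ}
    (hW : ∀ n ≤ N, ∑ j ∈ range (n + 1), coeff j ((1 - X) * B) * W (n - j) + μ * W n = h n)
    (n : ℕ) (hn : n ≤ N) :
    W n = ∑ j ∈ range (n + 1), coeff j (discreteResolvent B μ) * h (n - j) := by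
  have h1 : PowerSeries.mk W =
      discreteResolvent B μ * (((1 - X) * B + C μ) * PowerSeries.mk W) := by
    rw [← mul_assoc, mul_comm (discreteResolvent B μ), mul_discreteResolvent hB hμ, one_mul]
  have h2 := congrArg (coeff n) h1
  rw [coeff_mk, coeff_mul, Nat.sum_antidiagonal_eq_sum_range_succ_mk] at h2
  rw [h2]
  refine sum_congr rfl fun j _ => ?_
  rw [← hW (n - j) (by omega), add_mul, map_add, coeff_C_mul, coeff_mk, coeff_mul,
    Nat.sum_antidiagonal_eq_sum_range_succ_mk]
  simp

end Resolvent

end TwoScaleFPE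

/-! ### The L1 kernel and the binomial kernel. -/

namespace TwoScaleFPE

section Kernels

open PowerSeries Finset

variable {α : ℝ}

theorem intervalIntegrable_rpow_of_pos {p : ℝ} (hp : 0 < p) (a b : ℝ) :
    IntervalIntegrable (fun x : ℝ => x ^ (p - 1)) volume a b :=
  intervalIntegral.intervalIntegrable_rpow' (by linarith)

theorem integral_rpow_sub_one {p : ℝ} (hp : 0 < p) (a b : ℝ) :
    ∫ x in a..b, x ^ (p - 1) = (b ^ p - a ^ p) / p := by
  rw [integral_rpow (Or.inl (by linarith))]
  simp

theorem bCoeff_eq_integral (hα : α < 1) (j : ℕ) :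
    bCoeff α j = (Real.Gamma (1 - α))⁻¹ * ∫ x in (j : ℝ)..j + 1, x ^ (-α) := by
  have h1 : 0 < 1 - α := by linarith
  have := integral_rpow_sub_one h1 (j : ℝ) (j + 1)
  rw [show 1 - α - 1 = -α by ring] at this
  rw [this, bCoeff, show 2 - α = (1 - α) + 1 by ring, Real.Gamma_add_one h1.ne']
  have := (Real.Gamma_pos_of_pos h1).ne'
  field_simp

theorem bCoeff_eq_integral_zero_one (hα : α < 1) (j : ℕ) :
    bCoeff α j = (Real.Gamma (1 - α))⁻¹ * ∫ x in (0 : ℝ)..1, (x + j) ^ (-α) := by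
  rw [bCoeff_eq_integral hα,
    intervalIntegral.integral_comp_add_right (fun x : ℝ => x ^ (-α)) (j : ℝ)]
  simp [add_comm]

theorem intervalIntegrable_add_rpow_neg (hα : α < 1) (j : ℝ) (a b : ℝ) :
    IntervalIntegrable (fun x : ℝ => (x + j) ^ (-α)) volume a b := by
  have := (intervalIntegrable_rpow_of_pos (p := 1 - α) (by linarith) (a + j) (b + j)).comp_add_right j
  simpa [show 1 - α - 1 = -α by ring] using this

/-- The decreasing integrand is at least its value at the right end of the cell. This lower bound
later limits the growth of the discrete step response to n^α. -/
theorem bCoeff_ge (hα : α ∈ Ioo (0 : ℝ) 1) (j : ℕ) :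
    (Real.Gamma (1 - α))⁻¹ * ((j : ℝ) + 1) ^ (-α) ≤ bCoeff α j := by
  rw [bCoeff_eq_integral hα.2]
  have h1 : 0 < 1 - α := by linarith [hα.2]
  have hG := Real.Gamma_pos_of_pos h1
  refine mul_le_mul_of_nonneg_left ?_ (by positivity)
  have hle : (j : ℝ) ≤ j + 1 := by linarith
  have := intervalIntegral.integral_mono_on_of_le_Ioo hle
    (f := fun _ : ℝ => ((j : ℝ) + 1) ^ (-α)) (g := fun x => x ^ (-α))
    intervalIntegrable_const (intervalIntegral.intervalIntegrable_rpow' (by linarith [hα.2]))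
    (fun x hx => by
      have : (0 : ℝ) ≤ j := Nat.cast_nonneg j
      exact Real.rpow_le_rpow_of_nonpos (by linarith [hx.1]) hx.2.le (by linarith [hα.1]))
  simpa using this

/-- The generating series of the numbers `b_j` of the L1 scheme. -/
noncomputable def l1Kernel (α : ℝ) : PowerSeries ℝ := PowerSeries.mk (bCoeff α)

/-- Each b_n is the integral over x in (0, 1) of (x + n)^(-α), which decreases and is log-convex in
n for fixed x. Log-convexity survives integration by Cauchy–Schwarz, used here as the discriminant
of the nonnegative quadratic b_n θ² + 2 b_{n+1} θ + b_{n+2}. -/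
theorem isKaluzaKernel_l1Kernel (hα : α ∈ Ioo (0 : ℝ) 1) : IsKaluzaKernel (l1Kernel α) := by
  have h1 : 0 < 1 - α := by linarith [hα.2]
  have hG := Real.Gamma_pos_of_pos h1
  have hi : ∀ j : ℕ, IntervalIntegrable (fun x : ℝ => (x + j) ^ (-α)) volume 0 1 :=
    fun j => intervalIntegrable_add_rpow_neg hα.2 j 0 1
  have hpos : ∀ n, 0 < bCoeff α n := fun n =>
    lt_of_lt_of_le (by positivity) (bCoeff_ge hα n)
  refine ⟨fun n => by simpa [l1Kernel] using hpos n, fun n => ?_, fun n => ?_⟩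
  · simp only [l1Kernel, coeff_mk]
    rw [bCoeff_eq_integral_zero_one hα.2, bCoeff_eq_integral_zero_one hα.2]
    refine mul_le_mul_of_nonneg_left ?_ (by positivity)
    refine intervalIntegral.integral_mono_on_of_le_Ioo zero_le_one (hi _) (hi _) fun x hx => ?_
    have : (0 : ℝ) ≤ n := Nat.cast_nonneg n
    exact Real.rpow_le_rpow_of_nonpos (by linarith [hx.1]) (by simp) (by linarith [hα.1])
  · simp only [l1Kernel, coeff_mk]
    have hquad : ∀ θ : ℝ, 0 ≤ bCoeff α n * (θ * θ) + 2 * bCoeff α (n + 1) * θ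
        + bCoeff α (n + 2) := by
      intro θ
      simp only [bCoeff_eq_integral_zero_one hα.2]
      have : 0 ≤ ∫ x in (0 : ℝ)..1, ((x + n) ^ (-α) * (θ * θ)
          + (x + (n + 1 : ℕ)) ^ (-α) * (2 * θ) + (x + (n + 2 : ℕ)) ^ (-α)) := by
        refine intervalIntegral.integral_nonneg_of_ae_restrict zero_le_one ?_
        rw [Filter.EventuallyLE, ← restrict_Ioc_eq_restrict_Icc, ae_restrict_iff' measurableSet_Ioc]
        refine Filter.Eventually.of_forall fun x hx => ?_
        have hn : (0 : ℝ) ≤ n := Nat.cast_nonneg n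
        have hx0 := hx.1
        have p0 : 0 < x + n := by linarith
        have p1 : 0 < x + (n + 1 : ℕ) := by push_cast; linarith
        have p2 : 0 < x + (n + 2 : ℕ) := by push_cast; linarith
        have hlog : ((x + (n + 1 : ℕ)) ^ (-α)) ^ 2 ≤ (x + n) ^ (-α) * (x + (n + 2 : ℕ)) ^ (-α) := by
          rw [← Real.mul_rpow p0.le p2.le, sq, ← Real.mul_rpow p1.le p1.le]
          refine Real.rpow_le_rpow_of_nonpos (by positivity) ?_ (by linarith [hα.1])
          push_cast; nlinarith
        have q0 := Real.rpow_pos_of_pos p0 (-α)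
        set A := (x + n) ^ (-α)
        set B := (x + (n + 1 : ℕ)) ^ (-α)
        set D := (x + (n + 2 : ℕ)) ^ (-α)
        have : 0 ≤ A * (A * (θ * θ) + B * (2 * θ) + D) := by nlinarith [sq_nonneg (A * θ + B)]
        exact nonneg_of_mul_nonneg_right this q0
      rw [intervalIntegral.integral_add (((hi n).mul_const _).add ((hi _).mul_const _)) (hi _),
        intervalIntegral.integral_add ((hi n).mul_const _) ((hi _).mul_const _),
        intervalIntegral.integral_mul_const, intervalIntegral.integral_mul_const] at this
      have := mul_nonneg (inv_pos.2 hG).le this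
      linarith
    have := discrim_le_zero hquad
    rw [discrim] at this
    nlinarith

/-- The coefficients of `(1 - X) ^ (-a)`. -/
noncomputable def binomCoeff (a : ℝ) : ℕ → ℝ
  | 0 => 1
  | n + 1 => binomCoeff a n * (a + n) / (n + 1)

/-- The power series `(1 - X) ^ (-a)`. -/
noncomputable def binomKernel (a : ℝ) : PowerSeries ℝ := PowerSeries.mk (binomCoeff a)

theorem binomCoeff_pos {a : ℝ} (ha : 0 < a) (n : ℕ) : 0 < binomCoeff a n := by
  induction n with
  | zero => simp [binomCoeff]
  | succ n ih => rw [binomCoeff]; positivity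

/-- The ratio of consecutive coefficients is (a + n)/(n + 1), which for 0 < a < 1 is below 1 and
increases with n. -/
theorem isKaluzaKernel_binomKernel {a : ℝ} (ha : a ∈ Ioo (0 : ℝ) 1) :
    IsKaluzaKernel (binomKernel a) := by
  obtain ⟨h0, h1⟩ := ha
  refine ⟨fun n => by simpa [binomKernel] using binomCoeff_pos h0 n, fun n => ?_, fun n => ?_⟩
  · simp only [binomKernel, coeff_mk]
    rw [binomCoeff, div_le_iff₀ (by positivity)]
    exact mul_le_mul_of_nonneg_left (by linarith) (binomCoeff_pos h0 n).le
  · simp only [binomKernel, coeff_mk]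
    have p := binomCoeff_pos h0 n
    rw [binomCoeff, binomCoeff]
    push_cast
    have : (a + n) / (n + 1) ≤ (a + (n + 1)) / (n + 1 + 1) := by
      rw [div_le_div_iff₀ (by positivity) (by positivity)]
      nlinarith
    rw [show binomCoeff a n * (binomCoeff a (n + 1) * (a + (n + 1)) / (n + 1 + 1)) =
      binomCoeff a n * binomCoeff a (n + 1) * ((a + (n + 1)) / (n + 1 + 1)) by ring,
      show (binomCoeff a n * (a + n) / (n + 1)) ^ 2 =
      binomCoeff a n * binomCoeff a (n + 1) * ((a + n) / (n + 1)) by rw [binomCoeff]; ring]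
    exact mul_le_mul_of_nonneg_left this (mul_pos p (binomCoeff_pos h0 _)).le

theorem binomKernel_mul_binomKernel (a : ℝ) :
    binomKernel a * binomKernel (1 - a) = PowerSeries.mk 1 := by
  have hrec : ∀ (a : ℝ) (n : ℕ), ((n : ℝ) + 1) * binomCoeff a (n + 1) = (a + n) * binomCoeff a n := by
    intro a n
    rw [binomCoeff]; field_simp
  ext n
  simp only [coeff_mul, binomKernel, coeff_mk, Pi.one_apply]
  induction n with
  | zero => simp [binomCoeff]
  | succ n ih =>
    have hn : ((n : ℝ) + 1) ≠ 0 := by positivity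
    refine mul_left_cancel₀ hn ?_
    -- Write n + 1 as the sum of the two indices and lower each index by the recursion. On the
    -- antidiagonal of order n the factors then add up to (a + i) + (1 - a + j) = n + 1, which
    -- reduces the sum to the induction hypothesis.
    have e1 : ((n : ℝ) + 1) * ∑ p ∈ antidiagonal (n + 1), binomCoeff a p.1 * binomCoeff (1 - a) p.2
        = ∑ p ∈ antidiagonal (n + 1), (p.1 : ℝ) * binomCoeff a p.1 * binomCoeff (1 - a) p.2
        + ∑ p ∈ antidiagonal (n + 1), binomCoeff a p.1 * ((p.2 : ℝ) * binomCoeff (1 - a) p.2) := by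
      rw [mul_sum, ← sum_add_distrib]
      refine sum_congr rfl fun p hp => ?_
      have : ((p.1 : ℝ) + p.2) = n + 1 := by exact_mod_cast mem_antidiagonal.1 hp
      rw [← this]; ring
    rw [e1, Nat.sum_antidiagonal_succ, Nat.sum_antidiagonal_succ']
    simp only [Nat.cast_zero, zero_mul, zero_add, mul_zero, Nat.cast_add, Nat.cast_one,
      hrec]
    rw [← sum_add_distrib]
    refine Eq.trans ?_ (congrArg (((n : ℝ) + 1) * ·) ih)
    simp only [mul_sum]
    refine sum_congr rfl fun p hp => ?_
    have : ((p.1 : ℝ) + p.2) = n := by exact_mod_cast mem_antidiagonal.1 hp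
    rw [← this]; ring

open Filter Topology

/-- The coefficient is a(a+1)⋯(a+n-1)/n!, so this is Gauss's limit formula for the Gamma function.
-/
theorem tendsto_rpow_mul_binomCoeff {a : ℝ} (ha : 0 < a) :
    Tendsto (fun n : ℕ => (n : ℝ) ^ (1 - a) * binomCoeff a n) atTop (𝓝 (Real.Gamma a)⁻¹) := by
  have hprod : ∀ n : ℕ, binomCoeff a n * n.factorial = ∏ j ∈ range n, (a + j) := by
    intro n
    induction n with
    | zero => simp [binomCoeff]
    | succ n ih =>
      rw [prod_range_succ, ← ih, binomCoeff, Nat.factorial_succ]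
      push_cast; field_simp
  have h1 : ∀ᶠ n : ℕ in atTop, (Real.GammaSeq a n)⁻¹ * (n / (a + n)) =
      (n : ℝ) ^ (1 - a) * binomCoeff a n := by
    filter_upwards [eventually_gt_atTop 0] with n hn
    have hn' : (0 : ℝ) < n := by exact_mod_cast hn
    have hp : 0 < (n : ℝ) ^ a := Real.rpow_pos_of_pos hn' a
    have hf : (0 : ℝ) < n.factorial := by exact_mod_cast n.factorial_pos
    rw [Real.GammaSeq, prod_range_succ, ← hprod, Real.rpow_sub hn', Real.rpow_one]
    field_simp
  refine Tendsto.congr' h1 ?_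
  have h2 : Tendsto (fun n : ℕ => (n : ℝ) / (a + n)) atTop (𝓝 1) := by
    have := tendsto_natCast_div_add_atTop (𝕜 := ℝ) a
    simpa [add_comm] using this
  simpa using ((Real.GammaSeq_tendsto_Gamma a).inv₀ (Real.Gamma_pos_of_pos ha).ne').mul h2

/-- The integral of the kernel `t ^ (a - 1) / Γ(a)` over the `i`-th unit cell. -/
noncomputable def cellWeight (a : ℝ) (i : ℕ) : ℝ :=
  (Real.Gamma a)⁻¹ * ∫ x in (i : ℝ)..i + 1, x ^ (a - 1)

theorem sum_cellWeight {a : ℝ} (ha : 0 < a) (n : ℕ) :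
    ∑ i ∈ range n, cellWeight a i = (n : ℝ) ^ a / Real.Gamma (a + 1) := by
  simp only [cellWeight]
  rw [← mul_sum]
  have := intervalIntegral.sum_integral_adjacent_intervals (μ := volume)
    (f := fun x : ℝ => x ^ (a - 1)) (a := fun i : ℕ => (i : ℝ)) (n := n)
    (fun k _ => intervalIntegrable_rpow_of_pos ha _ _)
  push_cast at this
  rw [this, integral_rpow_sub_one ha, Real.Gamma_add_one ha.ne', Real.zero_rpow ha.ne']
  have := (Real.Gamma_pos_of_pos ha).ne'
  field_simp
  simp

theorem tendsto_rpow_mul_cellWeight {a : ℝ} (ha : a ∈ Ioo (0 : ℝ) 1) :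
    Tendsto (fun n : ℕ => (n : ℝ) ^ (1 - a) * cellWeight a n) atTop (𝓝 (Real.Gamma a)⁻¹) := by
  have hlim : Tendsto (fun n : ℕ => ((n : ℝ) / (n + 1)) ^ (1 - a)) atTop (𝓝 1) := by
    have := (tendsto_natCast_div_add_atTop (𝕜 := ℝ) 1).rpow_const (p := 1 - a) (Or.inl one_ne_zero)
    simpa using this
  have hG := Real.Gamma_pos_of_pos ha.1
  refine tendsto_of_tendsto_of_tendsto_of_le_of_le' (g := fun n : ℕ =>
    (Real.Gamma a)⁻¹ * ((n : ℝ) / (n + 1)) ^ (1 - a)) (h := fun _ => (Real.Gamma a)⁻¹)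
    (by simpa using hlim.const_mul (Real.Gamma a)⁻¹) tendsto_const_nhds ?_ ?_
  all_goals
    filter_upwards [eventually_gt_atTop 0] with n hn
    have hn' : (0 : ℝ) < n := by exact_mod_cast hn
    have hle : (n : ℝ) ≤ n + 1 := by linarith
    rw [cellWeight, mul_left_comm]
  · refine mul_le_mul_of_nonneg_left ?_ (by positivity)
    have := intervalIntegral.integral_mono_on_of_le_Ioo hle
      (f := fun _ : ℝ => ((n : ℝ) + 1) ^ (a - 1)) (g := fun x => x ^ (a - 1))
      intervalIntegrable_const (intervalIntegrable_rpow_of_pos ha.1 _ _)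
      (fun x hx => Real.rpow_le_rpow_of_nonpos (by linarith [hx.1]) hx.2.le (by linarith [ha.2]))
    simp only [intervalIntegral.integral_const, add_sub_cancel_left, one_smul] at this
    rw [Real.div_rpow hn'.le (by positivity), div_eq_mul_inv, ← Real.rpow_neg (by positivity),
      neg_sub]
    exact mul_le_mul_of_nonneg_left this (by positivity)
  · have := intervalIntegral.integral_mono_on_of_le_Ioo hle
      (g := fun _ : ℝ => (n : ℝ) ^ (a - 1)) (f := fun x => x ^ (a - 1))
      (intervalIntegrable_rpow_of_pos ha.1 _ _) intervalIntegrable_const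
      (fun x hx => Real.rpow_le_rpow_of_nonpos hn' hx.1.le (by linarith [ha.2]))
    simp only [intervalIntegral.integral_const, add_sub_cancel_left, one_smul] at this
    have h3 : (n : ℝ) ^ (1 - a) * (n : ℝ) ^ (a - 1) = 1 := by
      rw [← Real.rpow_add hn']; simp
    have := mul_le_mul_of_nonneg_left this (Real.rpow_nonneg hn'.le (1 - a))
    rw [h3] at this
    exact (mul_le_mul_of_nonneg_left this (inv_pos.2 hG).le).trans_eq (mul_one _)

/-- Both weights are asymptotic to n^(a-1)/Γ(a), so their difference is little-o of the cell weight.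
The cell weights have divergent sums n^a/Γ(a+1), and little-o passes to such sums. This is the
consistency of convolution quadrature. -/
theorem tendsto_sum_abs_binomCoeff_sub_cellWeight {a : ℝ} (ha : a ∈ Ioo (0 : ℝ) 1) :
    Tendsto (fun n : ℕ => (∑ i ∈ range n, |binomCoeff a i - cellWeight a i|) / (n : ℝ) ^ a)
      atTop (𝓝 0) := by
  have hG := Real.Gamma_pos_of_pos ha.1
  have hG1 := Real.Gamma_pos_of_pos (show 0 < a + 1 by linarith [ha.1])
  have h1 := tendsto_rpow_mul_binomCoeff ha.1
  have h2 := tendsto_rpow_mul_cellWeight ha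
  have h3 : Tendsto (fun n : ℕ => (binomCoeff a n - cellWeight a n) / cellWeight a n)
      atTop (𝓝 0) := by
    have h4 := ((h1.sub h2).div h2 (inv_pos.2 hG).ne')
    rw [sub_self, zero_div] at h4
    refine h4.congr' ?_
    filter_upwards [eventually_gt_atTop 0] with n hn
    have hn' : (0 : ℝ) < n := by exact_mod_cast hn
    have := (Real.rpow_pos_of_pos hn' (1 - a)).ne'
    simp only [Pi.div_apply]
    rw [← mul_sub, mul_div_mul_left _ _ this]
  have hpos : ∀ n, 0 < cellWeight a n := by
    intro n
    refine mul_pos (inv_pos.2 hG) ?_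
    refine intervalIntegral.intervalIntegral_pos_of_pos_on (intervalIntegrable_rpow_of_pos ha.1 _ _)
      (fun x hx => ?_) (by linarith)
    have : (0 : ℝ) ≤ n := Nat.cast_nonneg n
    exact Real.rpow_pos_of_pos (by linarith [hx.1]) _
  have h5 : (fun n : ℕ => |binomCoeff a n - cellWeight a n|) =o[atTop] cellWeight a := by
    have := (Asymptotics.isLittleO_iff_tendsto (f := fun n => binomCoeff a n - cellWeight a n)
      (g := cellWeight a) (l := atTop) fun n hn => absurd hn (hpos n).ne').2 h3
    exact this.abs_left
  have htop : Tendsto (fun n : ℕ => (n : ℝ) ^ a) atTop atTop :=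
    (tendsto_rpow_atTop ha.1).comp tendsto_natCast_atTop_atTop
  have h6 := h5.sum_range (fun n => (hpos n).le) (by
    simp only [sum_cellWeight ha.1]
    exact htop.atTop_div_const hG1)
  simp only [sum_cellWeight ha.1] at h6
  have h7 := h6.tendsto_div_nhds_zero.div_const (Real.Gamma (a + 1))
  rw [zero_div] at h7
  refine h7.congr fun n => ?_
  field_simp

end Kernels

end TwoScaleFPE

/-! ### Riemann–Liouville integrals and their composition. -/

namespace TwoScaleFPE

/-- The Riemann-Liouville integral of order `a`. -/
noncomputable def fracInt (a : ℝ) (w : ℝ → ℝ) (t : ℝ) : ℝ :=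
  (Real.Gamma a)⁻¹ * ∫ ξ in (0 : ℝ)..t, (t - ξ) ^ (a - 1) * w ξ

section FracInt

variable {a : ℝ}

theorem intervalIntegrable_sub_rpow (ha : 0 < a) (t x y : ℝ) :
    IntervalIntegrable (fun ξ : ℝ => (t - ξ) ^ (a - 1)) volume x y := by
  simpa using (intervalIntegrable_rpow_of_pos ha (t - x) (t - y)).comp_sub_left t

theorem intervalIntegrable_sub_rpow_mul (ha : 0 < a) {w : ℝ → ℝ} {s t : ℝ} (t' : ℝ)
    (hw : ContinuousOn w (uIcc s t)) :
    IntervalIntegrable (fun ξ : ℝ => (t' - ξ) ^ (a - 1) * w ξ) volume s t :=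
  (intervalIntegrable_sub_rpow ha t' s t).mul_continuousOn hw

theorem fracInt_congr {w v : ℝ → ℝ} {t : ℝ} (ht : 0 ≤ t) (h : ∀ s ∈ Icc 0 t, w s = v s) :
    fracInt a w t = fracInt a v t := by
  unfold fracInt
  congr 1
  refine intervalIntegral.integral_congr fun s hs => ?_
  rw [uIcc_of_le ht] at hs
  simp only [h s hs]

theorem fracInt_sub (ha : 0 < a) {w v : ℝ → ℝ} {t : ℝ} (hw : ContinuousOn w (uIcc 0 t))
    (hv : ContinuousOn v (uIcc 0 t)) :
    fracInt a (fun s => w s - v s) t = fracInt a w t - fracInt a v t := by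
  unfold fracInt
  simp only [mul_sub]
  rw [intervalIntegral.integral_sub (intervalIntegrable_sub_rpow_mul ha t hw)
    (intervalIntegrable_sub_rpow_mul ha t hv), mul_sub]

theorem fracInt_add (ha : 0 < a) {w v : ℝ → ℝ} {t : ℝ} (hw : ContinuousOn w (uIcc 0 t))
    (hv : ContinuousOn v (uIcc 0 t)) :
    fracInt a (fun s => w s + v s) t = fracInt a w t + fracInt a v t := by
  unfold fracInt
  simp only [mul_add]
  rw [intervalIntegral.integral_add (intervalIntegrable_sub_rpow_mul ha t hw)
    (intervalIntegrable_sub_rpow_mul ha t hv), mul_add]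

theorem fracInt_const_mul (c : ℝ) (w : ℝ → ℝ) (t : ℝ) :
    fracInt a (fun s => c * w s) t = c * fracInt a w t := by
  unfold fracInt
  simp only [mul_left_comm _ c, intervalIntegral.integral_const_mul]

theorem fracInt_const (ha : 0 < a) (c t : ℝ) :
    fracInt a (fun _ => c) t = c * (t ^ a / Real.Gamma (a + 1)) := by
  unfold fracInt
  rw [intervalIntegral.integral_mul_const,
    intervalIntegral.integral_comp_sub_left (fun x : ℝ => x ^ (a - 1)) t, sub_self, sub_zero,
    integral_rpow_sub_one ha, Real.Gamma_add_one ha.ne', Real.zero_rpow ha.ne']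
  have := (Real.Gamma_pos_of_pos ha).ne'
  field_simp
  ring

theorem fracInt_mono (ha : 0 < a) {w v : ℝ → ℝ} {t : ℝ} (ht : 0 ≤ t)
    (hw : ContinuousOn w (Icc 0 t)) (hv : ContinuousOn v (Icc 0 t))
    (h : ∀ s ∈ Icc 0 t, w s ≤ v s) : fracInt a w t ≤ fracInt a v t := by
  rw [← uIcc_of_le ht] at hw hv
  have := Real.Gamma_pos_of_pos ha
  refine mul_le_mul_of_nonneg_left ?_ (by positivity)
  refine intervalIntegral.integral_mono_on ht (intervalIntegrable_sub_rpow_mul ha t hw)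
    (intervalIntegrable_sub_rpow_mul ha t hv) fun s hs => ?_
  exact mul_le_mul_of_nonneg_left (h s hs) (Real.rpow_nonneg (by linarith [hs.2]) _)

/-- Scaling of the Riemann-Liouville integral. -/
theorem fracInt_scale {τ : ℝ} (hτ : 0 < τ) (w : ℝ → ℝ) {x : ℝ} (hx : 0 ≤ x) :
    fracInt a w (τ * x) = τ ^ a * fracInt a (fun y => w (τ * y)) x := by
  unfold fracInt
  have h := intervalIntegral.integral_comp_mul_left
    (f := fun ξ => (τ * x - ξ) ^ (a - 1) * w ξ) (a := 0) (b := x) hτ.ne'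
  rw [mul_zero, smul_eq_mul, inv_mul_eq_div, eq_div_iff hτ.ne'] at h
  rw [← h, mul_left_comm (τ ^ a)]
  congr 1
  rw [← intervalIntegral.integral_mul_const, ← intervalIntegral.integral_const_mul]
  refine intervalIntegral.integral_congr fun s hs => ?_
  rw [uIcc_of_le hx] at hs
  simp only
  rw [← mul_sub, Real.mul_rpow hτ.le (by linarith [hs.2]), Real.rpow_sub_one hτ.ne']
  field_simp

/-- Associativity of the convolution on a half line. -/
theorem integral_triangle_swap {p q c : ℝ → ℝ} (hp : Measurable p) (hq : Measurable q)
    (hp0 : ∀ x, 0 < x → 0 ≤ p x) (hq0 : ∀ x, 0 < x → 0 ≤ q x) {t M : ℝ} (ht : 0 ≤ t)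
    (hpq : ∀ u ∈ Icc 0 t, IntervalIntegrable (fun s => p (u - s) * q s) volume 0 u)
    (hM : ∀ u ∈ Icc 0 t, ∫ s in (0 : ℝ)..u, p (u - s) * q s ≤ M)
    (hc : IntervalIntegrable c volume 0 t) :
    ∫ s in (0 : ℝ)..t, p (t - s) * ∫ r in (0 : ℝ)..s, q (s - r) * c r =
      ∫ r in (0 : ℝ)..t, (∫ s in (0 : ℝ)..(t - r), p (t - r - s) * q s) * c r := by
  set μ : Measure ℝ := volume.restrict (Ioc 0 t) with hμ
  -- The triangle r < s < t is encoded by an indicator, so that Fubini applies on a square. Its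
  -- boundary is discarded as a null set, because p and q are controlled only at positive arguments.
  set f : ℝ → ℝ → ℝ := fun s r => (Ioi r).indicator (fun s => p (t - s) * q (s - r)) s * c r with hf
  have hc' : Integrable c μ := (intervalIntegrable_iff_integrableOn_Ioc_of_le ht).1 hc
  have hinner : ∀ r ∈ Ioc 0 t, ∀ g : ℝ → ℝ,
      ∫ s, (Ioi r).indicator g s ∂μ = ∫ s in r..t, g s := by
    intro r hr g
    rw [integral_indicator measurableSet_Ioi, hμ, Measure.restrict_restrict measurableSet_Ioi,
      intervalIntegral.integral_of_le hr.2]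
    congr 2
    ext s; constructor
    · rintro ⟨h1, h2⟩; exact ⟨h1, h2.2⟩
    · rintro ⟨h1, h2⟩; exact ⟨h1, hr.1.trans h1, h2⟩
  have hshift : ∀ r, ∫ s in r..t, p (t - s) * q (s - r) =
      ∫ s in (0 : ℝ)..(t - r), p (t - r - s) * q s := by
    intro r
    have := intervalIntegral.integral_comp_sub_right
      (fun s => p (t - r - s) * q s) (a := r) (b := t) r
    simp only [sub_self, sub_sub_sub_cancel_right] at this
    exact this
  have hint : ∀ r ∈ Ioc 0 t,
      Integrable ((Ioi r).indicator fun s => p (t - s) * q (s - r)) μ := by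
    intro r hr
    rw [integrable_indicator_iff measurableSet_Ioi, IntegrableOn, hμ,
      Measure.restrict_restrict measurableSet_Ioi]
    have h1 := (hpq (t - r) ⟨by linarith [hr.2], by linarith [hr.1]⟩).comp_sub_right r
    simp only [zero_add, sub_add_cancel, sub_sub_sub_cancel_right] at h1
    refine ((intervalIntegrable_iff_integrableOn_Ioc_of_le hr.2).1 h1).mono_set ?_
    rintro s ⟨h1, h2⟩; exact ⟨h1, h2.2⟩
  have hmeas : AEStronglyMeasurable (Function.uncurry f) (μ.prod μ) := by
    have h1 : Measurable fun z : ℝ × ℝ =>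
        {z : ℝ × ℝ | z.2 < z.1}.indicator (fun z => p (t - z.1) * q (z.1 - z.2)) z :=
      (by fun_prop : Measurable fun z : ℝ × ℝ => p (t - z.1) * q (z.1 - z.2)).indicator
        (measurableSet_lt measurable_snd measurable_fst)
    have h2 : AEStronglyMeasurable (fun z : ℝ × ℝ => c z.2) (μ.prod μ) :=
      hc'.aestronglyMeasurable.comp_snd
    exact h1.aestronglyMeasurable.mul h2
  have hnn : ∀ r, ∀ s ∈ Ioo 0 t, 0 ≤ (Ioi r).indicator (fun s => p (t - s) * q (s - r)) s := by
    intro r s hs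
    by_cases h : s ∈ Ioi r
    · rw [indicator_of_mem h]
      exact mul_nonneg (hp0 _ (by linarith [hs.2])) (hq0 _ (sub_pos.2 h))
    · rw [indicator_of_notMem h]
  have hae : ∀ᵐ s ∂μ, s ∈ Ioo 0 t := by
    rw [hμ, ← restrict_Ioo_eq_restrict_Ioc]
    exact ae_restrict_mem measurableSet_Ioo
  -- Tonelli's test: for fixed r the integral of |f| over s is (p * q)(t - r)|c(r)| ≤ M|c(r)|, which
  -- is integrable.
  have hintf : Integrable (Function.uncurry f) (μ.prod μ) := by
    rw [integrable_prod_iff' hmeas]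
    constructor
    · filter_upwards [ae_restrict_mem (measurableSet_Ioc (a := (0 : ℝ)) (b := t))] with r hr
      exact (hint r hr).mul_const (c r)
    · refine Integrable.mono' (hc'.norm.const_mul M) hmeas.norm.prod_swap.integral_prod_right' ?_
      filter_upwards [ae_restrict_mem (measurableSet_Ioc (a := (0 : ℝ)) (b := t))] with r hr
      have e : ∫ s, ‖f s r‖ ∂μ =
          (∫ s in (0 : ℝ)..(t - r), p (t - r - s) * q s) * ‖c r‖ := by
        rw [← hshift, ← hinner r hr, ← integral_mul_const]
        refine integral_congr_ae ?_
        filter_upwards [hae] with s hs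
        rw [hf, norm_mul, Real.norm_of_nonneg (hnn r s hs)]
      have h0 : 0 ≤ ∫ s, ‖f s r‖ ∂μ := integral_nonneg fun s => norm_nonneg _
      change ‖∫ s, ‖f s r‖ ∂μ‖ ≤ _
      rw [Real.norm_of_nonneg h0, e]
      exact mul_le_mul_of_nonneg_right (hM _ ⟨by linarith [hr.2], by linarith [hr.1]⟩)
        (norm_nonneg _)
  have hswap := integral_integral_swap hintf
  rw [intervalIntegral.integral_of_le ht, intervalIntegral.integral_of_le ht]
  refine Eq.trans ?_ (hswap.trans ?_)
  · refine setIntegral_congr_fun measurableSet_Ioc fun s hs => ?_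
    change p (t - s) * _ = ∫ r, f s r ∂μ
    rw [intervalIntegral.integral_of_le hs.1.le, ← integral_const_mul]
    have : Ioc 0 s =ᵐ[volume] Ioo 0 s := Ioo_ae_eq_Ioc.symm
    rw [setIntegral_congr_set this, ← integral_indicator measurableSet_Ioo,
      ← integral_indicator measurableSet_Ioc]
    congr 1
    ext r
    by_cases hr : r ∈ Ioo 0 s
    · have h1 : r ∈ Ioc 0 t := ⟨hr.1, hr.2.le.trans hs.2⟩
      have h2 : s ∈ Ioi r := hr.2
      rw [indicator_of_mem hr, indicator_of_mem h1]
      simp only [f]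
      rw [indicator_of_mem h2, mul_assoc]
    · rw [indicator_of_notMem hr]
      by_cases h1 : r ∈ Ioc 0 t
      · have h2 : s ∉ Ioi r := fun h => hr ⟨h1.1, h⟩
        rw [indicator_of_mem h1]
        simp only [f]
        rw [indicator_of_notMem h2, zero_mul]
      · rw [indicator_of_notMem h1]
  · refine setIntegral_congr_fun measurableSet_Ioc fun r hr => ?_
    simp only [f]
    rw [integral_mul_const, hinner r hr, hshift]

theorem integral_sub_rpow_mul_rpow {a b : ℝ} (ha : 0 < a) (hb : 0 < b) {u : ℝ} (hu : 0 < u) :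
    ∫ s in (0 : ℝ)..u, (u - s) ^ (a - 1) * s ^ (b - 1) =
      u ^ (a + b - 1) * ProbabilityTheory.beta b a := by
  have h := Complex.betaIntegral_scaled (b : ℂ) (a : ℂ) hu
  have e1 : (∫ x in (0 : ℝ)..u, (x : ℂ) ^ ((b : ℂ) - 1) * ((u : ℂ) - x) ^ ((a : ℂ) - 1)) =
      ((∫ s in (0 : ℝ)..u, (u - s) ^ (a - 1) * s ^ (b - 1) : ℝ) : ℂ) := by
    rw [← intervalIntegral.integral_ofReal]
    refine intervalIntegral.integral_congr fun s hs => ?_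
    rw [uIcc_of_le hu.le] at hs
    rw [mul_comm, Complex.ofReal_mul, Complex.ofReal_cpow hs.1, Complex.ofReal_cpow (sub_nonneg.2 hs.2)]
    push_cast; rfl
  rw [e1] at h
  have h' := congrArg Complex.re h
  rw [Complex.ofReal_re] at h'
  rw [h', ProbabilityTheory.beta_eq_betaIntegralReal b a hb ha]
  have : ((u : ℂ) ^ ((b : ℂ) + a - 1)) = ((u ^ (a + b - 1) : ℝ) : ℂ) := by
    rw [Complex.ofReal_cpow hu.le]; push_cast; rw [add_comm (b : ℂ)]
  rw [this, Complex.re_ofReal_mul]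

theorem intervalIntegrable_sub_rpow_mul_rpow {a b : ℝ} (ha : 0 < a) (hb : 0 < b) {u : ℝ}
    (hu : 0 ≤ u) :
    IntervalIntegrable (fun s => (u - s) ^ (a - 1) * s ^ (b - 1)) volume 0 u := by
  rcases hu.eq_or_lt with rfl | hu
  · exact IntervalIntegrable.refl
  have h1 : IntervalIntegrable (fun s => (u - s) ^ (a - 1) * s ^ (b - 1)) volume 0 (u / 2) := by
    refine (intervalIntegrable_rpow_of_pos hb 0 (u / 2)).continuousOn_mul ?_
    rw [uIcc_of_le (by positivity)]
    exact (by fun_prop : ContinuousOn (fun s : ℝ => u - s) _).rpow_const fun s hs =>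
      Or.inl (by simp at hs; linarith)
  refine h1.trans ?_
  refine (intervalIntegrable_sub_rpow ha u (u / 2) u).mul_continuousOn ?_
  rw [uIcc_of_le (by linarith)]
  exact continuousOn_id.rpow_const fun s hs => Or.inl (by
    have := hs.1; simp only [id]; linarith)

/-- `I^a I^(1-a) w` is the integral of `w`. -/
theorem fracInt_fracInt_one_sub (ha : a ∈ Ioo (0 : ℝ) 1) {w : ℝ → ℝ} {t : ℝ} (ht : 0 ≤ t)
    (hw : IntervalIntegrable w volume 0 t) :
    fracInt a (fracInt (1 - a) w) t = ∫ s in (0 : ℝ)..t, w s := by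
  have hb : 0 < 1 - a := by linarith [ha.2]
  have hG := Real.Gamma_pos_of_pos ha.1
  have hG' := Real.Gamma_pos_of_pos hb
  -- The exponents of the Beta integral cancel the power of u, so the composed kernel is constant
  -- and the composition is plain integration.
  have hval : ∀ u, 0 < u → ∫ s in (0 : ℝ)..u, (u - s) ^ (a - 1) * s ^ (1 - a - 1) =
      Real.Gamma a * Real.Gamma (1 - a) := by
    intro u hu
    rw [integral_sub_rpow_mul_rpow ha.1 hb hu, ProbabilityTheory.beta]
    simp [mul_comm]
  have h := integral_triangle_swap (p := fun x => x ^ (a - 1)) (q := fun x => x ^ (1 - a - 1))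
    (c := w) (by fun_prop) (by fun_prop) (fun x hx => Real.rpow_nonneg hx.le _)
    (fun x hx => Real.rpow_nonneg hx.le _) (M := Real.Gamma a * Real.Gamma (1 - a)) ht
    (fun u hu => intervalIntegrable_sub_rpow_mul_rpow ha.1 hb hu.1)
    (fun u hu => by
      rcases hu.1.eq_or_lt with rfl | h0
      · simp; positivity
      · exact (hval u h0).le) hw
  have e : ∫ r in (0 : ℝ)..t, (∫ s in (0 : ℝ)..(t - r), (t - r - s) ^ (a - 1) * s ^ (1 - a - 1)) * w r
      = Real.Gamma a * Real.Gamma (1 - a) * ∫ r in (0 : ℝ)..t, w r := by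
    rw [← intervalIntegral.integral_const_mul, intervalIntegral.integral_of_le ht,
      intervalIntegral.integral_of_le ht, ← restrict_Ioo_eq_restrict_Ioc]
    refine setIntegral_congr_fun measurableSet_Ioo fun r hr => ?_
    rw [hval _ (by linarith [hr.2])]
  unfold fracInt
  simp only [mul_left_comm _ (Real.Gamma (1 - a))⁻¹, intervalIntegral.integral_const_mul]
  rw [h, e]
  field_simp

/-- `I^a (q * c) = (I^a q) * c` for a nonnegative continuous `q`. -/
theorem fracInt_conv (ha : 0 < a) {q c : ℝ → ℝ} (hq : Continuous q) (hq0 : ∀ x, 0 < x → 0 ≤ q x)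
    {t M : ℝ} (ht : 0 ≤ t) (hM : ∀ u ∈ Icc 0 t, fracInt a q u ≤ M)
    (hc : IntervalIntegrable c volume 0 t) :
    fracInt a (fun s => ∫ r in (0 : ℝ)..s, q (s - r) * c r) t =
      ∫ r in (0 : ℝ)..t, fracInt a q (t - r) * c r := by
  have hG := Real.Gamma_pos_of_pos ha
  have h := integral_triangle_swap (p := fun x => x ^ (a - 1)) (q := q)
    (c := c) (by fun_prop) hq.measurable (fun x hx => Real.rpow_nonneg hx.le _)
    hq0 (M := Real.Gamma a * M) ht
    (fun u hu => intervalIntegrable_sub_rpow_mul ha u hq.continuousOn)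
    (fun u hu => by
      have := hM u hu
      rwa [fracInt, inv_mul_le_iff₀ hG] at this) hc
  unfold fracInt
  rw [h, ← intervalIntegral.integral_const_mul]
  simp only [mul_assoc]

end FracInt

end TwoScaleFPE

/-! ### The scalar Volterra equation: uniqueness and the step response. -/

namespace TwoScaleFPE

section Volterra

variable {a l : ℝ}

theorem integrableOn_rpow_mul_exp_neg (ha : 0 < a) {μ : ℝ} (hμ : 0 < μ) :
    IntegrableOn (fun s : ℝ => s ^ (a - 1) * Real.exp (-(μ * s))) (Ioi 0) := by
  have h := Real.integral_rpow_mul_exp_neg_mul_Ioi ha hμ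
  by_contra hcon
  rw [integral_undef hcon] at h
  have := Real.Gamma_pos_of_pos ha
  have : 0 < (1 / μ) ^ a * Real.Gamma a := by positivity
  linarith

/-- With the weight e^(μt) the Volterra operator l·I^a has norm at most lμ^(-a). The choice μ = (2l
+ 1)^(1/a) makes this l/(2l + 1), hence a contraction with constant 1/2 on every interval at once.
-/
theorem exists_weight (ha : 0 < a) (hl : 0 ≤ l) : ∃ μ : ℝ, 1 ≤ μ ∧ l * (1 / μ) ^ a ≤ 1 / 2 := by
  refine ⟨(2 * l + 1) ^ a⁻¹, Real.one_le_rpow (by linarith) (by positivity), ?_⟩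
  rw [one_div, Real.inv_rpow (by positivity), Real.rpow_inv_rpow (by positivity) ha.ne',
    ← div_eq_mul_inv, div_le_div_iff₀ (by positivity) (by norm_num)]
  linarith

theorem fracInt_exp_le (ha : 0 < a) {μ : ℝ} (hμ : 0 < μ) {t : ℝ} (ht : 0 ≤ t) :
    fracInt a (fun s => Real.exp (μ * s)) t ≤ (1 / μ) ^ a * Real.exp (μ * t) := by
  have hG := Real.Gamma_pos_of_pos ha
  rw [fracInt, inv_mul_le_iff₀ hG]
  have h1 : ∫ ξ in (0 : ℝ)..t, (t - ξ) ^ (a - 1) * Real.exp (μ * ξ) =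
      Real.exp (μ * t) * ∫ x in (0 : ℝ)..t, x ^ (a - 1) * Real.exp (-(μ * x)) := by
    have := intervalIntegral.integral_comp_sub_left
      (fun x : ℝ => x ^ (a - 1) * Real.exp (-(μ * x))) t (a := 0) (b := t)
    rw [sub_self, sub_zero] at this
    rw [← this, ← intervalIntegral.integral_const_mul]
    congr 1
    ext ξ
    rw [mul_left_comm, ← Real.exp_add]
    congr 2
    ring
  rw [h1, intervalIntegral.integral_of_le ht]
  have h2 : ∫ x in Ioc 0 t, x ^ (a - 1) * Real.exp (-(μ * x)) ≤ (1 / μ) ^ a * Real.Gamma a := by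
    rw [← Real.integral_rpow_mul_exp_neg_mul_Ioi ha hμ]
    refine setIntegral_mono_set (integrableOn_rpow_mul_exp_neg ha hμ) ?_
      (LE.le.eventuallyLE fun x hx => hx.1)
    filter_upwards [ae_restrict_mem measurableSet_Ioi] with x hx
    exact mul_nonneg (Real.rpow_nonneg (le_of_lt hx) _) (Real.exp_pos _).le
  calc _ ≤ Real.exp (μ * t) * ((1 / μ) ^ a * Real.Gamma a) :=
        mul_le_mul_of_nonneg_left h2 (Real.exp_pos _).le
    _ = _ := by ring

theorem abs_fracInt_le (ha : 0 < a) {w v : ℝ → ℝ} {t : ℝ} (ht : 0 ≤ t)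
    (hw : ContinuousOn w (Icc 0 t)) (hv : ContinuousOn v (Icc 0 t))
    (h : ∀ s ∈ Icc 0 t, |w s| ≤ v s) : |fracInt a w t| ≤ fracInt a v t := by
  rw [abs_le]
  constructor
  · have := fracInt_mono (w := fun s => -v s) ha ht hv.neg hw (fun s hs => (abs_le.1 (h s hs)).1)
    have e := fracInt_const_mul (a := a) (-1) v t
    simp only [neg_one_mul] at e
    linarith
  · exact fracInt_mono ha ht hw hv (fun s hs => (abs_le.1 (h s hs)).2)

/-- Uniqueness for the linear Volterra equation. -/
theorem eq_zero_of_volterra (ha : 0 < a) (hl : 0 ≤ l) {T : ℝ} {w : ℝ → ℝ}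
    (hw : ContinuousOn w (Icc 0 T)) (h : ∀ t ∈ Icc 0 T, w t = -(l * fracInt a w t)) :
    ∀ t ∈ Icc 0 T, w t = 0 := by
  intro t₀ ht₀
  obtain ⟨μ, hμ1, hμ⟩ := exists_weight ha hl
  have hμ0 : 0 < μ := by linarith
  have hne : (Icc 0 T).Nonempty := ⟨t₀, ht₀⟩
  -- At a maximum of e^(-μt)|w(t)| the equation bounds this maximum by half of itself.
  obtain ⟨t, ht, hmax⟩ := isCompact_Icc.exists_isMaxOn hne
    (f := fun t => Real.exp (-(μ * t)) * |w t|)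
    ((by fun_prop : ContinuousOn (fun t : ℝ => Real.exp (-(μ * t))) _).mul hw.abs)
  set m := Real.exp (-(μ * t)) * |w t| with hm
  have hb : ∀ s ∈ Icc 0 T, |w s| ≤ m * Real.exp (μ * s) := by
    intro s hs
    have := hmax hs
    simp only [mem_ofPred_eq] at this
    have h2 := mul_le_mul_of_nonneg_right this (Real.exp_pos (μ * s)).le
    calc |w s| = Real.exp (-(μ * s)) * |w s| * Real.exp (μ * s) := by
          rw [mul_right_comm, ← Real.exp_add]; simp
      _ ≤ _ := h2
  have hm0 : 0 ≤ m := by positivity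
  have h3 : |fracInt a w t| ≤ m * ((1 / μ) ^ a * Real.exp (μ * t)) := by
    refine (abs_fracInt_le ha ht.1 (hw.mono (Icc_subset_Icc_right ht.2))
      (v := fun s => m * Real.exp (μ * s)) (by fun_prop)
      (fun s hs => hb s ⟨hs.1, hs.2.trans ht.2⟩)).trans ?_
    rw [fracInt_const_mul]
    exact mul_le_mul_of_nonneg_left (fracInt_exp_le ha hμ0 ht.1) hm0
  have h4 : |w t| ≤ m * Real.exp (μ * t) * (1 / 2) := by
    rw [h t ht, abs_neg, abs_mul, abs_of_nonneg hl]
    calc l * |fracInt a w t| ≤ l * (m * ((1 / μ) ^ a * Real.exp (μ * t))) :=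
          mul_le_mul_of_nonneg_left h3 hl
      _ = m * Real.exp (μ * t) * (l * (1 / μ) ^ a) := by ring
      _ ≤ _ := mul_le_mul_of_nonneg_left hμ (by positivity)
  have h5 : m * Real.exp (μ * t) = |w t| := by
    rw [hm, mul_right_comm, ← Real.exp_add]; simp
  have h6 : |w t| = 0 := le_antisymm (by linarith) (abs_nonneg _)
  have h7 : m = 0 := by rw [hm, h6, mul_zero]
  have := hb t₀ ht₀
  rw [h7, zero_mul] at this
  exact abs_nonpos_iff.1 this

/-- `Φ` solves the Volterra equation `Φ = I^a (1 - l Φ)`; thus `Φ(t) = t^a E_{a,a+1}(-l t^a)`. -/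
structure IsFracStep (a l : ℝ) (Φ : ℝ → ℝ) : Prop where
  continuous : Continuous Φ
  eq_zero : ∀ t ≤ 0, Φ t = 0
  eq_fracInt : ∀ t, 0 ≤ t → Φ t = fracInt a (fun s => 1 - l * Φ s) t

-- Banach's fixed point theorem for Ψ(t) = e^(-μt)Φ(t) in the bounded continuous functions on the
-- line, restricted to the closed set of functions vanishing for t ≤ 0. On that set convolution over
-- the half line is the same as integration over (0, t).
open BoundedContinuousFunction in
theorem exists_isFracStep (ha : 0 < a) (hl : 0 ≤ l) : ∃ Φ, IsFracStep a l Φ := by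
  obtain ⟨μ, hμ1, hμ⟩ := exists_weight ha hl
  have hμ0 : 0 < μ := by linarith
  have hG := Real.Gamma_pos_of_pos ha
  set k : ℝ → ℝ := fun s => s ^ (a - 1) * Real.exp (-(μ * s)) with hk
  have hki : IntegrableOn k (Ioi 0) := integrableOn_rpow_mul_exp_neg ha hμ0
  have hkint : ∫ s in Ioi 0, k s = (1 / μ) ^ a * Real.Gamma a :=
    Real.integral_rpow_mul_exp_neg_mul_Ioi ha hμ0
  have hk0 : ∀ s ∈ Ioi (0 : ℝ), 0 ≤ k s := fun s hs =>
    mul_nonneg (Real.rpow_nonneg (le_of_lt hs) _) (Real.exp_pos _).le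
  have hint : ∀ (Ψ : ℝ →ᵇ ℝ) (t : ℝ), IntegrableOn (fun s => k s * Ψ (t - s)) (Ioi 0) := by
    intro Ψ t
    refine Integrable.mul_bdd (c := ‖Ψ‖) hki
      (Continuous.aestronglyMeasurable (by fun_prop)) (Filter.Eventually.of_forall fun s => ?_)
    exact Ψ.norm_coe_le_norm _
  have hbound : ∀ (Ψ : ℝ →ᵇ ℝ) (t : ℝ), |∫ s in Ioi 0, k s * Ψ (t - s)| ≤
      (1 / μ) ^ a * Real.Gamma a * ‖Ψ‖ := by
    intro Ψ t
    rw [← hkint, ← integral_mul_const, ← Real.norm_eq_abs]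
    refine norm_integral_le_of_norm_le (hki.mul_const _) ?_
    filter_upwards [ae_restrict_mem measurableSet_Ioi] with s hs
    rw [norm_mul, Real.norm_of_nonneg (hk0 s hs)]
    exact mul_le_mul_of_nonneg_left (Ψ.norm_coe_le_norm _) (hk0 s hs)
  have hcont : ∀ Ψ : ℝ →ᵇ ℝ, Continuous fun t => ∫ s in Ioi 0, k s * Ψ (t - s) := by
    intro Ψ
    refine continuous_of_dominated (bound := fun s => k s * ‖Ψ‖)
      (fun t => (hint Ψ t).aestronglyMeasurable) (fun t => ?_) (hki.mul_const _)
      (Filter.Eventually.of_forall fun s => by fun_prop)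
    filter_upwards [ae_restrict_mem measurableSet_Ioi] with s hs
    rw [norm_mul, Real.norm_of_nonneg (hk0 s hs)]
    exact mul_le_mul_of_nonneg_left (Ψ.norm_coe_le_norm _) (hk0 s hs)
  have hG1 := Real.Gamma_pos_of_pos (show 0 < a + 1 by linarith)
  obtain ⟨c, hc⟩ : ∃ c : ℝ, ∀ t : ℝ, |(max t 0) ^ a / Real.Gamma (a + 1) * Real.exp (-(μ * t))| ≤ c := by
    have hcts : Continuous fun t : ℝ => (max t 0) ^ a / Real.Gamma (a + 1) * Real.exp (-(μ * t)) :=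
      (((continuous_id.max continuous_const).rpow_const fun t => Or.inr ha.le).div_const _).mul
        (by fun_prop)
    have hlim : Filter.Tendsto (fun t : ℝ => (max t 0) ^ a / Real.Gamma (a + 1) *
        Real.exp (-(μ * t))) Filter.atTop (nhds 0) := by
      have h1 := (tendsto_rpow_mul_exp_neg_mul_atTop_nhds_zero a μ hμ0).div_const
        (Real.Gamma (a + 1))
      rw [zero_div] at h1
      refine h1.congr' ?_
      filter_upwards [Filter.eventually_ge_atTop 0] with t ht
      rw [max_eq_left ht, neg_mul]; ring
    obtain ⟨A, hA⟩ := (Metric.tendsto_atTop.1 hlim) 1 one_pos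
    obtain ⟨c, hc⟩ := isCompact_Icc.exists_bound_of_continuousOn (s := Icc 0 A) hcts.continuousOn
    refine ⟨max c 1, fun t => ?_⟩
    rcases le_total t 0 with ht | ht
    · rw [max_eq_right ht, Real.zero_rpow ha.ne']; simp
    rcases le_total t A with htA | htA
    · exact (hc t ⟨ht, htA⟩).trans (le_max_left _ _)
    · have := (hA t htA).le
      rw [dist_zero_right] at this
      exact this.trans (le_max_right _ _)
  -- This is the weighted solution for l = 0, extended by zero to negative times by the truncation
  -- max(t, 0).
  set ψ : ℝ →ᵇ ℝ := BoundedContinuousFunction.ofNormedAddCommGroup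
    (fun t : ℝ => (max t 0) ^ a / Real.Gamma (a + 1) * Real.exp (-(μ * t)))
    ((((continuous_id.max continuous_const).rpow_const fun t => Or.inr ha.le).div_const _).mul
        (by fun_prop)) c hc with hψ
  set V : (ℝ →ᵇ ℝ) → (ℝ →ᵇ ℝ) := fun Ψ => BoundedContinuousFunction.ofNormedAddCommGroup
    (fun t => ∫ s in Ioi 0, k s * Ψ (t - s)) (hcont Ψ) _ (hbound Ψ) with hV
  set S : (ℝ →ᵇ ℝ) → (ℝ →ᵇ ℝ) := fun Ψ => ψ - (l * (Real.Gamma a)⁻¹) • V Ψ with hS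
  have hSdiff : ∀ Ψ₁ Ψ₂ : ℝ →ᵇ ℝ, dist (S Ψ₁) (S Ψ₂) ≤ 1 / 2 * dist Ψ₁ Ψ₂ := by
    intro Ψ₁ Ψ₂
    refine (BoundedContinuousFunction.dist_le (by positivity)).2 fun t => ?_
    have e : S Ψ₁ t - S Ψ₂ t =
        -((l * (Real.Gamma a)⁻¹) * ∫ s in Ioi 0, k s * (Ψ₁ - Ψ₂) (t - s)) := by
      have : ∫ s in Ioi 0, k s * (Ψ₁ - Ψ₂) (t - s) =
          (∫ s in Ioi 0, k s * Ψ₁ (t - s)) - ∫ s in Ioi 0, k s * Ψ₂ (t - s) := by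
        rw [← integral_sub (hint Ψ₁ t) (hint Ψ₂ t)]
        simp only [BoundedContinuousFunction.coe_sub, Pi.sub_apply, mul_sub]
      rw [this]
      simp only [hS, hV, BoundedContinuousFunction.coe_sub, Pi.sub_apply,
        BoundedContinuousFunction.coe_smul, BoundedContinuousFunction.coe_ofNormedAddCommGroup,
        smul_eq_mul]
      ring
    rw [Real.dist_eq, e, abs_neg, abs_mul, abs_of_nonneg (by positivity), dist_eq_norm]
    calc l * (Real.Gamma a)⁻¹ * |∫ s in Ioi 0, k s * (Ψ₁ - Ψ₂) (t - s)|
        ≤ l * (Real.Gamma a)⁻¹ * ((1 / μ) ^ a * Real.Gamma a * ‖Ψ₁ - Ψ₂‖) :=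
          mul_le_mul_of_nonneg_left (hbound _ t) (by positivity)
      _ = l * (1 / μ) ^ a * ‖Ψ₁ - Ψ₂‖ := by field_simp
      _ ≤ _ := mul_le_mul_of_nonneg_right hμ (norm_nonneg _)
  have hSc : ContractingWith (1 / 2) S :=
    ⟨by norm_num, LipschitzWith.of_dist_le_mul fun x y => by simpa using hSdiff x y⟩
  set Z : Set (ℝ →ᵇ ℝ) := {Ψ | ∀ t ≤ 0, Ψ t = 0} with hZ
  have hZc : IsClosed Z := by
    have : Z = ⋂ t ∈ Iic (0 : ℝ), {Ψ : ℝ →ᵇ ℝ | Ψ t = 0} := by ext; simp [hZ]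
    rw [this]
    refine isClosed_biInter fun t _ => isClosed_eq ?_ continuous_const
    exact continuous_eval_const t
  have hmaps : MapsTo S Z Z := by
    intro Ψ hΨ t ht
    have h1 : ∫ s in Ioi 0, k s * Ψ (t - s) = 0 := by
      refine setIntegral_eq_zero_of_forall_eq_zero fun s hs => ?_
      rw [hΨ (t - s) (by have : 0 < s := hs; linarith), mul_zero]
    simp only [hS, hV, hψ, BoundedContinuousFunction.coe_sub, Pi.sub_apply,
      BoundedContinuousFunction.coe_smul, BoundedContinuousFunction.coe_ofNormedAddCommGroup,
      smul_eq_mul, h1, max_eq_right ht, Real.zero_rpow ha.ne']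
    simp
  obtain ⟨Ψ, hΨZ, hfix, -⟩ := ContractingWith.exists_fixedPoint' hZc.isComplete hmaps
    (hSc.restrict hmaps) (x := 0) (fun t _ => rfl) (edist_ne_top _ _)
  have hfix' : ∀ t, Ψ t = (max t 0) ^ a / Real.Gamma (a + 1) * Real.exp (-(μ * t)) -
      (l * (Real.Gamma a)⁻¹) * ∫ s in Ioi 0, k s * Ψ (t - s) := by
    intro t
    have := DFunLike.congr_fun hfix.eq t
    rw [← this]
    rfl
  refine ⟨fun t => Real.exp (μ * t) * Ψ t, by fun_prop, fun t ht => ?_, fun t ht => ?_⟩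
  · simp only [hΨZ t ht, mul_zero]
  have hct : Continuous fun s : ℝ => l * (Real.exp (μ * s) * Ψ s) := by fun_prop
  rw [fracInt_sub ha continuousOn_const hct.continuousOn, fracInt_const ha, fracInt_const_mul,
    hfix' t, max_eq_left ht, one_mul, mul_sub]
  have h1 : ∫ s in Ioi 0, k s * Ψ (t - s) = ∫ s in (0 : ℝ)..t, k s * Ψ (t - s) := by
    rw [intervalIntegral.integral_of_le ht]
    refine setIntegral_eq_of_subset_of_forall_sdiff_eq_zero measurableSet_Ioi
      (fun x hx => hx.1) fun s hs => ?_
    have : t < s := by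
      by_contra hcon
      exact hs.2 ⟨hs.1, not_lt.1 hcon⟩
    rw [hΨZ (t - s) (by linarith), mul_zero]
  have h2 : Real.exp (μ * t) * ∫ s in (0 : ℝ)..t, k s * Ψ (t - s) =
      ∫ ξ in (0 : ℝ)..t, (t - ξ) ^ (a - 1) * (Real.exp (μ * ξ) * Ψ ξ) := by
    have := intervalIntegral.integral_comp_sub_left
      (fun x : ℝ => k x * Ψ (t - x)) t (a := 0) (b := t)
    rw [sub_self, sub_zero] at this
    rw [← this, ← intervalIntegral.integral_const_mul]
    congr 1
    ext ξ
    simp only [hk, sub_sub_cancel]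
    have : Real.exp (μ * ξ) = Real.exp (μ * t) * Real.exp (-(μ * (t - ξ))) := by
      rw [← Real.exp_add]; congr 1; ring
    rw [this]; ring
  have h3 : Real.exp (μ * t) * Real.exp (-(μ * t)) = 1 := by rw [← Real.exp_add]; simp
  rw [h1, fracInt, ← h2]
  linear_combination (t ^ a / Real.Gamma (a + 1)) * h3

/-- The scaling property of `IsFracStep`. -/
theorem IsFracStep.scale {Φ : ℝ → ℝ} (h : IsFracStep a l Φ) {τ : ℝ} (hτ : 0 < τ) :
    IsFracStep a (l * τ ^ a) fun x => (τ ^ a)⁻¹ * Φ (τ * x) := by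
  have hc := h.continuous
  have hp := Real.rpow_pos_of_pos hτ a
  refine ⟨by fun_prop, fun t ht => ?_, fun t ht => ?_⟩
  · simp only [h.eq_zero (τ * t) (mul_nonpos_of_nonneg_of_nonpos hτ.le ht), mul_zero]
  · rw [h.eq_fracInt _ (by positivity), fracInt_scale hτ _ ht, inv_mul_cancel_left₀ hp.ne']
    congr 1
    ext s
    field_simp

end Volterra

end TwoScaleFPE

/-! ### Convolution quadrature and the shape of the step response. -/

namespace TwoScaleFPE

section ConvolutionQuadrature

open PowerSeries Finset Filter Topology

variable {a l : ℝ}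

theorem binomCoeff_le_one (ha : a ∈ Set.Ioo (0 : ℝ) 1) (n : ℕ) : binomCoeff a n ≤ 1 := by
  have h : Antitone fun n => coeff n (binomKernel a) :=
    antitone_nat_of_succ_le (isKaluzaKernel_binomKernel ha).anti
  simpa [binomKernel, binomCoeff] using h (Nat.zero_le n)

/-- The weights `ω_i` of convolution quadrature approximate the Riemann-Liouville integral. -/
theorem abs_fracInt_sub_quadrature_le (ha : a ∈ Set.Ioo (0 : ℝ) 1) {F : ℝ → ℝ} (hF : Continuous F)
    {h η M : ℝ} (hh : 0 < h) {n : ℕ} (hM : ∀ t ∈ Set.Icc 0 (h * n), |F t| ≤ M)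
    (hη : ∀ s ∈ Set.Icc 0 (h * n), ∀ t ∈ Set.Icc 0 (h * n), |s - t| ≤ h → |F s - F t| ≤ η) :
    |fracInt a F (h * n) - h ^ a * ∑ i ∈ range (n + 1), binomCoeff a i * F (h * (n - i : ℕ))| ≤
      h ^ a * (η * ((n : ℝ) ^ a / Real.Gamma (a + 1))
        + (∑ i ∈ range n, |binomCoeff a i - cellWeight a i|) * M + M) := by
  have hp := Real.rpow_pos_of_pos hh a
  have hG := Real.Gamma_pos_of_pos ha.1
  rw [fracInt_scale hh F (Nat.cast_nonneg n), ← mul_sub, abs_mul, abs_of_pos hp]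
  refine mul_le_mul_of_nonneg_left ?_ hp.le
  have hii : ∀ k : ℕ, IntervalIntegrable (fun x : ℝ => x ^ (a - 1) * F (h * (n - x))) volume
      (k : ℝ) ((k + 1 : ℕ) : ℝ) := fun k =>
    (intervalIntegrable_rpow_of_pos ha.1 _ _).mul_continuousOn (by fun_prop)
  have e1 : fracInt a (fun y => F (h * y)) n = ∑ i ∈ range n, (Real.Gamma a)⁻¹ *
      ∫ x in (i : ℝ)..(i + 1 : ℕ), x ^ (a - 1) * F (h * (n - x)) := by
    rw [fracInt, ← mul_sum]
    have h1 := intervalIntegral.sum_integral_adjacent_intervals (μ := volume)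
      (f := fun x : ℝ => x ^ (a - 1) * F (h * (n - x))) (a := fun i : ℕ => (i : ℝ)) (n := n)
      (fun k _ => hii k)
    rw [h1]
    have := intervalIntegral.integral_comp_sub_left
      (fun x : ℝ => x ^ (a - 1) * F (h * (n - x))) (n : ℝ) (a := 0) (b := n)
    rw [sub_self, sub_zero] at this
    simp only [sub_sub_cancel] at this
    rw [this, Nat.cast_zero]
  -- The quadrature has n + 1 nodes but there are only n cells. The last node, at time 0, is split
  -- off and costs M, since its weight is at most 1.
  rw [e1, sum_range_succ, ← sub_sub, ← sum_sub_distrib]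
  refine (abs_sub _ _).trans (add_le_add ?_ ?_)
  · rw [← sum_cellWeight ha.1, mul_sum, sum_mul, ← sum_add_distrib]
    refine (abs_sum_le_sum_abs _ _).trans (sum_le_sum fun i hi => ?_)
    have hi' : i + 1 ≤ n := mem_range.1 hi
    have hi2 : ((i : ℝ) + 1) ≤ n := by exact_mod_cast hi'
    have hi0 : (0 : ℝ) ≤ i := Nat.cast_nonneg i
    have hsub : ((n - i : ℕ) : ℝ) = n - i := by rw [Nat.cast_sub (by omega)]
    rw [hsub]
    have hmem : ∀ x ∈ Set.Icc (i : ℝ) (i + 1), h * (n - x) ∈ Set.Icc 0 (h * n) := fun x hx =>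
      ⟨mul_nonneg hh.le (by linarith [hx.2]),
        mul_le_mul_of_nonneg_left (by linarith [hx.1]) hh.le⟩
    -- Freezing F at one end of a cell costs its oscillation η times the cell weight; replacing the
    -- cell weight by the quadrature weight is the second contribution.
    have hcell : |(Real.Gamma a)⁻¹ * (∫ x in (i : ℝ)..(i + 1 : ℕ), x ^ (a - 1) * F (h * (n - x)))
        - cellWeight a i * F (h * (n - i))| ≤ η * cellWeight a i := by
      rw [cellWeight, mul_assoc, ← intervalIntegral.integral_mul_const, mul_left_comm η,
        ← intervalIntegral.integral_const_mul η, Nat.cast_add, Nat.cast_one, ← mul_sub, abs_mul,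
        abs_of_pos (inv_pos.2 hG)]
      refine mul_le_mul_of_nonneg_left ?_ (inv_pos.2 hG).le
      have hii' := hii i
      push_cast at hii'
      rw [← intervalIntegral.integral_sub hii'
        ((intervalIntegrable_rpow_of_pos ha.1 _ _).mul_const _)]
      rw [← Real.norm_eq_abs]
      refine intervalIntegral.norm_integral_le_of_norm_le (by linarith) ?_
        ((intervalIntegrable_rpow_of_pos ha.1 _ _).const_mul η)
      filter_upwards with x hx
      rw [← mul_sub, norm_mul, Real.norm_of_nonneg (Real.rpow_nonneg (by linarith [hx.1]) _),
        mul_comm]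
      refine mul_le_mul_of_nonneg_right ?_ (Real.rpow_nonneg (by linarith [hx.1]) _)
      refine hη _ (hmem x ⟨hx.1.le, hx.2⟩) _ (hmem i ⟨le_rfl, by linarith⟩) ?_
      rw [← mul_sub, abs_mul, abs_of_pos hh]
      have : |(n : ℝ) - x - (n - i)| ≤ 1 := by rw [abs_le]; constructor <;> linarith [hx.1, hx.2]
      exact (mul_le_mul_of_nonneg_left this hh.le).trans_eq (mul_one h)
    have e2 : (Real.Gamma a)⁻¹ * (∫ x in (i : ℝ)..(i + 1 : ℕ), x ^ (a - 1) * F (h * (n - x)))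
        - binomCoeff a i * F (h * (n - i)) =
        ((Real.Gamma a)⁻¹ * (∫ x in (i : ℝ)..(i + 1 : ℕ), x ^ (a - 1) * F (h * (n - x)))
        - cellWeight a i * F (h * (n - i))) - (binomCoeff a i - cellWeight a i) * F (h * (n - i)) := by
      ring
    rw [e2]
    refine (abs_sub _ _).trans (add_le_add hcell ?_)
    rw [abs_mul]
    exact mul_le_mul_of_nonneg_left (hM _ (hmem i ⟨le_rfl, by linarith⟩)) (abs_nonneg _)
  · rw [abs_mul, abs_of_pos (binomCoeff_pos ha.1 n), Nat.sub_self, Nat.cast_zero, mul_zero]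
    have := hM 0 ⟨le_rfl, by positivity⟩
    exact (mul_le_mul (binomCoeff_le_one ha n) this (abs_nonneg _) zero_le_one).trans_eq (one_mul M)

/-- Since (1 - X)(1 - X)^(a-1) = (1 - X)^a is the inverse of the quadrature series, the implicit
scheme has a resolvent of the form `discreteResolvent`, with kernel (1 - X)^(a-1). -/
theorem isKaluzaKernel_cq (ha : a ∈ Set.Ioo (0 : ℝ) 1) : IsKaluzaKernel (binomKernel (1 - a)) :=
  isKaluzaKernel_binomKernel ⟨by linarith [ha.2], by linarith [ha.1]⟩

/-- The convolution quadrature approximation of the solution of `Φ = I^a (1 - l Φ)`. -/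
noncomputable def cqStep (a l h : ℝ) (n : ℕ) : ℝ :=
  h ^ a * ∑ i ∈ range (n + 1), coeff i (discreteResolvent (binomKernel (1 - a)) (l * h ^ a))

/-- Stability of convolution quadrature. -/
theorem abs_sub_cqStep_le (ha : a ∈ Set.Ioo (0 : ℝ) 1) (hl : 0 ≤ l) {h ε : ℝ} (hh : 0 < h)
    {y : ℕ → ℝ} {N : ℕ} (hy : ∀ n ≤ N, |y n - h ^ a * ∑ i ∈ range (n + 1),
      binomCoeff a i * (1 - l * y (n - i))| ≤ ε) {n : ℕ} (hn : n ≤ N) :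
    |y n - cqStep a l h n| ≤ 2 * ε := by
  have hp := Real.rpow_pos_of_pos hh a
  have hB := isKaluzaKernel_cq ha
  have hμ : 0 ≤ l * h ^ a := by positivity
  set B := binomKernel (1 - a) with hBdef
  set W := binomKernel a
  set μ := l * h ^ a with hμdef
  set G := discreteResolvent B μ with hGdef
  have hBW : W * B = PowerSeries.mk 1 := binomKernel_mul_binomKernel a
  have h1X := PowerSeries.mk_one_mul_one_sub_eq_one ℝ
  have hG1 : ((1 - X) * B + C μ) * G = 1 := mul_discreteResolvent hB hμ
  have hGW : (1 + C μ * W) * G = W := by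
    calc (1 + C μ * W) * G = (PowerSeries.mk 1 * (1 - X) + C μ * W) * G := by rw [h1X]
      _ = W * (((1 - X) * B + C μ) * G) := by rw [← hBW]; ring
      _ = W := by rw [hG1, mul_one]
  set Y := PowerSeries.mk y with hY
  set δ := Y - C (h ^ a) * (W * (PowerSeries.mk 1 - C l * Y)) with hδ
  have hcoef : ∀ m, coeff m δ = y m - h ^ a * ∑ i ∈ range (m + 1),
      binomCoeff a i * (1 - l * y (m - i)) := by
    intro m
    rw [hδ, map_sub, coeff_C_mul, coeff_mul, Nat.sum_antidiagonal_eq_sum_range_succ_mk]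
    simp only [hY, W, binomKernel, coeff_mk, map_sub, coeff_C_mul, Pi.one_apply]
  -- The error satisfies (1 + μW)·error = δ, and 1 - μG is the inverse of 1 + μW. As G ≥ 0 and μ∑G ≤
  -- 1, this inverse amplifies the defect by at most 2, uniformly in μ.
  have hE : Y - C (h ^ a) * (PowerSeries.mk 1 * G) = (1 - C μ * G) * δ := by
    have hμC : C μ = C l * C (h ^ a) := by rw [hμdef, map_mul]
    have e1 : δ = (1 + C μ * W) * (Y - C (h ^ a) * (PowerSeries.mk 1 * G)) := by
      have : (1 + C μ * W) * (C (h ^ a) * (PowerSeries.mk 1 * G)) =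
          C (h ^ a) * PowerSeries.mk 1 * W := by
        nth_rewrite 2 [← hGW]; ring
      rw [mul_sub, this, hδ, hμC]; ring
    have e2 : (1 - C μ * G) * (1 + C μ * W) = 1 := by
      have : (1 - C μ * G) * (1 + C μ * W) = 1 + C μ * W - C μ * ((1 + C μ * W) * G) := by ring
      rw [this, hGW]; ring
    rw [e1, ← mul_assoc (1 - C μ * G), e2, one_mul]
  have hEn := congrArg (coeff n) hE
  rw [map_sub, coeff_C_mul, coeff_mk_one_mul, sub_mul, map_sub, one_mul, mul_assoc, coeff_C_mul,
    coeff_mul, Nat.sum_antidiagonal_eq_sum_range_succ_mk, hY, coeff_mk] at hEn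
  change y n - cqStep a l h n = _ at hEn
  rw [hEn]
  have hε : ∀ m ≤ N, |coeff m δ| ≤ ε := fun m hm => by rw [hcoef]; exact hy m hm
  have hε0 : 0 ≤ ε := (abs_nonneg _).trans (hε n hn)
  have h2 : |μ * ∑ k ∈ range (n + 1), coeff k G * coeff (n - k) δ| ≤ ε := by
    rw [abs_mul, abs_of_nonneg hμ]
    calc μ * |∑ k ∈ range (n + 1), coeff k G * coeff (n - k) δ|
        ≤ μ * ∑ k ∈ range (n + 1), coeff k G * ε := by
          refine mul_le_mul_of_nonneg_left ((abs_sum_le_sum_abs _ _).trans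
            (sum_le_sum fun k _ => ?_)) hμ
          rw [abs_mul, abs_of_nonneg (discreteResolvent_nonneg hB hμ k)]
          exact mul_le_mul_of_nonneg_left (hε _ (by omega)) (discreteResolvent_nonneg hB hμ k)
      _ = (μ * ∑ k ∈ range (n + 1), coeff k G) * ε := by rw [← sum_mul, mul_assoc μ]
      _ ≤ 1 * ε := mul_le_mul_of_nonneg_right (mul_sum_discreteResolvent_le_one hB hμ _) hε0
      _ = ε := one_mul ε
  have := hε n hn
  exact (abs_sub _ _).trans (by linarith)

/-- Uniform convergence of convolution quadrature on the grid of `[0, T]`. -/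
theorem IsFracStep.eventually_abs_sub_cqStep_le (ha : a ∈ Set.Ioo (0 : ℝ) 1) (hl : 0 ≤ l)
    {Φ : ℝ → ℝ} (hΦ : IsFracStep a l Φ) {T ε : ℝ} (hT : 0 < T) (hε : 0 < ε) :
    ∀ᶠ N : ℕ in atTop, ∀ n ≤ N, |Φ (T / N * n) - cqStep a l (T / N) n| ≤ ε := by
  set F : ℝ → ℝ := fun s => 1 - l * Φ s with hFdef
  have hFc : Continuous F := by have := hΦ.continuous; fun_prop
  obtain ⟨M, hM⟩ := isCompact_Icc.exists_bound_of_continuousOn (s := Set.Icc 0 T) hFc.continuousOn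
  have hG1 := Real.Gamma_pos_of_pos (show 0 < a + 1 by linarith [ha.1])
  have hTa := Real.rpow_pos_of_pos hT a
  -- The oscillation term contributes at most ε/8 with this η; the weight error and the extra node
  -- contribute ε/8 each for large N. The defect is then below ε/2, and stability doubles it.
  set η := ε / 8 * (Real.Gamma (a + 1) / T ^ a) with hη
  have hη0 : 0 < η := by positivity
  obtain ⟨δ, hδ0, hδ⟩ := Metric.uniformContinuousOn_iff.1
    (isCompact_Icc.uniformContinuousOn_of_continuous (s := Set.Icc 0 T) hFc.continuousOn) η hη0
  have hA := ((tendsto_sum_abs_binomCoeff_sub_cellWeight ha).mul_const (T ^ a * M))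
  rw [zero_mul] at hA
  have hB : Tendsto (fun N : ℕ => T ^ a * M / (N : ℝ) ^ a) atTop (𝓝 0) :=
    tendsto_const_nhds.div_atTop ((tendsto_rpow_atTop ha.1).comp tendsto_natCast_atTop_atTop)
  filter_upwards [hA.eventually_le_const (show 0 < ε / 8 by positivity),
    hB.eventually_le_const (show 0 < ε / 8 by positivity), eventually_gt_atTop 0,
    (tendsto_const_div_atTop_nhds_zero_nat T).eventually_lt_const hδ0] with N h1 h2 hN hδN n hn
  have hN' : (0 : ℝ) < N := by exact_mod_cast hN
  set h := T / N with hh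
  have hh0 : 0 < h := by positivity
  have hhN : h * N = T := by rw [hh]; field_simp
  have hha : h ^ a = T ^ a / (N : ℝ) ^ a := Real.div_rpow hT.le hN'.le a
  have hNa := Real.rpow_pos_of_pos hN' a
  have := abs_sub_cqStep_le (y := fun n => Φ (h * n)) (N := N) (ε := ε / 2) ha hl hh0 ?_ hn
  · simpa using (this.trans_eq (by ring))
  intro m hm
  have hmN : (m : ℝ) ≤ N := by exact_mod_cast hm
  have hle : h * m ≤ T := by rw [← hhN]; exact mul_le_mul_of_nonneg_left hmN hh0.le
  have hM0 : 0 ≤ M := (norm_nonneg _).trans (hM 0 ⟨le_rfl, hT.le⟩)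
  have key := abs_fracInt_sub_quadrature_le (η := η) (M := M) ha hFc hh0 (n := m)
    (fun t ht => hM t ⟨ht.1, ht.2.trans hle⟩)
    (fun s hs t ht hst => (hδ s ⟨hs.1, hs.2.trans hle⟩ t ⟨ht.1, ht.2.trans hle⟩
      (lt_of_le_of_lt hst hδN)).le)
  rw [hΦ.eq_fracInt (h * m) (by positivity)]
  refine key.trans ?_
  have hsum : ∑ i ∈ range m, |binomCoeff a i - cellWeight a i| ≤
      ∑ i ∈ range N, |binomCoeff a i - cellWeight a i| :=
    sum_le_sum_of_subset_of_nonneg (range_mono hm) fun _ _ _ => abs_nonneg _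
  have hma : (m : ℝ) ^ a ≤ (N : ℝ) ^ a := Real.rpow_le_rpow (Nat.cast_nonneg m) hmN ha.1.le
  calc h ^ a * (η * ((m : ℝ) ^ a / Real.Gamma (a + 1))
        + (∑ i ∈ range m, |binomCoeff a i - cellWeight a i|) * M + M)
      ≤ h ^ a * (η * ((N : ℝ) ^ a / Real.Gamma (a + 1))
        + (∑ i ∈ range N, |binomCoeff a i - cellWeight a i|) * M + M) := by gcongr
    _ = ε / 8 + (∑ i ∈ range N, |binomCoeff a i - cellWeight a i|) / (N : ℝ) ^ a * (T ^ a * M)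
        + T ^ a * M / (N : ℝ) ^ a := by
        rw [hha, hη]; field_simp
    _ ≤ ε / 2 := by linarith

/-- Rounding x down to the grid moves it by o(1), so uniform convergence on the grid and continuity
of Φ give pointwise convergence. Order and slope inequalities of the discrete step response can thus
be passed to the limit. -/
theorem IsFracStep.tendsto_cqStep (ha : a ∈ Set.Ioo (0 : ℝ) 1) (hl : 0 ≤ l)
    {Φ : ℝ → ℝ} (hΦ : IsFracStep a l Φ) {T x : ℝ} (hT : 0 < T) (hx : x ∈ Set.Icc 0 T) :
    Tendsto (fun N : ℕ => T / N * ⌊x / T * N⌋₊) atTop (𝓝 x) ∧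
    Tendsto (fun N : ℕ => cqStep a l (T / N) ⌊x / T * N⌋₊) atTop (𝓝 (Φ x)) := by
  have h0 : 0 ≤ x / T := div_nonneg hx.1 hT.le
  have h1 : Tendsto (fun N : ℕ => T / N * ⌊x / T * N⌋₊) atTop (𝓝 x) := by
    have := ((tendsto_nat_floor_mul_div_atTop h0).comp
      (tendsto_natCast_atTop_atTop (R := ℝ))).const_mul T
    rw [mul_div_cancel₀ _ hT.ne'] at this
    refine this.congr fun N => ?_
    simp only [Function.comp]
    ring
  refine ⟨h1, ?_⟩
  have h2 := (hΦ.continuous.tendsto x).comp h1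
  rw [Metric.tendsto_atTop] at h2 ⊢
  intro ε hε
  obtain ⟨N₁, hN₁⟩ := h2 (ε / 2) (by positivity)
  obtain ⟨N₂, hN₂⟩ := eventually_atTop.1
    (hΦ.eventually_abs_sub_cqStep_le ha hl hT (show 0 < ε / 4 by positivity))
  refine ⟨max N₁ N₂, fun N hN => ?_⟩
  have e1 := hN₁ N (le_trans (le_max_left _ _) hN)
  have hfl : ⌊x / T * N⌋₊ ≤ N := by
    refine Nat.floor_le_of_le ?_
    have : x / T ≤ 1 := (div_le_one hT).2 hx.2
    nlinarith [(Nat.cast_nonneg N : (0 : ℝ) ≤ N)]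
  have e2 := hN₂ N (le_trans (le_max_right _ _) hN) _ hfl
  simp only [Function.comp, Real.dist_eq] at e1 ⊢
  rw [abs_lt] at e1 ⊢
  rw [abs_le] at e2
  constructor <;> linarith

theorem IsFracStep.monotoneOn (ha : a ∈ Set.Ioo (0 : ℝ) 1) (hl : 0 ≤ l)
    {Φ : ℝ → ℝ} (hΦ : IsFracStep a l Φ) : MonotoneOn Φ (Set.Ici 0) := by
  intro x hx y hy hxy
  have hT : 0 < y + 1 := by have : 0 ≤ y := hy; linarith
  refine le_of_tendsto_of_tendsto' (hΦ.tendsto_cqStep ha hl hT ⟨hx, by linarith⟩).2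
    (hΦ.tendsto_cqStep ha hl hT ⟨hy, by linarith⟩).2 fun N => ?_
  have hp : 0 ≤ ((y + 1) / (N : ℝ)) ^ a := Real.rpow_nonneg (by positivity) a
  refine mul_le_mul_of_nonneg_left ?_ hp
  refine sum_le_sum_of_subset_of_nonneg (range_mono ?_) fun i _ _ =>
    discreteResolvent_nonneg (isKaluzaKernel_cq ha) (by positivity) i
  gcongr

/-- Limit of the discrete bound μ∑G ≤ 1. -/
theorem IsFracStep.mul_le_one (ha : a ∈ Set.Ioo (0 : ℝ) 1) (hl : 0 ≤ l)
    {Φ : ℝ → ℝ} (hΦ : IsFracStep a l Φ) (t : ℝ) : l * Φ t ≤ 1 := by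
  rcases le_total t 0 with ht | ht
  · rw [hΦ.eq_zero t ht]; simp
  have hT : 0 < t + 1 := by linarith
  refine le_of_tendsto' ((hΦ.tendsto_cqStep ha hl hT ⟨ht, by linarith⟩).2.const_mul l) fun N => ?_
  rw [cqStep, ← mul_assoc]
  exact mul_sum_discreteResolvent_le_one (isKaluzaKernel_cq ha) (by positivity) _

theorem IsFracStep.nonneg (ha : a ∈ Set.Ioo (0 : ℝ) 1) (hl : 0 ≤ l)
    {Φ : ℝ → ℝ} (hΦ : IsFracStep a l Φ) (t : ℝ) : 0 ≤ Φ t := by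
  rcases le_total t 0 with ht | ht
  · rw [hΦ.eq_zero t ht]
  · rw [← hΦ.eq_zero 0 le_rfl]
    exact hΦ.monotoneOn ha hl (Set.mem_Ici.2 le_rfl) ht ht

theorem IsFracStep.monotone (ha : a ∈ Set.Ioo (0 : ℝ) 1) (hl : 0 ≤ l)
    {Φ : ℝ → ℝ} (hΦ : IsFracStep a l Φ) : Monotone Φ := by
  intro x y hxy
  rcases le_total x 0 with hx | hx
  · rw [hΦ.eq_zero x hx]; exact hΦ.nonneg ha hl y
  · exact hΦ.monotoneOn ha hl hx (hx.trans hxy) hxy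

theorem IsFracStep.le_rpow (ha : a ∈ Set.Ioo (0 : ℝ) 1) (hl : 0 ≤ l)
    {Φ : ℝ → ℝ} (hΦ : IsFracStep a l Φ) {t : ℝ} (ht : 0 ≤ t) :
    Φ t ≤ t ^ a / Real.Gamma (a + 1) := by
  have hc := hΦ.continuous
  rw [hΦ.eq_fracInt t ht, ← one_mul (t ^ a / _), ← fracInt_const ha.1]
  refine fracInt_mono ha.1 ht (by fun_prop) (by fun_prop) fun s _ => ?_
  have := mul_nonneg hl (hΦ.nonneg ha hl s)
  linarith

/-- Discrete concavity: every summand after index q is at most G q, and every summand between p and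
q is at least G q. -/
theorem sum_slope_anti {G : ℕ → ℝ} (hG : Antitone G) {p q r : ℕ} (hpq : p ≤ q) (hqr : q ≤ r) :
    ((q : ℝ) - p) * (∑ i ∈ range (r + 1), G i - ∑ i ∈ range (q + 1), G i) ≤
      ((r : ℝ) - q) * (∑ i ∈ range (q + 1), G i - ∑ i ∈ range (p + 1), G i) := by
  have h1 : ∑ i ∈ range (r + 1), G i - ∑ i ∈ range (q + 1), G i ≤ ((r : ℝ) - q) * G q := by
    rw [← sum_Ico_eq_sub _ (by omega)]
    have := sum_le_card_nsmul (Finset.Ico (q + 1) (r + 1)) G (G q) fun i hi =>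
      hG (by have := Finset.mem_Ico.1 hi; omega)
    simpa [Nat.cast_sub hqr] using this
  have h2 : ((q : ℝ) - p) * G q ≤ ∑ i ∈ range (q + 1), G i - ∑ i ∈ range (p + 1), G i := by
    rw [← sum_Ico_eq_sub _ (by omega)]
    have := card_nsmul_le_sum (Finset.Ico (p + 1) (q + 1)) G (G q) fun i hi =>
      hG (by have := Finset.mem_Ico.1 hi; omega)
    simpa [Nat.cast_sub hpq] using this
  have hpq' : (0 : ℝ) ≤ q - p := sub_nonneg.2 (by exact_mod_cast hpq)
  have hqr' : (0 : ℝ) ≤ r - q := sub_nonneg.2 (by exact_mod_cast hqr)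
  calc _ ≤ ((q : ℝ) - p) * (((r : ℝ) - q) * G q) := mul_le_mul_of_nonneg_left h1 hpq'
    _ = ((r : ℝ) - q) * (((q : ℝ) - p) * G q) := by ring
    _ ≤ _ := mul_le_mul_of_nonneg_left h2 hqr'

/-- The discrete step responses are partial sums of a nonincreasing sequence, hence discretely
concave, and slope comparison is closed under limits. This is where Kaluza's theorem reaches the
continuous problem. -/
theorem IsFracStep.concaveOn (ha : a ∈ Set.Ioo (0 : ℝ) 1) (hl : 0 ≤ l)
    {Φ : ℝ → ℝ} (hΦ : IsFracStep a l Φ) : ConcaveOn ℝ (Set.Ici 0) Φ := by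
  refine concaveOn_of_slope_anti_adjacent (convex_Ici 0) fun {x y z} hx hz hxy hyz => ?_
  have hx0 : 0 ≤ x := hx
  rw [div_le_div_iff₀ (by linarith) (by linarith), mul_comm, mul_comm (Φ y - Φ x)]
  have hT : 0 < z + 1 := by linarith
  obtain ⟨x1, x2⟩ := hΦ.tendsto_cqStep ha hl hT (x := x) ⟨hx0, by linarith⟩
  obtain ⟨y1, y2⟩ := hΦ.tendsto_cqStep ha hl hT (x := y) ⟨by linarith, by linarith⟩
  obtain ⟨z1, z2⟩ := hΦ.tendsto_cqStep ha hl hT (x := z) ⟨by linarith, by linarith⟩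
  refine le_of_tendsto_of_tendsto' ((y1.sub x1).mul (z2.sub y2)) ((z1.sub y1).mul (y2.sub x2))
    fun N => ?_
  have hs := sum_slope_anti (discreteResolvent_antitone (isKaluzaKernel_cq ha)
    (μ := l * ((z + 1) / N) ^ a) (by positivity))
    (p := ⌊x / (z + 1) * N⌋₊) (q := ⌊y / (z + 1) * N⌋₊) (r := ⌊z / (z + 1) * N⌋₊)
    (by gcongr) (by gcongr)
  have hp : 0 ≤ ((z + 1) / (N : ℝ)) ^ a := Real.rpow_nonneg (by positivity) a
  have hq : 0 ≤ (z + 1) / (N : ℝ) := by positivity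
  have := mul_le_mul_of_nonneg_left hs (mul_nonneg hp hq)
  simp only [cqStep]
  linear_combination this

end ConvolutionQuadrature

end TwoScaleFPE

/-! ### Truncation error of the L1 formula for the concave step response. -/

namespace TwoScaleFPE

section Truncation

open Filter Topology

variable {α l : ℝ}

/-- Both chords are compared with the chord from x₁ to y₂, by moving one endpoint at a time. -/
theorem slope_anti_of_concaveOn {P : ℝ → ℝ} (hP : ConcaveOn ℝ (Ici 0) P) {x₁ y₁ x₂ y₂ : ℝ}
    (h0 : 0 ≤ x₁) (hx : x₁ ≤ x₂) (hy : y₁ ≤ y₂) (h₁ : x₁ < y₁) (h₂ : x₂ < y₂) :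
    (P y₂ - P x₂) / (y₂ - x₂) ≤ (P y₁ - P x₁) / (y₁ - x₁) := by
  have hneg := hP.neg
  have m : ∀ z, x₁ ≤ z → z ∈ Ici (0 : ℝ) := fun z hz => h0.trans hz
  have e1 := hneg.secant_mono (m x₁ le_rfl) (m y₁ h₁.le) (m y₂ (h₁.le.trans hy)) h₁.ne'
    (h₁.trans_le hy).ne' hy
  have e2 := hneg.secant_mono (m y₂ (h₁.le.trans hy)) (m x₁ le_rfl) (m x₂ hx)
    (h₁.trans_le hy).ne h₂.ne hx
  simp only [Pi.neg_apply] at e1 e2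
  have r1 : (-P y₁ - -P x₁) / (y₁ - x₁) = -((P y₁ - P x₁) / (y₁ - x₁)) := by ring
  have r2 : (-P y₂ - -P x₁) / (y₂ - x₁) = -((P y₂ - P x₁) / (y₂ - x₁)) := by ring
  have r3 : (-P x₁ - -P y₂) / (x₁ - y₂) = -((P y₂ - P x₁) / (y₂ - x₁)) := by
    rw [← neg_div_neg_eq]; ring
  have r4 : (-P x₂ - -P y₂) / (x₂ - y₂) = -((P y₂ - P x₂) / (y₂ - x₂)) := by
    rw [← neg_div_neg_eq]; ring
  rw [r1, r2] at e1
  rw [r3, r4] at e2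
  linarith

theorem tendsto_average_left {g : ℝ → ℝ} (hg : Continuous g) (x : ℝ) :
    Tendsto (fun ε : ℝ => ε⁻¹ * ∫ s in (x - ε)..x, g s) (𝓝[>] 0) (𝓝 (g x)) := by
  have h := (hg.integral_hasStrictDerivAt 0 x).hasDerivAt
  rw [hasDerivAt_iff_tendsto_slope_zero] at h
  have hneg : Tendsto (fun ε : ℝ => -ε) (𝓝[>] 0) (𝓝[≠] 0) := by
    refine tendsto_nhdsWithin_of_tendsto_nhds_of_eventually_within _ ?_ ?_
    · have : Tendsto (fun ε : ℝ => -ε) (𝓝 0) (𝓝 (-0)) := tendsto_id.neg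
      rw [neg_zero] at this
      exact this.mono_left nhdsWithin_le_nhds
    · filter_upwards [self_mem_nhdsWithin] with ε hε
      exact neg_ne_zero.2 (ne_of_gt hε)
  refine (h.comp hneg).congr fun ε => ?_
  simp only [Function.comp, smul_eq_mul]
  have hi : ∀ u v, IntervalIntegrable g volume u v := fun u v => hg.intervalIntegrable u v
  rw [intervalIntegral.integral_interval_sub_left (hi _ _) (hi _ _),
    intervalIntegral.integral_symm, ← sub_eq_add_neg, inv_neg, neg_mul_neg]

/-- Backward difference quotient. -/
noncomputable def backwardDiff (P : ℝ → ℝ) (ε s : ℝ) : ℝ := ε⁻¹ * (P s - P (s - ε))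

theorem continuous_backwardDiff {P : ℝ → ℝ} (hP : Continuous P) (ε : ℝ) :
    Continuous (backwardDiff P ε) := by
  unfold backwardDiff; fun_prop

theorem integral_backwardDiff {P : ℝ → ℝ} (hP : Continuous P) (ε x y : ℝ) :
    ∫ s in x..y, backwardDiff P ε s =
      ε⁻¹ * (∫ s in (y - ε)..y, P s) - ε⁻¹ * ∫ s in (x - ε)..x, P s := by
  have hi : ∀ u v, IntervalIntegrable P volume u v := fun u v => hP.intervalIntegrable u v
  unfold backwardDiff
  rw [intervalIntegral.integral_const_mul, intervalIntegral.integral_sub (hi _ _)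
    ((by fun_prop : Continuous fun s => P (s - ε)).intervalIntegrable _ _),
    intervalIntegral.integral_comp_sub_right, ← mul_sub]
  congr 1
  rw [intervalIntegral.integral_interval_sub_interval_comm (hi _ _) (hi _ _) (hi _ _),
    intervalIntegral.integral_symm x]
  have := intervalIntegral.integral_add_adjacent_intervals (hi y (y - ε)) (hi (y - ε) (x - ε))
  rw [intervalIntegral.integral_symm (y - ε) y]
  ring

/-- `I^(1-α)` of the difference quotient of `Φ` is an average of `1 - l Φ`. -/
theorem IsFracStep.fracInt_backwardDiff (hα : α ∈ Ioo (0 : ℝ) 1)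
    {P : ℝ → ℝ} (hP : IsFracStep α l P) {t ε : ℝ} (hε : 0 ≤ ε) (hεt : ε ≤ t) :
    fracInt (1 - α) (backwardDiff P ε) t = ε⁻¹ * ∫ s in (t - ε)..t, (1 - l * P s) := by
  have hb : 0 < 1 - α := by linarith [hα.2]
  have hPc := hP.continuous
  have hF : Continuous fun s => 1 - l * P s := by fun_prop
  -- Since P = I^α(1 - lP), applying I^(1-α) gives the primitive of 1 - lP.
  have key : ∀ u, 0 ≤ u → fracInt (1 - α) P u = ∫ s in (0 : ℝ)..u, (1 - l * P s) := by
    intro u hu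
    have h := fracInt_fracInt_one_sub (a := 1 - α) ⟨hb, by linarith [hα.1]⟩ hu
      (hF.intervalIntegrable 0 u)
    rw [sub_sub_cancel] at h
    rw [← h]
    exact fracInt_congr hu fun s hs => hP.eq_fracInt s hs.1
  -- A time shift commutes with the fractional integral because P vanishes for nonpositive times.
  have hshift : fracInt (1 - α) (fun s => P (s - ε)) t = fracInt (1 - α) P (t - ε) := by
    unfold fracInt
    congr 1
    have h1 := intervalIntegral.integral_comp_sub_right
      (fun ξ => (t - ε - ξ) ^ (1 - α - 1) * P ξ) (a := ε) (b := t) ε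
    rw [sub_self] at h1
    rw [← h1]
    simp only [sub_sub_sub_cancel_right]
    have hc : Continuous fun s => P (s - ε) := by fun_prop
    rw [← intervalIntegral.integral_add_adjacent_intervals (b := ε)
      (intervalIntegrable_sub_rpow_mul hb t hc.continuousOn)
      (intervalIntegrable_sub_rpow_mul hb t hc.continuousOn)]
    rw [add_eq_right]
    refine (intervalIntegral.integral_congr (g := fun _ => (0 : ℝ)) fun s hs => ?_).trans (by simp)
    rw [uIcc_of_le hε] at hs
    simp only
    rw [hP.eq_zero (s - ε) (by linarith [hs.2]), mul_zero]
  have hd : fracInt (1 - α) (backwardDiff P ε) t =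
      ε⁻¹ * (fracInt (1 - α) P t - fracInt (1 - α) P (t - ε)) := by
    have : backwardDiff P ε = fun s => ε⁻¹ * (P s - P (s - ε)) := rfl
    rw [this, fracInt_const_mul, fracInt_sub hb hPc.continuousOn
      (by fun_prop), hshift]
  rw [hd, key t (by linarith), key (t - ε) (by linarith),
    intervalIntegral.integral_interval_sub_left (hF.intervalIntegrable _ _)
      (hF.intervalIntegrable _ _)]

/-- Bounds of the variation of `t ^ (-α)` over the unit cells. -/
noncomputable def cellVar (α : ℝ) (i : ℕ) : ℝ :=
  if i = 0 then (1 - α)⁻¹ else (i : ℝ) ^ (-α) - ((i : ℝ) + 1) ^ (-α)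

theorem cellVar_nonneg (hα : α ∈ Ioo (0 : ℝ) 1) (i : ℕ) : 0 ≤ cellVar α i := by
  unfold cellVar
  split_ifs with h
  · exact inv_nonneg.2 (by linarith [hα.2])
  · have hi : (0 : ℝ) < i := by exact_mod_cast Nat.pos_of_ne_zero h
    exact sub_nonneg.2 (Real.rpow_le_rpow_of_nonpos hi (by linarith) (by linarith [hα.1]))

/-- The drop of t^(-α) across cell i ≥ 1 is i^(-α)(1 - (i/(i+1))^α), and (i/(i+1))^α ≥ i/(i+1)
because α < 1. The value at i = 0 is the integral of t^(-α) over the singular cell. -/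
theorem succ_mul_cellVar_le (hα : α ∈ Ioo (0 : ℝ) 1) (i : ℕ) :
    ((i : ℝ) + 1) * cellVar α i ≤ (1 - α)⁻¹ := by
  have h1 : 1 ≤ (1 - α)⁻¹ := (one_le_inv₀ (by linarith [hα.2])).2 (by linarith [hα.1])
  unfold cellVar
  split_ifs with h
  · simp [h]
  · refine le_trans ?_ h1
    have hi : (0 : ℝ) < i := by exact_mod_cast Nat.pos_of_ne_zero h
    have hi1 : (1 : ℝ) ≤ i := by exact_mod_cast Nat.pos_of_ne_zero h
    have h2 : (i : ℝ) ^ (-α) ≤ 1 := Real.rpow_le_one_of_one_le_of_nonpos hi1 (by linarith [hα.1])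
    have h3 : (i : ℝ) / (i + 1) ≤ ((i : ℝ) / (i + 1)) ^ α := by
      have := Real.rpow_le_rpow_of_exponent_ge (x := (i : ℝ) / (i + 1)) (by positivity)
        ((div_le_one (by positivity)).2 (by linarith)) hα.2.le
      rwa [Real.rpow_one] at this
    have h4 : ((i : ℝ) + 1) ^ (-α) = (i : ℝ) ^ (-α) * ((i : ℝ) / (i + 1)) ^ α := by
      rw [Real.div_rpow hi.le (by positivity), Real.rpow_neg hi.le, Real.rpow_neg (by positivity)]
      field_simp
    rw [h4]
    have h5 : 0 < (i : ℝ) ^ (-α) := Real.rpow_pos_of_pos hi _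
    calc ((i : ℝ) + 1) * ((i : ℝ) ^ (-α) - (i : ℝ) ^ (-α) * ((i : ℝ) / (i + 1)) ^ α)
        ≤ ((i : ℝ) + 1) * ((i : ℝ) ^ (-α) - (i : ℝ) ^ (-α) * ((i : ℝ) / (i + 1))) := by gcongr
      _ = (i : ℝ) ^ (-α) := by field_simp; ring
      _ ≤ 1 := h2

theorem cellVar_le_one (hα : α ∈ Ioo (0 : ℝ) 1) {i : ℕ} (hi : i ≠ 0) : cellVar α i ≤ 1 := by
  have hi1 : (1 : ℝ) ≤ i := by exact_mod_cast Nat.pos_of_ne_zero hi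
  have h2 : (i : ℝ) ^ (-α) ≤ 1 := Real.rpow_le_one_of_one_le_of_nonpos hi1 (by linarith [hα.1])
  have h3 : 0 ≤ ((i : ℝ) + 1) ^ (-α) := by positivity
  rw [cellVar, if_neg hi]
  linarith

theorem sum_cellVar_le (hα : α ∈ Ioo (0 : ℝ) 1) (n : ℕ) :
    ∑ i ∈ Finset.range n, cellVar α i ≤ (1 - α)⁻¹ + 1 := by
  have h : ∀ n : ℕ, ∑ i ∈ Finset.range (n + 1), cellVar α i =
      (1 - α)⁻¹ + 1 - ((n : ℝ) + 1) ^ (-α) := by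
    intro n
    induction n with
    | zero => simp [cellVar]
    | succ n ih =>
      rw [Finset.sum_range_succ, ih, cellVar, if_neg (by omega)]
      push_cast; ring
  rcases n with _ | n
  · have : 0 ≤ (1 - α)⁻¹ := inv_nonneg.2 (by linarith [hα.2])
    simp; linarith
  · rw [h]
    have : 0 ≤ ((n : ℝ) + 1) ^ (-α) := by positivity
    linarith

/-- Second differences of `P` on the unit grid, with an artificial initial value. -/
noncomputable def secondDiff (c₀ : ℝ) (P : ℝ → ℝ) (j : ℕ) : ℝ :=
  if j = 0 then c₀ else (P j - P (j - 1)) - (P (j + 2) - P (j + 1))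

/-- The interpolation error on one cell, integrated against the kernel. -/
theorem abs_integral_cell_le (hα : α ∈ Ioo (0 : ℝ) 1) {P : ℝ → ℝ} (hPc : Continuous P)
    (hPm : Monotone P) (hP : ConcaveOn ℝ (Ici 0) P) (hP0 : P 0 = 0) {c₀ : ℝ} (hc₀ : 2 * P 1 ≤ c₀)
    {j i : ℕ} (hij : i + j ≠ 0) {ε : ℝ} (hε : ε ∈ Ioc (0 : ℝ) 1) :
    |∫ s in (j : ℝ)..j + 1, ((i + j + 1 : ℝ) - s) ^ (-α) *
        (P (j + 1) - P j - backwardDiff P ε s)| ≤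
      cellVar α i * secondDiff c₀ P j +
        2 * |P (j + 1) - P j - ∫ s in (j : ℝ)..j + 1, backwardDiff P ε s| := by
  have hε0 := hε.1
  have hb : 0 < 1 - α := by linarith [hα.2]
  set D : ℝ → ℝ := fun s => P (j + 1) - P j - backwardDiff P ε s with hD
  have hDc : Continuous D := by
    have := continuous_backwardDiff hPc ε
    fun_prop
  set d := P (j + 1) - P j - ∫ s in (j : ℝ)..j + 1, backwardDiff P ε s with hd
  have hdint : ∫ s in (j : ℝ)..j + 1, D s = d := by
    rw [hD, intervalIntegral.integral_sub (intervalIntegrable_const (μ := volume))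
      ((continuous_backwardDiff hPc ε).intervalIntegrable _ _)]
    simp [hd]
  have hj0 : (0 : ℝ) ≤ j := Nat.cast_nonneg j
  have hjle : (j : ℝ) ≤ j + 1 := by linarith
  -- By concavity the chord slope over [j, j+1] and the backward quotient at s, whose step is at
  -- most 1, both lie between the slopes over [j+1, j+2] and [j-1, j]. For j = 0 the left neighbour
  -- leaves the region of concavity.
  have hbound : j ≠ 0 → ∀ s ∈ Icc (j : ℝ) (j + 1), |D s| ≤ secondDiff c₀ P j := by
    intro hj s hs
    have hj1 : (1 : ℝ) ≤ j := by exact_mod_cast Nat.pos_of_ne_zero hj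
    have e1 := slope_anti_of_concaveOn hP (x₁ := (j : ℝ) - 1) (y₁ := j) (x₂ := s - ε) (y₂ := s)
      (by linarith) (by linarith [hs.1, hε.2]) hs.1 (by linarith) (by linarith)
    have e2 := slope_anti_of_concaveOn hP (x₂ := (j : ℝ) + 1) (y₂ := j + 2) (x₁ := s - ε) (y₁ := s)
      (by linarith [hs.1, hε.2]) (by linarith [hs.2]) (by linarith [hs.2]) (by linarith)
      (by linarith)
    have e3 := slope_anti_of_concaveOn hP (x₁ := (j : ℝ) - 1) (y₁ := j) (x₂ := j) (y₂ := j + 1)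
      (by linarith) (by linarith) (by linarith) (by linarith) (by linarith)
    have e4 := slope_anti_of_concaveOn hP (x₁ := (j : ℝ)) (y₁ := j + 1) (x₂ := j + 1) (y₂ := j + 2)
      (by linarith) (by linarith) (by linarith) (by linarith) (by linarith)
    have hq : backwardDiff P ε s = (P s - P (s - ε)) / (s - (s - ε)) := by
      rw [backwardDiff, sub_sub_cancel]; ring
    rw [← hq] at e1 e2
    rw [show (j : ℝ) - (j - 1) = 1 by ring, div_one] at e1 e3
    rw [show (j : ℝ) + 2 - (j + 1) = 1 by ring, div_one] at e2 e4
    rw [show (j : ℝ) + 1 - j = 1 by ring, div_one] at e3 e4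
    rw [secondDiff, if_neg hj, abs_le]
    constructor <;> simp only [hD] <;> linarith
  -- In the first cell, monotonicity of P gives |D| ≤ 2P(1) - D, and c₀ takes the place of the
  -- missing second difference.
  have habs : ∫ s in (j : ℝ)..j + 1, |D s| ≤ secondDiff c₀ P j + |d| := by
    by_cases hj : j = 0
    · subst hj
      have hle : ∀ s ∈ Icc ((0 : ℕ) : ℝ) ((0 : ℕ) + 1), |D s| ≤ 2 * P 1 - D s := by
        intro s _
        have : 0 ≤ backwardDiff P ε s :=
          mul_nonneg (inv_nonneg.2 hε0.le) (sub_nonneg.2 (hPm (by linarith)))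
        have hP1 : 0 ≤ P 1 := hP0 ▸ hPm zero_le_one
        simp only [hD, Nat.cast_zero, zero_add, hP0, sub_zero]
        rw [abs_le]; constructor <;> linarith
      have := intervalIntegral.integral_mono_on (μ := volume) hjle
        (hDc.abs.intervalIntegrable _ _)
        ((by fun_prop : Continuous fun s => 2 * P 1 - D s).intervalIntegrable _ _) hle
      rw [intervalIntegral.integral_sub (intervalIntegrable_const (μ := volume))
        (hDc.intervalIntegrable _ _), hdint] at this
      simp only [intervalIntegral.integral_const, add_sub_cancel_left, one_smul] at this
      rw [secondDiff, if_pos rfl]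
      linarith [neg_abs_le d]
    · have := intervalIntegral.integral_mono_on (μ := volume) hjle
        (hDc.abs.intervalIntegrable _ _) intervalIntegrable_const (hbound hj)
      simp only [intervalIntegral.integral_const, add_sub_cancel_left, one_smul] at this
      linarith [abs_nonneg d]
  have hker : IntervalIntegrable (fun s : ℝ => ((i + j + 1 : ℝ) - s) ^ (-α)) volume j (j + 1) := by
    have := intervalIntegrable_sub_rpow hb (i + j + 1 : ℝ) j (j + 1)
    rwa [show 1 - α - 1 = -α by ring] at this
  -- In the singular cell the pointwise bound of D meets the integral 1/(1 - α) of the kernel. In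
  -- the other cells the kernel minus a constant is at most `cellVar`; the constant only sees the
  -- mean d of D, which vanishes as ε → 0.
  by_cases hi : i = 0
  · subst hi
    have hj : j ≠ 0 := by omega
    have h1 : |∫ s in (j : ℝ)..j + 1, ((0 : ℕ) + j + 1 - s : ℝ) ^ (-α) * D s| ≤
        ∫ s in (j : ℝ)..j + 1, ((0 : ℕ) + j + 1 - s : ℝ) ^ (-α) * secondDiff c₀ P j := by
      rw [← Real.norm_eq_abs]
      refine intervalIntegral.norm_integral_le_of_norm_le hjle ?_ (hker.mul_const _)
      filter_upwards with s hs
      rw [norm_mul, Real.norm_of_nonneg (Real.rpow_nonneg (by simp; linarith [hs.2]) _)]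
      exact mul_le_mul_of_nonneg_left (hbound hj s ⟨hs.1.le, hs.2⟩)
        (Real.rpow_nonneg (by simp; linarith [hs.2]) _)
    have h2 : ∫ s in (j : ℝ)..j + 1, ((0 : ℕ) + j + 1 - s : ℝ) ^ (-α) = (1 - α)⁻¹ := by
      have e := intervalIntegral.integral_comp_sub_left (fun x : ℝ => x ^ (1 - α - 1))
        ((0 : ℕ) + j + 1 : ℝ) (a := j) (b := j + 1)
      rw [integral_rpow_sub_one hb] at e
      simp only [show 1 - α - 1 = -α by ring] at e
      rw [e]
      simp [Real.zero_rpow hb.ne']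
    rw [intervalIntegral.integral_mul_const, h2] at h1
    rw [cellVar, if_pos rfl]
    linarith [abs_nonneg d]
  · have hi1 : (1 : ℝ) ≤ i := by exact_mod_cast Nat.pos_of_ne_zero hi
    set κ : ℝ := ((i : ℝ) + 1) ^ (-α) with hκ
    have hκ0 : 0 ≤ κ := by positivity
    have hκ1 : κ ≤ 1 := Real.rpow_le_one_of_one_le_of_nonpos (by linarith) (by linarith [hα.1])
    have hv : ∀ s ∈ Icc (j : ℝ) (j + 1), |((i + j + 1 : ℝ) - s) ^ (-α) - κ| ≤ cellVar α i := by
      intro s hs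
      rw [cellVar, if_neg hi]
      have h1 : κ ≤ ((i + j + 1 : ℝ) - s) ^ (-α) :=
        Real.rpow_le_rpow_of_nonpos (by linarith [hs.2]) (by linarith [hs.1]) (by linarith [hα.1])
      have h2 : ((i + j + 1 : ℝ) - s) ^ (-α) ≤ (i : ℝ) ^ (-α) :=
        Real.rpow_le_rpow_of_nonpos (by linarith) (by linarith [hs.2]) (by linarith [hα.1])
      rw [abs_of_nonneg (by linarith)]
      linarith
    have hsplit : ∫ s in (j : ℝ)..j + 1, ((i + j + 1 : ℝ) - s) ^ (-α) * D s =
        (∫ s in (j : ℝ)..j + 1, (((i + j + 1 : ℝ) - s) ^ (-α) - κ) * D s) + κ * d := by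
      rw [← hdint, ← intervalIntegral.integral_const_mul, ← intervalIntegral.integral_add
        ((hker.sub (intervalIntegrable_const (μ := volume) (c := κ))).mul_continuousOn hDc.continuousOn)
        ((hDc.intervalIntegrable _ _).const_mul κ)]
      congr 1; ext s; ring
    have h1 : |∫ s in (j : ℝ)..j + 1, (((i + j + 1 : ℝ) - s) ^ (-α) - κ) * D s| ≤
        ∫ s in (j : ℝ)..j + 1, cellVar α i * |D s| := by
      rw [← Real.norm_eq_abs]
      refine intervalIntegral.norm_integral_le_of_norm_le hjle ?_
        ((hDc.abs.intervalIntegrable _ _).const_mul _)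
      filter_upwards with s hs
      rw [norm_mul]
      exact mul_le_mul_of_nonneg_right (hv s ⟨hs.1.le, hs.2⟩) (norm_nonneg _)
    rw [intervalIntegral.integral_const_mul] at h1
    have h2 := mul_le_mul_of_nonneg_left habs (cellVar_nonneg hα i)
    have h3 : |κ * d| ≤ |d| := by
      rw [abs_mul, abs_of_nonneg hκ0]
      exact mul_le_of_le_one_left (abs_nonneg d) hκ1
    have h4 : cellVar α i * |d| ≤ |d| := mul_le_of_le_one_left (abs_nonneg d) (cellVar_le_one hα hi)
    rw [hsplit]
    refine (abs_add_le _ _).trans ?_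
    linarith

/-- The truncation error of the L1 formula at the grid point `k + 1`. -/
theorem IsFracStep.abs_truncation_le (hα : α ∈ Ioo (0 : ℝ) 1) (hl : 0 ≤ l)
    {P : ℝ → ℝ} (hP : IsFracStep α l P) {c₀ : ℝ} (hc₀ : 2 * P 1 ≤ c₀)
    (hc₁ : Real.Gamma (1 - α) * (bCoeff α 0 * P 1 + 1) ≤ c₀) (k : ℕ) :
    |∑ j ∈ Finset.range (k + 1), bCoeff α (k - j) * (P (j + 1) - P j) - (1 - l * P (k + 1))| ≤
      (Real.Gamma (1 - α))⁻¹ *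
        ∑ j ∈ Finset.range (k + 1), cellVar α (k - j) * secondDiff c₀ P j := by
  have hb : 0 < 1 - α := by linarith [hα.2]
  have hG := Real.Gamma_pos_of_pos hb
  have hPc := hP.continuous
  have hP0 := hP.eq_zero 0 le_rfl
  have hPm := hP.monotone hα hl
  have hPv := hP.concaveOn hα hl
  have hF : Continuous fun s => 1 - l * P s := by fun_prop
  -- At the first grid point the singular kernel meets the singular start of P, so cancellation is
  -- not available; the crude bound `hc₁` covers this case.
  rcases Nat.eq_zero_or_pos k with rfl | hk
  · have hF1 : 0 ≤ 1 - l * P 1 := by linarith [hP.mul_le_one hα hl 1]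
    have hP1 : 0 ≤ P 1 := hP.nonneg hα hl 1
    have hF2 : 1 - l * P 1 ≤ 1 := by linarith [mul_nonneg hl hP1]
    have hb0 : 0 ≤ bCoeff α 0 := le_trans (by positivity) (bCoeff_ge hα 0)
    have hb1 : 1 ≤ (1 - α)⁻¹ := (one_le_inv₀ hb).2 (by linarith [hα.1])
    simp only [zero_add, Finset.sum_range_one, Nat.sub_zero, Nat.cast_zero, hP0, sub_zero,
      cellVar, secondDiff, if_true]
    have h1 : |bCoeff α 0 * P 1 - (1 - l * P 1)| ≤ bCoeff α 0 * P 1 + 1 := by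
      have := mul_nonneg hb0 hP1
      rw [abs_le]; constructor <;> linarith
    have hc : 0 ≤ c₀ := by linarith
    rw [le_inv_mul_iff₀ hG]
    calc _ ≤ Real.Gamma (1 - α) * (bCoeff α 0 * P 1 + 1) := mul_le_mul_of_nonneg_left h1 hG.le
      _ ≤ c₀ := hc₁
      _ ≤ _ := le_mul_of_one_le_left hc hb1
  -- The derivative of P is replaced by a backward quotient of width ε. The resulting defects of the
  -- cell means tend to zero, so the estimate is proved for each small ε and then passed to the
  -- limit.
  set E : ℝ → ℕ → ℝ := fun ε j =>
    P (j + 1) - P j - ∫ s in (j : ℝ)..j + 1, backwardDiff P ε s with hE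
  have hElim : ∀ j : ℕ, Tendsto (fun ε => E ε j) (𝓝[>] 0) (𝓝 0) := by
    intro j
    have h1 := tendsto_average_left hPc ((j : ℝ) + 1)
    have h2 := tendsto_average_left hPc (j : ℝ)
    have h3 := (tendsto_const_nhds (x := P (j + 1) - P j)).sub (h1.sub h2)
    rw [sub_self] at h3
    refine h3.congr fun ε => ?_
    simp only [hE, integral_backwardDiff hPc]
  have hlhs : Tendsto (fun ε : ℝ => |∑ j ∈ Finset.range (k + 1),
      bCoeff α (k - j) * (P (j + 1) - P j) -
        ε⁻¹ * ∫ s in ((k : ℝ) + 1 - ε)..(k + 1), (1 - l * P s)|) (𝓝[>] 0)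
      (𝓝 |∑ j ∈ Finset.range (k + 1), bCoeff α (k - j) * (P (j + 1) - P j) -
        (1 - l * P (k + 1))|) :=
    (tendsto_const_nhds.sub (tendsto_average_left hF ((k : ℝ) + 1))).abs
  have hrhs : Tendsto (fun ε : ℝ => (Real.Gamma (1 - α))⁻¹ *
        ∑ j ∈ Finset.range (k + 1), (cellVar α (k - j) * secondDiff c₀ P j + 2 * |E ε j|))
      (𝓝[>] 0) (𝓝 ((Real.Gamma (1 - α))⁻¹ *
        ∑ j ∈ Finset.range (k + 1), (cellVar α (k - j) * secondDiff c₀ P j + 2 * |(0 : ℝ)|))) :=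
    (tendsto_finsetSum _ fun j _ =>
      tendsto_const_nhds.add ((hElim j).abs.const_mul 2)).const_mul _
  simp only [abs_zero, mul_zero, add_zero] at hrhs
  refine le_of_tendsto_of_tendsto hlhs hrhs ?_
  filter_upwards [Ioc_mem_nhdsGT (zero_lt_one (α := ℝ))] with ε hε
  have hid := hP.fracInt_backwardDiff hα (t := (k : ℝ) + 1) hε.1.le
    (by have : (0 : ℝ) ≤ k := Nat.cast_nonneg k
        linarith [hε.2])
  rw [← hid]
  have hKc := continuous_backwardDiff hPc ε
  have hker : ∀ j : ℕ, IntervalIntegrable (fun s : ℝ => ((k + 1 : ℝ) - s) ^ (1 - α - 1)) volume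
      (j : ℝ) ((j + 1 : ℕ) : ℝ) := fun j => intervalIntegrable_sub_rpow hb _ _ _
  have hsum : fracInt (1 - α) (backwardDiff P ε) (k + 1) = ∑ j ∈ Finset.range (k + 1),
      (Real.Gamma (1 - α))⁻¹ * ∫ s in (j : ℝ)..(j + 1 : ℕ),
        ((k + 1 : ℝ) - s) ^ (1 - α - 1) * backwardDiff P ε s := by
    rw [fracInt, ← Finset.mul_sum]
    have h1 := intervalIntegral.sum_integral_adjacent_intervals (μ := volume)
      (f := fun s : ℝ => ((k + 1 : ℝ) - s) ^ (1 - α - 1) * backwardDiff P ε s)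
      (a := fun i : ℕ => (i : ℝ)) (n := k + 1)
      (fun j _ => (hker j).mul_continuousOn hKc.continuousOn)
    rw [h1]
    push_cast; rfl
  rw [hsum, ← Finset.sum_sub_distrib, Finset.mul_sum]
  refine (Finset.abs_sum_le_sum_abs _ _).trans (Finset.sum_le_sum fun j hj => ?_)
  have hjk : j ≤ k := by simpa [Nat.lt_succ_iff] using hj
  have hbj : bCoeff α (k - j) = (Real.Gamma (1 - α))⁻¹ *
      ∫ s in (j : ℝ)..(j + 1 : ℕ), ((k + 1 : ℝ) - s) ^ (1 - α - 1) := by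
    rw [bCoeff_eq_integral hα.2, intervalIntegral.integral_comp_sub_left
      (fun x : ℝ => x ^ (1 - α - 1)) (k + 1 : ℝ), Nat.cast_sub hjk]
    simp only [show 1 - α - 1 = -α by ring]
    congr 2
    · push_cast; ring
    · ring
  rw [hbj, mul_assoc, ← intervalIntegral.integral_mul_const, ← mul_sub,
    ← intervalIntegral.integral_sub ((hker j).mul_const _)
      ((hker j).mul_continuousOn hKc.continuousOn), abs_mul, abs_of_pos (inv_pos.2 hG)]
  refine mul_le_mul_of_nonneg_left ?_ (inv_pos.2 hG).le
  have := abs_integral_cell_le hα hPc hPm hPv hP0 hc₀ (j := j) (i := k - j) (by omega) hε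
  rw [Nat.cast_sub hjk] at this
  simp only [← mul_sub, show 1 - α - 1 = -α by ring]
  simpa using this

end Truncation

end TwoScaleFPE

/-! ### Nonsmooth data bounds for the L1 step response. -/

namespace TwoScaleFPE

section L1Error

open PowerSeries Finset

variable {α l : ℝ}

theorem sum_antidiagonal_mul_le {x y : ℕ → ℝ} {n : ℕ} {S c : ℝ} (hx : ∀ i, 0 ≤ x i)
    (hy : ∀ j ≤ n, y j ≤ c) (hc : 0 ≤ c) (hS : ∑ i ∈ range (n + 1), x i ≤ S) :
    ∑ p ∈ antidiagonal n, x p.1 * y p.2 ≤ S * c := by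
  rw [Nat.sum_antidiagonal_eq_sum_range_succ_mk]
  calc ∑ k ∈ range n.succ, x k * y (n - k) ≤ ∑ k ∈ range (n + 1), x k * c :=
        sum_le_sum fun k _ => mul_le_mul_of_nonneg_left (hy _ (Nat.sub_le n k)) (hx k)
    _ = (∑ k ∈ range (n + 1), x k) * c := by rw [sum_mul]
    _ ≤ S * c := mul_le_mul_of_nonneg_right hS hc

/-- If i + j = n, then n + 1 ≤ (i + 1) + (j + 1), so the decay factor can be passed to one of the
two sequences. -/
theorem succ_mul_sum_antidiagonal_le {x y : ℕ → ℝ} (n : ℕ) (hx : ∀ i, 0 ≤ x i)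
    (hy : ∀ i, 0 ≤ y i) :
    ((n : ℝ) + 1) * ∑ p ∈ antidiagonal n, x p.1 * y p.2 ≤
      ∑ p ∈ antidiagonal n, (((p.1 : ℝ) + 1) * x p.1) * y p.2 +
      ∑ p ∈ antidiagonal n, x p.1 * (((p.2 : ℝ) + 1) * y p.2) := by
  rw [mul_sum, ← sum_add_distrib]
  refine sum_le_sum fun p hp => ?_
  have h : ((p.1 : ℝ) + p.2) = n := by exact_mod_cast mem_antidiagonal.1 hp
  have := mul_nonneg (hx p.1) (hy p.2)
  rw [← h]
  nlinarith

/-- Convolution preserves the combination of bounded mass and decay 1/(i + 1): in each half of the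
split one sequence uses its decay and the other its mass. -/
theorem succ_mul_sum_antidiagonal_le_of_decay {x y : ℕ → ℝ} {n : ℕ} {A M : ℝ}
    (hx : ∀ i, 0 ≤ x i) (hy : ∀ i, 0 ≤ y i) (hA : 0 ≤ A) (hM : 0 ≤ M)
    (hxA : ∀ i ≤ n, ((i : ℝ) + 1) * x i ≤ A) (hxS : ∑ i ∈ range (n + 1), x i ≤ A)
    (hyM : ∀ i ≤ n, ((i : ℝ) + 1) * y i ≤ M) (hyS : ∑ i ∈ range (n + 1), y i ≤ M) :
    ((n : ℝ) + 1) * ∑ p ∈ antidiagonal n, x p.1 * y p.2 ≤ 2 * A * M := by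
  refine (succ_mul_sum_antidiagonal_le n hx hy).trans ?_
  have h1 := sum_antidiagonal_mul_le (S := M) (c := A) hy hxA hA hyS
  have h2 := sum_antidiagonal_mul_le (S := A) (c := M) hx hyM hM hxS
  have h3 : ∑ p ∈ antidiagonal n, (((p.1 : ℝ) + 1) * x p.1) * y p.2 =
      ∑ p ∈ antidiagonal n, y p.1 * (((p.2 : ℝ) + 1) * x p.2) := by
    rw [← Finset.Nat.sum_antidiagonal_swap]
    exact sum_congr rfl fun p _ => by simp only [Prod.fst_swap, Prod.snd_swap]; ring
  rw [h3]
  linarith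

theorem sum_secondDiff (P : ℝ → ℝ) (n : ℕ) :
    ∑ i ∈ range (n + 1), secondDiff 0 P i = P 2 - P 0 - (P (n + 2) - P n) := by
  induction n with
  | zero => simp [secondDiff]
  | succ n ih =>
    rw [sum_range_succ, ih, secondDiff, if_neg (by omega)]
    push_cast
    rw [add_sub_cancel_right, show (n : ℝ) + 1 + 1 = n + 2 by ring]
    ring

/-- Summation by parts shows that the first moment of the second differences is controlled by values
of P alone, without a factor n. -/
theorem sum_succ_mul_secondDiff (P : ℝ → ℝ) (n : ℕ) :
    ∑ i ∈ range (n + 1), ((i : ℝ) + 1) * secondDiff 0 P i =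
      2 * (P n - P 0) + (P 2 - P 1) - n * (P (n + 1) - P n) - (n + 1) * (P (n + 2) - P (n + 1)) := by
  induction n with
  | zero => simp [secondDiff]
  | succ n ih =>
    rw [sum_range_succ, ih, secondDiff, if_neg (by omega)]
    push_cast
    rw [add_sub_cancel_right, show (n : ℝ) + 1 + 1 = n + 2 by ring]
    ring

/-- The L1 approximation, with unit step size, of the solution of `P = I^α (1 - l P)`. -/
noncomputable def l1Step (α l : ℝ) (n : ℕ) : ℝ :=
  ∑ i ∈ range n, coeff i (discreteResolvent (l1Kernel α) l)

theorem l1Step_nonneg (hα : α ∈ Set.Ioo (0 : ℝ) 1) (hl : 0 ≤ l) (n : ℕ) : 0 ≤ l1Step α l n :=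
  sum_nonneg fun i _ => discreteResolvent_nonneg (isKaluzaKernel_l1Kernel hα) hl i

theorem mul_l1Step_le_one (hα : α ∈ Set.Ioo (0 : ℝ) 1) (hl : 0 ≤ l) (n : ℕ) :
    l * l1Step α l n ≤ 1 :=
  mul_sum_discreteResolvent_le_one (isKaluzaKernel_l1Kernel hα) hl n

theorem l1Step_le_rpow (hα : α ∈ Set.Ioo (0 : ℝ) 1) (hl : 0 ≤ l) (n : ℕ) :
    l1Step α l n ≤ Real.Gamma (1 - α) * (n : ℝ) ^ α := by
  have hG := Real.Gamma_pos_of_pos (show 0 < 1 - α by linarith [hα.2])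
  rcases n with _ | n
  · simp [l1Step, Real.zero_rpow hα.1.ne']
  have h1 := kernel_mul_sum_discreteResolvent_le_one (isKaluzaKernel_l1Kernel hα) hl n
  have h2 := bCoeff_ge hα n
  rw [l1Kernel, coeff_mk] at h1
  have h3 := (mul_le_mul_of_nonneg_right h2 (l1Step_nonneg hα hl (n + 1))).trans h1
  have hp : 0 < ((n : ℝ) + 1) ^ α := by positivity
  rw [Real.rpow_neg (by positivity), ← mul_inv, inv_mul_le_iff₀ (by positivity), mul_one] at h3
  exact_mod_cast h3

/-- The error of the L1 approximation in terms of the truncation errors. -/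
theorem IsFracStep.sub_l1Step_eq (hα : α ∈ Set.Ioo (0 : ℝ) 1) (hl : 0 ≤ l)
    {P : ℝ → ℝ} (hP : IsFracStep α l P) (n : ℕ) :
    P (n + 1 : ℕ) - l1Step α l (n + 1) = ∑ j ∈ range (n + 1),
      coeff j (discreteResolvent (l1Kernel α) l) *
        (∑ i ∈ range (n - j + 1), bCoeff α (n - j - i) * (P (i + 1) - P i)
          - (1 - l * P ((n - j : ℕ) + 1))) := by
  have hB := isKaluzaKernel_l1Kernel hα
  have hP0 := hP.eq_zero 0 le_rfl
  set h : ℕ → ℝ := fun n => ∑ j ∈ range (n + 1), coeff j ((1 - X) * l1Kernel α) * P (n - j : ℕ)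
    + l * P n with hh
  -- Summation by parts: the factor 1 - X is moved from the kernel to P; the boundary term vanishes
  -- because P(0) = 0.
  have hsum : ∀ n : ℕ, ∑ j ∈ range (n + 2), coeff j ((1 - X) * l1Kernel α) * P (n + 1 - j : ℕ) =
      ∑ i ∈ range (n + 1), bCoeff α (n - i) * (P (i + 1) - P i) := by
    intro n
    have e : ((1 - X) * l1Kernel α) * PowerSeries.mk (fun n : ℕ => P n) =
        ((1 - X) * PowerSeries.mk (fun n : ℕ => P n)) * l1Kernel α := by ring
    have e1 := congrArg (coeff (n + 1)) e
    rw [coeff_mul, coeff_mul, Nat.sum_antidiagonal_eq_sum_range_succ_mk,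
      Nat.sum_antidiagonal_eq_sum_range_succ_mk] at e1
    simp only [coeff_mk, l1Kernel] at e1
    rw [show (n + 1).succ = (n + 1) + 1 from rfl, sum_range_succ' (n := n + 1) (f := fun k =>
      coeff k ((1 - X) * PowerSeries.mk fun n : ℕ => P n) * bCoeff α (n + 1 - k))] at e1
    rw [l1Kernel, e1, coeff_one_sub_X_mul_zero, coeff_mk, Nat.cast_zero, hP0, zero_mul, add_zero]
    refine sum_congr rfl fun i _ => ?_
    rw [coeff_one_sub_X_mul_succ, coeff_mk, coeff_mk, Nat.add_sub_add_right, mul_comm]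
    push_cast; rfl
  have h0 : h 0 = 0 := by simp [hh, hP0]
  have hd := eq_sum_discreteResolvent hB hl (W := fun n : ℕ => P n) (h := h) (N := n + 1)
    (fun n _ => rfl) (n + 1) le_rfl
  rw [hd, sum_range_succ, Nat.sub_self, h0, mul_zero, add_zero, l1Step, ← sum_sub_distrib]
  refine sum_congr rfl fun j hj => ?_
  have hj' : j ≤ n := by simpa [Nat.lt_succ_iff] using hj
  rw [show n + 1 - j = (n - j) + 1 by omega]
  simp only [hh]
  rw [hsum (n - j)]
  push_cast
  ring

/-- Nonsmooth data estimate for the L1 approximation with unit step size. -/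
theorem exists_mul_abs_sub_l1Step_le (hα : α ∈ Set.Ioo (0 : ℝ) 1) :
    ∃ C : ℝ, 0 < C ∧ ∀ (l : ℝ) (P : ℝ → ℝ), 0 ≤ l → IsFracStep α l P → ∀ (n : ℕ) (M : ℝ),
      P n ≤ M → l1Step α l n ≤ M → n * |P n - l1Step α l n| ≤ C * M := by
  have hb : 0 < 1 - α := by linarith [hα.2]
  have hG := Real.Gamma_pos_of_pos hb
  have hG1 := Real.Gamma_pos_of_pos (show 0 < α + 1 by linarith [hα.1])
  have hB := isKaluzaKernel_l1Kernel hα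
  have hb0 : 0 < bCoeff α 0 := lt_of_lt_of_le (by positivity) (bCoeff_ge hα 0)
  -- The two summands satisfy the two requirements on c₀, via P(1) ≤ 1/Γ(α+1); this bound of P(1)
  -- does not depend on l.
  set c₀ := 2 * (Real.Gamma (α + 1))⁻¹ +
    Real.Gamma (1 - α) * (bCoeff α 0 * (Real.Gamma (α + 1))⁻¹ + 1) with hc₀
  set A := (bCoeff α 0)⁻¹ with hA
  set A' := (1 - α)⁻¹ + 1 with hA'
  have hA0 : 0 < A := inv_pos.2 hb0
  have hA'0 : 0 < A' := by positivity
  have hc₀0 : 0 < c₀ := by positivity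
  refine ⟨(Real.Gamma (1 - α))⁻¹ * (A' * (4 * c₀ + 3 * A)), by positivity, ?_⟩
  intro l P hl hP n M hPM hLM
  have hM0 : 0 ≤ M := (hP.nonneg hα hl n).trans hPM
  rcases n with _ | n
  · simp; positivity
  set g : ℕ → ℝ := fun i => coeff i (discreteResolvent (l1Kernel α) l) with hg
  have hg0 : ∀ i, 0 ≤ g i := discreteResolvent_nonneg hB hl
  have hP1 : P 1 ≤ (Real.Gamma (α + 1))⁻¹ := by
    simpa using hP.le_rpow hα hl (t := 1) zero_le_one
  have hP0 := hP.eq_zero 0 le_rfl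
  have hm := hP.monotone hα hl
  have hcv := hP.concaveOn hα hl
  have hS1 : P 2 - P 1 ≤ P 1 := by
    have := slope_anti_of_concaveOn hcv (x₁ := 0) (y₁ := 1) (x₂ := 1) (y₂ := 2)
      le_rfl zero_le_one one_le_two zero_lt_one one_lt_two
    norm_num [hP0] at this
    linarith
  have hc1 : 2 * P 1 ≤ c₀ := by
    have : 0 ≤ Real.Gamma (1 - α) * (bCoeff α 0 * (Real.Gamma (α + 1))⁻¹ + 1) := by positivity
    linarith
  have hc2 : Real.Gamma (1 - α) * (bCoeff α 0 * P 1 + 1) ≤ c₀ := by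
    have h1 : Real.Gamma (1 - α) * (bCoeff α 0 * P 1 + 1) ≤
        Real.Gamma (1 - α) * (bCoeff α 0 * (Real.Gamma (α + 1))⁻¹ + 1) := by gcongr
    have : 0 ≤ (Real.Gamma (α + 1))⁻¹ := by positivity
    linarith
  set β := cellVar α with hβ
  set D := secondDiff c₀ P with hD
  set D' := secondDiff 0 P with hD'
  have hβ0 : ∀ i, 0 ≤ β i := cellVar_nonneg hα
  have hD'0 : ∀ i, 0 ≤ D' i := by
    intro i
    simp only [hD', secondDiff]
    split_ifs with hi
    · exact le_rfl
    · have hi1 : (1 : ℝ) ≤ i := by exact_mod_cast Nat.pos_of_ne_zero hi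
      have := slope_anti_of_concaveOn hcv (x₁ := (i : ℝ) - 1) (y₁ := i) (x₂ := i + 1) (y₂ := i + 2)
        (by linarith) (by linarith) (by linarith) (by linarith) (by linarith)
      rw [show (i : ℝ) - (i - 1) = 1 by ring, show (i : ℝ) + 2 - (i + 1) = 1 by ring, div_one,
        div_one] at this
      linarith
  have hDD' : PowerSeries.mk D = C c₀ + PowerSeries.mk D' := by
    ext i
    rw [coeff_mk, map_add, coeff_C, coeff_mk]
    simp only [hD, hD', secondDiff]
    split_ifs <;> simp
  -- H is the convolution of the cell variations with the resolvent. It is bounded by A'A and decays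
  -- like 2A'M/(m + 1).
  set H : ℕ → ℝ := fun m => ∑ p ∈ antidiagonal m, β p.1 * g p.2 with hH
  have hH0 : ∀ m, 0 ≤ H m := fun m => sum_nonneg fun p _ => mul_nonneg (hβ0 _) (hg0 _)
  have hβS : ∀ m, ∑ i ∈ range m, β i ≤ A' := sum_cellVar_le hα
  have hgS : ∀ m ≤ n, ∑ i ∈ range (m + 1), g i ≤ M := fun m hmn =>
    (sum_le_sum_of_subset_of_nonneg (range_mono (by omega)) fun i _ _ => hg0 i).trans hLM
  have hgA : ∀ j, g j ≤ A := fun j => by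
    have := discreteResolvent_zero_le hB hl j
    rwa [show coeff 0 (l1Kernel α) = bCoeff α 0 from coeff_mk 0 _] at this
  have hHA : ∀ m, H m ≤ A' * A := fun m =>
    sum_antidiagonal_mul_le hβ0 (fun j _ => hgA j) hA0.le (hβS _)
  have hHM : ∀ m ≤ n, ((m : ℝ) + 1) * H m ≤ 2 * A' * M := fun m hmn =>
    succ_mul_sum_antidiagonal_le_of_decay hβ0 hg0 hA'0.le hM0
      (fun i _ => (succ_mul_cellVar_le hα i).trans (by linarith)) (hβS _)
      (fun i hi => by
        have := discreteResolvent_mul_le_sum hB hl i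
        rw [mul_comm]
        exact this.trans (hgS i (hi.trans hmn))) (hgS m hmn)
  have hD'S : ∑ i ∈ range (n + 1), D' i ≤ c₀ := by
    rw [hD', sum_secondDiff, hP0]
    have := hm (show (n : ℝ) ≤ n + 2 by linarith)
    linarith
  have hD'S2 : ∑ i ∈ range (n + 1), ((i : ℝ) + 1) * D' i ≤ 3 * M := by
    rw [hD', sum_succ_mul_secondDiff, hP0]
    push_cast at hPM
    have h1 := hm (show (n : ℝ) ≤ n + 1 by linarith)
    have h2 := hm (show (n : ℝ) + 1 ≤ n + 2 by linarith)
    have h3 := hm (show (1 : ℝ) ≤ n + 1 by simp)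
    have h4 : 0 ≤ (n : ℝ) * (P (n + 1) - P n) := mul_nonneg (by positivity) (by linarith)
    have h5 : 0 ≤ ((n : ℝ) + 1) * (P (n + 2) - P (n + 1)) := mul_nonneg (by positivity) (by linarith)
    linarith
  -- The factor n + 1 goes either to D', whose first moment is at most 3M while H is bounded, or to
  -- H, which decays while D' has mass at most c₀.
  have hconv : ((n : ℝ) + 1) * ∑ p ∈ antidiagonal n, D' p.1 * H p.2 ≤
      3 * M * (A' * A) + c₀ * (2 * A' * M) := by
    refine (succ_mul_sum_antidiagonal_le n hD'0 hH0).trans (add_le_add ?_ ?_)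
    · exact sum_antidiagonal_mul_le (x := fun i => ((i : ℝ) + 1) * D' i)
        (fun i => mul_nonneg (by positivity) (hD'0 i)) (fun j _ => hHA j) (by positivity) hD'S2
    · exact sum_antidiagonal_mul_le (y := fun j => ((j : ℝ) + 1) * H j) hD'0 hHM
        (by positivity) hD'S
  have htot : |P (n + 1 : ℕ) - l1Step α l (n + 1)| ≤ (Real.Gamma (1 - α))⁻¹ *
      (c₀ * H n + ∑ p ∈ antidiagonal n, D' p.1 * H p.2) := by
    have e1 : c₀ * H n + ∑ p ∈ antidiagonal n, D' p.1 * H p.2 =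
        coeff n (PowerSeries.mk g * (PowerSeries.mk D * PowerSeries.mk β)) := by
      have hHs : PowerSeries.mk H = PowerSeries.mk β * PowerSeries.mk g := by
        ext m; simp [hH, coeff_mul]
      have : PowerSeries.mk g * (PowerSeries.mk D * PowerSeries.mk β) =
          C c₀ * PowerSeries.mk H + PowerSeries.mk D' * PowerSeries.mk H := by
        rw [hDD', hHs]; ring
      rw [this, map_add, coeff_C_mul, coeff_mul]
      simp
    rw [hP.sub_l1Step_eq hα hl, e1, coeff_mul, Nat.sum_antidiagonal_eq_sum_range_succ_mk, mul_sum]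
    refine (abs_sum_le_sum_abs _ _).trans (sum_le_sum fun j _ => ?_)
    rw [abs_mul, abs_of_nonneg (hg0 j), coeff_mk, mul_left_comm]
    refine mul_le_mul_of_nonneg_left ?_ (hg0 j)
    refine (hP.abs_truncation_le hα hl hc1 hc2 (n - j)).trans_eq ?_
    rw [coeff_mul, Nat.sum_antidiagonal_eq_sum_range_succ_mk]
    simp [hD, hβ, mul_comm]
  have hHn := hHM n le_rfl
  calc ((n + 1 : ℕ) : ℝ) * |P (n + 1 : ℕ) - l1Step α l (n + 1)|
      ≤ ((n + 1 : ℕ) : ℝ) * ((Real.Gamma (1 - α))⁻¹ *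
      (c₀ * H n + ∑ p ∈ antidiagonal n, D' p.1 * H p.2)) :=
        mul_le_mul_of_nonneg_left htot (Nat.cast_nonneg _)
    _ = (Real.Gamma (1 - α))⁻¹ * (c₀ * (((n : ℝ) + 1) * H n) +
        ((n : ℝ) + 1) * ∑ p ∈ antidiagonal n, D' p.1 * H p.2) := by push_cast; ring
    _ ≤ (Real.Gamma (1 - α))⁻¹ * (c₀ * (2 * A' * M) + (3 * M * (A' * A) + c₀ * (2 * A' * M))) := by
        gcongr
    _ = _ := by ring

/-- The error of the time stepping kernels, uniformly in `l`. -/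
theorem exists_kernel_error_le (hα : α ∈ Set.Ioo (0 : ℝ) 1) :
    ∃ C : ℝ, 0 < C ∧ ∀ (l : ℝ) (Φ : ℝ → ℝ), 0 ≤ l → IsFracStep α l Φ → ∀ τ : ℝ, 0 < τ →
      (∀ n : ℕ, 1 ≤ n → l * |Φ (n * τ) - τ ^ α * l1Step α (l * τ ^ α) n| ≤ C * τ * (n * τ)⁻¹) ∧
      ∀ (m : ℕ) (t : ℝ), 0 < t → t ∈ Set.Icc (m * τ) ((m + 1) * τ) →
        |Φ t - τ ^ α * l1Step α (l * τ ^ α) (m + 1)| ≤ C * τ * t ^ (α - 1) := by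
  obtain ⟨C, hC, hmain⟩ := exists_mul_abs_sub_l1Step_le hα
  have hG := Real.Gamma_pos_of_pos (show 0 < 1 - α by linarith [hα.2])
  have hG1 := Real.Gamma_pos_of_pos (show 0 < α + 1 by linarith [hα.1])
  set C₁ := (Real.Gamma (α + 1))⁻¹ + Real.Gamma (1 - α) with hC₁
  have hC₁0 : 0 < C₁ := by positivity
  refine ⟨C + (Real.Gamma (α + 1))⁻¹ + C * C₁, by positivity, ?_⟩
  intro l Φ hl hΦ τ hτ
  have hp := Real.rpow_pos_of_pos hτ α
  have hP := hΦ.scale hτ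
  set P : ℝ → ℝ := fun x => (τ ^ α)⁻¹ * Φ (τ * x) with hPdef
  set μ := l * τ ^ α with hμ
  have hμ0 : 0 ≤ μ := by positivity
  have hΦP : ∀ x, Φ (x * τ) = τ ^ α * P x := by
    intro x; rw [hPdef]; simp only; rw [mul_inv_cancel_left₀ hp.ne', mul_comm]
  constructor
  · intro n hn
    have hn' : (0 : ℝ) < n := by exact_mod_cast hn
    rcases hl.eq_or_lt with rfl | hl0
    · rw [zero_mul]; positivity
    have hμp : 0 < μ := by positivity
    have h1 : P n ≤ μ⁻¹ := by
      rw [← one_div, le_div_iff₀ hμp, mul_comm]; exact hP.mul_le_one hα hμ0 n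
    -- With M = 1/μ as common bound the factor μ cancels, leaving C/n whatever the size of l.
    have h2 : l1Step α μ n ≤ μ⁻¹ := by
      rw [← one_div, le_div_iff₀ hμp, mul_comm]; exact mul_l1Step_le_one hα hμ0 n
    have h3 := hmain μ P hμ0 hP n μ⁻¹ h1 h2
    have e : l * |Φ (n * τ) - τ ^ α * l1Step α μ n| = μ * |P n - l1Step α μ n| := by
      rw [hΦP, ← mul_sub, abs_mul, abs_of_pos hp, hμ]; ring
    rw [e]
    have h4 : μ * |P n - l1Step α μ n| ≤ C * (n : ℝ)⁻¹ := by
      rw [← div_eq_mul_inv, le_div_iff₀ hn']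
      have := mul_le_mul_of_nonneg_left h3 hμp.le
      rw [mul_left_comm, mul_left_comm μ C, mul_inv_cancel₀ hμp.ne', mul_one] at this
      linarith
    have e2 : τ * ((n : ℝ) * τ)⁻¹ = (n : ℝ)⁻¹ := by field_simp
    rw [mul_assoc _ τ, e2]
    refine h4.trans (mul_le_mul_of_nonneg_right ?_ (by positivity))
    have : 0 ≤ (Real.Gamma (α + 1))⁻¹ := by positivity
    have : 0 ≤ C * C₁ := by positivity
    linarith
  · intro m t ht hmem
    set x := t / τ with hx
    have hx0 : 0 < x := by positivity
    have htx : t = x * τ := by rw [hx]; field_simp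
    have hxm : x ≤ m + 1 := (div_le_iff₀ hτ).2 hmem.2
    have hmx : (m : ℝ) ≤ x := (le_div_iff₀ hτ).2 hmem.1
    have hx1 : (x ^ α) / x = x ^ (α - 1) := by rw [Real.rpow_sub_one hx0.ne']
    have hm := hP.monotone hα hμ0
    -- By monotonicity and concavity, P(m+1) - P(x) ≤ P(x+1) - P(x) ≤ P(x)/x, so replacing x by the
    -- next grid point has the same order as the scheme error.
    have h1 : P (m + 1) - P x ≤ (Real.Gamma (α + 1))⁻¹ * x ^ (α - 1) := by
      have s := slope_anti_of_concaveOn (hP.concaveOn hα hμ0) (x₁ := 0) (y₁ := x) (x₂ := x)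
        (y₂ := x + 1) le_rfl hx0.le (by linarith) hx0 (by linarith)
      rw [hP.eq_zero 0 le_rfl, sub_zero, sub_zero, add_sub_cancel_left, div_one] at s
      have s2 := hm (show (m : ℝ) + 1 ≤ x + 1 by linarith)
      have s3 := div_le_div_of_nonneg_right (hP.le_rpow hα hμ0 hx0.le) hx0.le
      rw [div_right_comm, hx1] at s3
      rw [inv_mul_eq_div]
      linarith
    -- Here the common bound is M = C₁(m+1)^α; dividing by m + 1 leaves the exponent α - 1, and x ≤
    -- m + 1.
    have h2 : |P (m + 1 : ℕ) - l1Step α μ (m + 1)| ≤ C * C₁ * x ^ (α - 1) := by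
      have hm1 : (0 : ℝ) < (m + 1 : ℕ) := by positivity
      have hma : (0 : ℝ) ≤ ((m + 1 : ℕ) : ℝ) ^ α := by positivity
      have b1 : P (m + 1 : ℕ) ≤ C₁ * ((m + 1 : ℕ) : ℝ) ^ α := by
        have := hP.le_rpow hα hμ0 hm1.le
        rw [div_eq_inv_mul] at this
        have := mul_nonneg hG.le hma
        rw [hC₁, add_mul]; linarith
      have b2 : l1Step α μ (m + 1) ≤ C₁ * ((m + 1 : ℕ) : ℝ) ^ α := by
        have := l1Step_le_rpow hα hμ0 (m + 1)
        have : 0 ≤ (Real.Gamma (α + 1))⁻¹ * ((m + 1 : ℕ) : ℝ) ^ α := by positivity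
        rw [hC₁, add_mul]; linarith
      have b3 := hmain μ P hμ0 hP (m + 1) _ b1 b2
      have b4 : |P (m + 1 : ℕ) - l1Step α μ (m + 1)| ≤ C * C₁ * ((m + 1 : ℕ) : ℝ) ^ (α - 1) := by
        rw [Real.rpow_sub_one hm1.ne', ← mul_div_assoc, le_div_iff₀ hm1]
        linarith
      refine b4.trans (mul_le_mul_of_nonneg_left ?_ (by positivity))
      exact Real.rpow_le_rpow_of_nonpos hx0 (by push_cast; exact hxm) (by linarith [hα.2])
    have h3 : |P x - l1Step α μ (m + 1)| ≤ ((Real.Gamma (α + 1))⁻¹ + C * C₁) * x ^ (α - 1) := by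
      push_cast at h2
      have s := hm hxm
      rw [abs_le] at h2 ⊢
      constructor <;> linarith
    rw [htx, hΦP, ← mul_sub, abs_mul, abs_of_pos hp]
    have hxt : τ ^ α * x ^ (α - 1) = τ * (x * τ) ^ (α - 1) := by
      rw [Real.mul_rpow hx0.le hτ.le, Real.rpow_sub_one hτ.ne']; field_simp
    calc τ ^ α * |P x - l1Step α μ (m + 1)|
        ≤ τ ^ α * (((Real.Gamma (α + 1))⁻¹ + C * C₁) * x ^ (α - 1)) :=
          mul_le_mul_of_nonneg_left h3 hp.le
      _ = ((Real.Gamma (α + 1))⁻¹ + C * C₁) * (τ ^ α * x ^ (α - 1)) := by ring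
      _ = ((Real.Gamma (α + 1))⁻¹ + C * C₁) * τ * (x * τ) ^ (α - 1) := by rw [hxt]; ring
      _ ≤ _ := by
        have : 0 ≤ (x * τ) ^ (α - 1) := by positivity
        gcongr
        linarith

end L1Error

end TwoScaleFPE

/-! ### Duhamel formulas and the scalar error representation. -/

namespace TwoScaleFPE

section Representation

open Filter Topology

variable {α l : ℝ}

/-- Scaling to the unit interval gives I^a w(t) = t^a I^a(w(t·))(1), which removes t from the
singular kernel; dominated convergence applies after extending w to a bounded continuous function.
-/
theorem continuousOn_fracInt {a : ℝ} (ha : 0 < a) {w : ℝ → ℝ} {T : ℝ} (hT : 0 ≤ T)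
    (hw : ContinuousOn w (Icc 0 T)) : ContinuousOn (fracInt a w) (Icc 0 T) := by
  set v := IccExtend hT ((Icc 0 T).domRestrict w) with hv
  have hvc : Continuous v := (continuousOn_iff_continuous_domRestrict.1 hw).Icc_extend'
  have hvw : ∀ s ∈ Icc 0 T, w s = v s := fun s hs => by
    rw [hv, IccExtend_of_mem hT _ hs]; rfl
  obtain ⟨M, hM⟩ := isCompact_Icc.exists_bound_of_continuousOn (s := Icc 0 T) hvc.continuousOn
  have hMv : ∀ s, ‖v s‖ ≤ M := by
    intro s
    have : v s = v (projIcc 0 T hT s) := by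
      rw [hv, IccExtend_of_mem hT _ (projIcc 0 T hT s).2, IccExtend, Function.comp]
    rw [this]; exact hM _ (projIcc 0 T hT s).2
  have hcont : Continuous fun t : ℝ => fracInt a (fun y => v (t * y)) 1 := by
    unfold fracInt
    refine continuous_const.mul ?_
    refine intervalIntegral.continuous_of_dominated_interval
      (bound := fun ξ => ‖(1 - ξ : ℝ) ^ (a - 1)‖ * M) (fun t => ?_) (fun t => ?_) ?_ ?_
    · exact ((by fun_prop : Measurable fun ξ : ℝ => (1 - ξ) ^ (a - 1)).mul
        (by fun_prop : Continuous fun ξ : ℝ => v (t * ξ)).measurable).aestronglyMeasurable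
    · filter_upwards with ξ hξ
      rw [norm_mul]
      exact mul_le_mul_of_nonneg_left (hMv _) (norm_nonneg _)
    · exact (intervalIntegrable_sub_rpow ha 1 0 1).norm.mul_const M
    · filter_upwards with ξ hξ
      fun_prop
  have h2 : ContinuousOn (fun t : ℝ => t ^ a * fracInt a (fun y => v (t * y)) 1) (Icc 0 T) :=
    ((continuous_id.rpow_const fun t => Or.inr ha.le).mul hcont).continuousOn
  refine h2.congr fun t ht => ?_
  rw [fracInt_congr ht.1 fun s hs => hvw s ⟨hs.1, hs.2.trans ht.2⟩]
  rcases ht.1.eq_or_lt with rfl | h0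
  · simp [fracInt, Real.zero_rpow ha.ne']
  · have := fracInt_scale (a := a) h0 v zero_le_one
    rwa [mul_one] at this

theorem eqOn_of_integral_eq {w v : ℝ → ℝ} {T : ℝ} (hT : 0 < T) (hw : ContinuousOn w (Icc 0 T))
    (hv : ContinuousOn v (Icc 0 T))
    (h : ∀ t ∈ Icc 0 T, ∫ s in (0 : ℝ)..t, w s = ∫ s in (0 : ℝ)..t, v s) :
    ∀ t ∈ Icc 0 T, w t = v t := by
  have hIoo : ∀ t ∈ Ioo 0 T, w t = v t := by
    intro t ht
    have hnhds : Icc 0 T ∈ 𝓝 t := Icc_mem_nhds ht.1 ht.2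
    have hd : ∀ u : ℝ → ℝ, ContinuousOn u (Icc 0 T) →
        HasDerivAt (fun t => ∫ s in (0 : ℝ)..t, u s) (u t) t := by
      intro u hu
      refine intervalIntegral.integral_hasDerivAt_right ?_ ?_ (hu.continuousAt hnhds)
      · refine ContinuousOn.intervalIntegrable (hu.mono ?_)
        rw [uIcc_of_le ht.1.le]; exact Icc_subset_Icc_right ht.2.le
      · exact (hu.mono Ioo_subset_Icc_self).stronglyMeasurableAtFilter isOpen_Ioo t ht
    have h1 := hd w hw
    have h2 := hd v hv
    refine (h1.congr_of_eventuallyEq ?_).unique h2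
    filter_upwards [hnhds] with s hs using (h s hs).symm
  have hcl : closure (Ioo 0 T) = Icc 0 T := closure_Ioo hT.ne
  exact EqOn.of_subset_closure hIoo hw hv Ioo_subset_Icc_self hcl.ge

/-- An equation with a Riemann-Liouville derivative is a Volterra equation. -/
theorem eq_fracInt_of_hasRLDerivAt (hα : α ∈ Ioo (0 : ℝ) 1) {T : ℝ} (hT : 0 < T) {w D : ℝ → ℝ}
    (hw : ContinuousOn w (Icc 0 T)) (hD : ContinuousOn D (Icc 0 T))
    (h : ∀ t ∈ Ioc 0 T, HasRLDerivAt α T w (D t) t) :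
    ∀ t ∈ Icc 0 T, w t = fracInt α D t := by
  have hb : 0 < 1 - α := by linarith [hα.2]
  have hDi : ∀ t ∈ Icc 0 T, IntervalIntegrable D volume 0 t := fun t ht =>
    ContinuousOn.intervalIntegrable (hD.mono (by
      rw [uIcc_of_le ht.1]; exact Icc_subset_Icc_right ht.2))
  -- The Riemann–Liouville derivative is the ordinary derivative of I^(1-α)w, which vanishes at 0.
  -- Only interior times are needed here.
  have hJ : ∀ t ∈ Icc 0 T, fracInt (1 - α) w t = ∫ s in (0 : ℝ)..t, D s := by
    intro t ht
    have hc : ContinuousOn (fracInt (1 - α) w) (Icc 0 t) :=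
      (continuousOn_fracInt hb hT.le hw).mono (Icc_subset_Icc_right ht.2)
    rw [intervalIntegral.integral_eq_sub_of_hasDerivAt_of_le ht.1 hc (fun s hs => ?_) (hDi t ht)]
    · simp [fracInt]
    · have hsT : s < T := hs.2.trans_le ht.2
      have := (h s ⟨hs.1, hsT.le⟩).hasDerivAt (Icc_mem_nhds hs.1 hsT)
      refine this.congr_of_eventuallyEq (Eventually.of_forall fun t' => ?_)
      simp only [fracInt, show 1 - α - 1 = -α by ring]
  have hV := continuousOn_fracInt hα.1 hT.le hD
  refine eqOn_of_integral_eq hT hw hV fun t ht => ?_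
  have hsub : ∀ {u : ℝ → ℝ}, ContinuousOn u (Icc 0 T) → IntervalIntegrable u volume 0 t := fun hu =>
    ContinuousOn.intervalIntegrable (hu.mono (by
      rw [uIcc_of_le ht.1]; exact Icc_subset_Icc_right ht.2))
  -- Both w and I^α D have the primitive of D as their I^(1-α). Applying I^α turns this into
  -- equality of their primitives, hence of the continuous functions themselves.
  rw [← fracInt_fracInt_one_sub hα ht.1 (hsub hw), ← fracInt_fracInt_one_sub hα ht.1 (hsub hV)]
  refine fracInt_congr ht.1 fun s hs => ?_
  have hs' : s ∈ Icc 0 T := ⟨hs.1, hs.2.trans ht.2⟩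
  rw [hJ s hs']
  have := fracInt_fracInt_one_sub (a := 1 - α) ⟨hb, by linarith [hα.1]⟩ hs.1 (hDi s hs')
  rw [sub_sub_cancel] at this
  exact this.symm

/-- As Φ vanishes for negative times, the upper limit t can be replaced by T, and t then enters only
through the continuous Φ. -/
theorem IsFracStep.continuousOn_conv {Φ : ℝ → ℝ} (hΦ : IsFracStep α l Φ) {T : ℝ}
    {c : ℝ → ℝ} (hc : IntervalIntegrable c volume 0 T) :
    ContinuousOn (fun t => ∫ r in (0 : ℝ)..t, Φ (t - r) * c r) (Icc 0 T) := by
  have hΦc := hΦ.continuous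
  obtain ⟨M, hM⟩ := isCompact_Icc.exists_bound_of_continuousOn (s := Icc (-T) T) hΦc.continuousOn
  have hsub : ∀ t ∈ Icc 0 T, IntervalIntegrable (fun r => Φ (t - r) * c r) volume 0 T := fun t _ =>
    hc.continuousOn_mul (by fun_prop)
  have key : ContinuousOn (fun t => ∫ r in (0 : ℝ)..T, Φ (t - r) * c r) (Icc 0 T) := by
    intro t₀ ht₀
    refine intervalIntegral.continuousWithinAt_of_dominated_interval
      (bound := fun r => M * ‖c r‖) ?_ ?_ (hc.norm.const_mul M) ?_
    · filter_upwards [self_mem_nhdsWithin] with t ht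
      rw [uIoc_of_le (ht.1.trans ht.2)]
      exact (hsub t ht).aestronglyMeasurable
    · filter_upwards [self_mem_nhdsWithin] with t ht
      filter_upwards with r hr
      rw [uIoc_of_le (ht.1.trans ht.2)] at hr
      rw [norm_mul]
      exact mul_le_mul_of_nonneg_right
        (hM _ ⟨by linarith [ht.1, hr.2], by linarith [ht.2, hr.1]⟩) (norm_nonneg _)
    · filter_upwards with r _
      exact (by fun_prop : Continuous fun t => Φ (t - r) * c r).continuousWithinAt
  refine key.congr fun t ht => ?_
  have e := intervalIntegral.integral_add_adjacent_intervals
    ((hsub t ht).mono_set (by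
      rw [uIcc_of_le ht.1, uIcc_of_le (ht.1.trans ht.2)]; exact Icc_subset_Icc_right ht.2))
    ((hsub t ht).mono_set (a := 0) (c := t) (d := T) (by
      rw [uIcc_of_le ht.2, uIcc_of_le (ht.1.trans ht.2)]; exact Icc_subset_Icc_left ht.1))
  simp only
  rw [← e, left_eq_add]
  refine (intervalIntegral.integral_congr (g := fun _ => (0 : ℝ)) fun s hs => ?_).trans (by simp)
  rw [uIcc_of_le ht.2] at hs
  simp only
  rw [hΦ.eq_zero (t - s) (by linarith [hs.1]), zero_mul]

/-- Duhamel's formula for the scalar fractional evolution equation. -/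
theorem IsFracStep.duhamel (hα : α ∈ Ioo (0 : ℝ) 1) (hl : 0 ≤ l) {Φ : ℝ → ℝ}
    (hΦ : IsFracStep α l Φ) {T : ℝ} (hT : 0 < T) {y g g' : ℝ → ℝ}
    (hy : ContinuousOn y (Icc 0 T)) (hg' : IntervalIntegrable g' volume 0 T)
    (hg : ∀ t ∈ Icc 0 T, g t = g 0 + ∫ r in (0 : ℝ)..t, g' r)
    (h : ∀ t ∈ Ioc 0 T, HasRLDerivAt α T (fun ξ => y ξ - y 0) (g t - l * y t) t) :
    ∀ t ∈ Icc 0 T, y t = (1 - l * Φ t) * y 0 + Φ t * g 0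
      + ∫ r in (0 : ℝ)..t, Φ (t - r) * g' r := by
  have hΦc := hΦ.continuous
  have hgi : ∀ t ∈ Icc 0 T, IntervalIntegrable g' volume 0 t := fun t ht =>
    hg'.mono_set (by
      rw [uIcc_of_le ht.1, uIcc_of_le hT.le]; exact Icc_subset_Icc_right ht.2)
  have hgc : ContinuousOn g (Icc 0 T) := by
    have h1 : ContinuousOn (fun t => ∫ r in (0 : ℝ)..t, g' r) (Icc 0 T) := by
      have := intervalIntegral.continuousOn_primitive_interval' (μ := volume) hg'
        (left_mem_uIcc (a := (0 : ℝ)) (b := T))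
      rwa [uIcc_of_le hT.le] at this
    exact (continuousOn_const.add h1).congr hg
  have hconv := hΦ.continuousOn_conv hg'
  set z : ℝ → ℝ := fun t => (1 - l * Φ t) * y 0 + Φ t * g 0
      + ∫ r in (0 : ℝ)..t, Φ (t - r) * g' r with hz
  have hzc : ContinuousOn z (Icc 0 T) :=
    (by fun_prop : ContinuousOn (fun t => (1 - l * Φ t) * y 0 + Φ t * g 0) (Icc 0 T)).add hconv
  have hgl : ∀ u : ℝ → ℝ, ContinuousOn u (Icc 0 T) →
      ContinuousOn (fun t => g t - l * u t) (Icc 0 T) :=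
    fun u hu => hgc.sub (continuousOn_const.mul hu)
  have hyV : ∀ t ∈ Icc 0 T, y t - y 0 = fracInt α (fun s => g s - l * y s) t :=
    eq_fracInt_of_hasRLDerivAt hα hT (hy.sub continuousOn_const) (hgl y hy) h
  have hF : Continuous fun s => 1 - l * Φ s := by fun_prop
  have hcF : ContinuousOn (fun t => ∫ r in (0 : ℝ)..t, (1 - l * Φ (t - r)) * g' r) (Icc 0 T) := by
    have h1 : ContinuousOn (fun t => (g t - g 0) - l * ∫ r in (0 : ℝ)..t, Φ (t - r) * g' r)
        (Icc 0 T) := (hgc.sub continuousOn_const).sub (continuousOn_const.mul hconv)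
    refine h1.congr fun t ht => ?_
    simp only [sub_mul, one_mul, mul_assoc]
    rw [intervalIntegral.integral_sub (hgi t ht) (((hgi t ht).continuousOn_mul
      (by fun_prop)).const_mul l), intervalIntegral.integral_const_mul, hg t ht]
    ring
  -- Because g is g(0) plus a primitive, g - lz is (g(0) - l y(0))(1 - lΦ) plus a convolution of 1 -
  -- lΦ with g'. The operator I^α maps 1 - lΦ to Φ in both terms, so z solves the equation of y and
  -- uniqueness applies.
  have hzV : ∀ t ∈ Icc 0 T, z t - y 0 = fracInt α (fun s => g s - l * z s) t := by
    intro t ht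
    have hsubset : uIcc 0 t ⊆ Icc 0 T := by
      rw [uIcc_of_le ht.1]; exact Icc_subset_Icc_right ht.2
    have e1 : fracInt α (fun s => g s - l * z s) t = fracInt α (fun s =>
        (g 0 - l * y 0) * (1 - l * Φ s) + ∫ r in (0 : ℝ)..s, (1 - l * Φ (s - r)) * g' r) t := by
      refine fracInt_congr ht.1 fun s hs => ?_
      have hs' : s ∈ Icc 0 T := ⟨hs.1, hs.2.trans ht.2⟩
      simp only [sub_mul, one_mul, mul_assoc]
      rw [intervalIntegral.integral_sub (hgi s hs') (((hgi s hs').continuousOn_mul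
        (by fun_prop)).const_mul l), intervalIntegral.integral_const_mul, hg s hs', hz]
      ring
    rw [e1, fracInt_add hα.1 (by fun_prop) (hcF.mono hsubset), fracInt_const_mul,
      ← hΦ.eq_fracInt t ht.1]
    have e2 := fracInt_conv hα.1 hF (fun x _ => by linarith [hΦ.mul_le_one hα hl x]) (M := Φ t)
      ht.1 (fun u hu => by
        rw [← hΦ.eq_fracInt u hu.1]; exact hΦ.monotone hα hl hu.2) (hgi t ht)
    rw [e2]
    have e3 : ∫ r in (0 : ℝ)..t, fracInt α (fun s => 1 - l * Φ s) (t - r) * g' r =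
        ∫ r in (0 : ℝ)..t, Φ (t - r) * g' r := by
      refine intervalIntegral.integral_congr fun r hr => ?_
      rw [uIcc_of_le ht.1] at hr
      rw [← hΦ.eq_fracInt (t - r) (by linarith [hr.2])]
    rw [e3, hz]
    ring
  have hdiff := eq_zero_of_volterra hα.1 hl (hy.sub hzc) (fun t ht => by
    have hsubset : uIcc 0 t ⊆ Icc 0 T := by
      rw [uIcc_of_le ht.1]; exact Icc_subset_Icc_right ht.2
    have e1 : y t - z t = fracInt α (fun s => (g s - l * y s) - (g s - l * z s)) t := by
      rw [fracInt_sub hα.1 ((hgl y hy).mono hsubset) ((hgl z hzc).mono hsubset), ← hzV t ht, ← hyV t ht]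
      ring
    have e2 : (fun s => (g s - l * y s) - (g s - l * z s)) = fun s => (-l) * (y s - z s) := by
      ext s; ring
    change y t - z t = -(l * fracInt α (fun s => y s - z s) t)
    rw [e1, e2, fracInt_const_mul]
    ring)
  intro t ht
  exact sub_eq_zero.1 (hdiff t ht)

open PowerSeries in
/-- Duhamel's formula for the scalar L1 scheme. -/
theorem l1_duhamel (hα : α ∈ Ioo (0 : ℝ) 1) (hl : 0 ≤ l) {τ : ℝ} (hτ : 0 < τ) {N : ℕ}
    {Y g : ℕ → ℝ} (h : ∀ n, 1 ≤ n → n ≤ N →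
      ∑ j ∈ Finset.range n, dCoeff α τ j * (Y (n - j) - Y 0) + l * Y n = g n) :
    Y N = Y 0 + τ ^ α * ∑ j ∈ Finset.range N,
      coeff j (discreteResolvent (l1Kernel α) (l * τ ^ α)) * (g (N - j) - l * Y 0) := by
  have hp := Real.rpow_pos_of_pos hτ α
  have hd : ∀ j, τ ^ α * dCoeff α τ j = coeff j ((1 - X) * l1Kernel α) := by
    have hpp : τ ^ α * τ ^ (-α) = 1 := by rw [← Real.rpow_add hτ]; simp
    intro j
    rcases j with _ | j
    · rw [coeff_one_sub_X_mul_zero, l1Kernel, coeff_mk, dCoeff, ← mul_assoc, hpp, one_mul]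
    · rw [coeff_one_sub_X_mul_succ, l1Kernel, coeff_mk, coeff_mk, dCoeff, ← mul_assoc, hpp, one_mul]
  -- The scheme says nothing at n = 0; the datum there is set to 0, consistent with the vanishing
  -- difference Y(0) - Y(0).
  have key := eq_sum_discreteResolvent (isKaluzaKernel_l1Kernel hα)
    (show 0 ≤ l * τ ^ α by positivity) (W := fun n => Y n - Y 0)
    (h := fun n => if n = 0 then 0 else τ ^ α * (g n - l * Y 0)) (N := N) (fun n hn => ?_) N le_rfl
  · rw [Finset.sum_range_succ, Nat.sub_self, if_pos rfl, mul_zero, add_zero] at key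
    rw [← sub_eq_iff_eq_add', key, Finset.mul_sum]
    refine Finset.sum_congr rfl fun j hj => ?_
    rw [if_neg (by have := Finset.mem_range.1 hj; omega)]
    ring
  · split_ifs with h0
    · simp [h0]
    · rw [Finset.sum_range_succ, Nat.sub_self, sub_self, mul_zero, add_zero,
        ← h n (by omega) hn, mul_sub, mul_sub (τ ^ α), mul_add, Finset.mul_sum]
      have : ∀ j, coeff j ((1 - X) * l1Kernel α) * (Y (n - j) - Y 0) =
          τ ^ α * (dCoeff α τ j * (Y (n - j) - Y 0)) := fun j => by rw [← hd, mul_assoc]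
      simp only [this]
      ring

open PowerSeries in
/-- The error of the L1 scheme for the scalar fractional evolution equation, in terms of kernels
with bounds independent of `l`. -/
theorem exists_error_representation (hα : α ∈ Ioo (0 : ℝ) 1) :
    ∃ C : ℝ, 0 < C ∧ ∀ l τ : ℝ, 0 ≤ l → 0 < τ → ∀ n : ℕ, 1 ≤ n →
      ∃ (e₁ e₂ : ℝ) (k : ℝ → ℝ), Measurable k ∧ |e₁| ≤ C * τ * (n * τ)⁻¹ ∧
        |e₂| ≤ C * τ * (n * τ) ^ (α - 1) ∧
        (∀ r ∈ Ioo 0 (n * τ), |k r| ≤ C * τ * (n * τ - r) ^ (α - 1)) ∧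
        ∀ (T : ℝ) (y g g' : ℝ → ℝ) (Y : ℕ → ℝ), n * τ ≤ T → ContinuousOn y (Icc 0 T) →
          IntervalIntegrable g' volume 0 T →
          (∀ t ∈ Icc 0 T, g t = g 0 + ∫ r in (0 : ℝ)..t, g' r) →
          (∀ t ∈ Ioc 0 T, HasRLDerivAt α T (fun ξ => y ξ - y 0) (g t - l * y t) t) →
          (∀ m : ℕ, 1 ≤ m → m ≤ n →
            ∑ j ∈ Finset.range m, dCoeff α τ j * (Y (m - j) - Y 0) + l * Y m = g (m * τ)) →
          y 0 = Y 0 →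
          y (n * τ) - Y n = e₁ * Y 0 + e₂ * g 0 + ∫ r in (0 : ℝ)..n * τ, k r * g' r := by
  obtain ⟨C, hC, hker⟩ := exists_kernel_error_le hα
  refine ⟨C, hC, fun l τ hl hτ n hn => ?_⟩
  obtain ⟨Φ, hΦ⟩ := exists_isFracStep hα.1 hl
  obtain ⟨hk1, hk2⟩ := hker l Φ hl hΦ τ hτ
  have hΦc := hΦ.continuous
  set G : ℕ → ℝ := fun j => coeff j (discreteResolvent (l1Kernel α) (l * τ ^ α)) with hG
  set E := Φ (n * τ) - τ ^ α * l1Step α (l * τ ^ α) n with hE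
  have hn' : (1 : ℝ) ≤ n := by exact_mod_cast hn
  have hnτ : 0 < n * τ := by positivity
  -- Inserting g(t_{n-j}) = g(0) + ∫ g' over (0, t_{n-j}) into the discrete Duhamel sum, the values
  -- of g' at r are weighted by those G_j with r ≤ t_{n-j}.
  set κ : ℝ → ℝ := fun r => τ ^ α *
    ∑ j ∈ Finset.range n, (Iic (((n - j : ℕ) : ℝ) * τ)).indicator (fun _ => G j) r with hκ
  refine ⟨-(l * E), E, fun r => Φ (n * τ - r) - κ r, ?_, ?_, ?_, ?_, ?_⟩
  · have : Measurable κ := (Finset.measurable_fun_sum _ fun j _ =>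
      measurable_const.indicator measurableSet_Iic).const_mul _
    exact (by fun_prop : Continuous fun r => Φ (n * τ - r)).measurable.sub this
  · rw [abs_neg, abs_mul, abs_of_nonneg hl]; exact hk1 n hn
  · have := hk2 (n - 1) (n * τ) hnτ (by
      rw [Nat.cast_sub hn]; push_cast
      exact ⟨by nlinarith, by rw [sub_add_cancel]⟩)
    rwa [Nat.sub_add_cancel hn] at this
  · intro r hr
    -- The condition r ≤ (n - j)τ holds exactly for j ≤ m, so κ(r) is the discrete step response
    -- after m + 1 steps, while n τ - r lies in [mτ, (m+1)τ].
    set m := ⌊(n * τ - r) / τ⌋₊ with hm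
    have hpos : 0 ≤ (n * τ - r) / τ := div_nonneg (by linarith [hr.2]) hτ.le
    have hfl := Nat.floor_le hpos
    have hfl2 := Nat.lt_floor_add_one ((n * τ - r) / τ)
    rw [← hm] at hfl hfl2
    rw [le_div_iff₀ hτ] at hfl
    rw [div_lt_iff₀ hτ] at hfl2
    have hmn : m + 1 ≤ n := by
      by_contra hcon
      have : (n : ℝ) ≤ m := by exact_mod_cast (by omega : n ≤ m)
      nlinarith [hr.1, mul_le_mul_of_nonneg_right this hτ.le]
    have hκr : κ r = τ ^ α * l1Step α (l * τ ^ α) (m + 1) := by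
      rw [hκ, l1Step]
      simp only
      congr 1
      rw [← Finset.sum_subset (Finset.range_mono hmn)]
      · refine Finset.sum_congr rfl fun j hj => ?_
        have hjm : j ≤ m := by simpa [Nat.lt_succ_iff] using hj
        refine indicator_of_mem ?_ _
        have : (j : ℝ) ≤ m := by exact_mod_cast hjm
        rw [mem_Iic, Nat.cast_sub (by omega)]
        nlinarith [mul_le_mul_of_nonneg_right this hτ.le]
      · intro j hj hj'
        have hjm : m + 1 ≤ j := by simpa using hj'
        have hjn : j < n := by simpa using hj
        refine indicator_of_notMem ?_ _
        have : ((m : ℝ) + 1) ≤ j := by exact_mod_cast hjm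
        rw [mem_Iic, Nat.cast_sub hjn.le, not_le]
        nlinarith [mul_le_mul_of_nonneg_right this hτ.le]
    simp only
    rw [hκr]
    exact hk2 m _ (by linarith [hr.2]) ⟨hfl, hfl2.le⟩
  · intro T y g g' Y hnT hy hg' hg heq hY h0
    have hT : 0 < T := by linarith
    have hmem : ∀ m : ℕ, m ≤ n → (m : ℝ) * τ ∈ Icc 0 T := fun m hm => by
      have : (m : ℝ) ≤ n := by exact_mod_cast hm
      exact ⟨by positivity, (mul_le_mul_of_nonneg_right this hτ.le).trans hnT⟩
    have hgi : ∀ t ∈ Icc 0 T, IntervalIntegrable g' volume 0 t := fun t ht =>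
      hg'.mono_set (by
        rw [uIcc_of_le ht.1, uIcc_of_le hT.le]; exact Icc_subset_Icc_right ht.2)
    have hd := hΦ.duhamel hα hl hT hy hg' hg heq _ (hmem n le_rfl)
    have hD := l1_duhamel hα hl hτ (g := fun m => g (m * τ)) hY
    have hgn := hgi _ (hmem n le_rfl)
    have hind : ∀ j, IntervalIntegrable (fun r => (Iic (((n - j : ℕ) : ℝ) * τ)).indicator
        (fun _ => G j) r * g' r) volume 0 (n * τ) := by
      intro j
      rw [intervalIntegrable_iff_integrableOn_Ioc_of_le hnτ.le] at hgn ⊢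
      have : (fun r => (Iic (((n - j : ℕ) : ℝ) * τ)).indicator (fun _ => G j) r * g' r) =
          (Iic (((n - j : ℕ) : ℝ) * τ)).indicator fun r => G j * g' r := by
        ext r; by_cases hr : r ∈ Iic (((n - j : ℕ) : ℝ) * τ) <;> simp [hr]
      rw [this]
      exact (Integrable.const_mul hgn (G j)).indicator measurableSet_Iic
    have hκint : ∫ r in (0 : ℝ)..n * τ, κ r * g' r =
        τ ^ α * ∑ j ∈ Finset.range n, G j * ∫ r in (0 : ℝ)..((n - j : ℕ) : ℝ) * τ, g' r := by
      simp only [hκ, mul_assoc, Finset.sum_mul]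
      rw [intervalIntegral.integral_const_mul, intervalIntegral.integral_finsetSum
        fun j _ => hind j]
      congr 1
      refine Finset.sum_congr rfl fun j _ => ?_
      have hle : ((n - j : ℕ) : ℝ) * τ ≤ n * τ :=
        mul_le_mul_of_nonneg_right (by exact_mod_cast Nat.sub_le n j) hτ.le
      have h0' : (0 : ℝ) ≤ ((n - j : ℕ) : ℝ) * τ := by positivity
      rw [← intervalIntegral.integral_const_mul, intervalIntegral.integral_of_le hnτ.le,
        intervalIntegral.integral_of_le h0']
      have e : (fun r => (Iic (((n - j : ℕ) : ℝ) * τ)).indicator (fun _ => G j) r * g' r) =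
          (Iic (((n - j : ℕ) : ℝ) * τ)).indicator fun r => G j * g' r := by
        ext r; by_cases hr : r ∈ Iic (((n - j : ℕ) : ℝ) * τ) <;> simp [hr]
      rw [e, integral_indicator measurableSet_Iic, Measure.restrict_restrict measurableSet_Iic]
      congr 2
      ext r
      simp only [mem_inter_iff, mem_Iic, mem_Ioc]
      constructor
      · rintro ⟨h1, h2, -⟩; exact ⟨h2, h1⟩
      · rintro ⟨h1, h2⟩; exact ⟨h2, h1, h2.trans hle⟩
    have hsum : ∑ j ∈ Finset.range n, G j * (g ((n - j : ℕ) * τ) - l * Y 0) =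
        l1Step α (l * τ ^ α) n * (g 0 - l * Y 0) +
          ∑ j ∈ Finset.range n, G j * ∫ r in (0 : ℝ)..((n - j : ℕ) : ℝ) * τ, g' r := by
      rw [l1Step, Finset.sum_mul, ← Finset.sum_add_distrib]
      refine Finset.sum_congr rfl fun j _ => ?_
      rw [hg _ (hmem (n - j) (Nat.sub_le n j))]
      ring
    have hκi : IntervalIntegrable (fun r => κ r * g' r) volume 0 (n * τ) := by
      have : (fun r => κ r * g' r) = fun r => τ ^ α * ∑ j ∈ Finset.range n,
          (Iic (((n - j : ℕ) : ℝ) * τ)).indicator (fun _ => G j) r * g' r := by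
        ext r; simp only [hκ, mul_assoc, Finset.sum_mul]
      rw [this]
      have := (IntervalIntegrable.sum (Finset.range n) fun j _ => hind j).const_mul (τ ^ α)
      simpa only [Finset.sum_apply] using this
    simp only [sub_mul]
    rw [intervalIntegral.integral_sub (hgn.continuousOn_mul (by fun_prop)) hκi, hκint, hd, hD,
      hsum, h0, hE]
    ring

end Representation

end TwoScaleFPE

/-! ### Piecewise affine functions and the bilinear forms. -/

namespace TwoScaleFPE

section Lipschitz

/-- Induction on the number of sets: from a, jump to the last point c of a set containing a. That
set is not met in (c, b], so the remaining closed sets cover (c, b] and, by closure, [c, b]. -/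
theorem abs_sub_le_of_finite_closed_cover {g : ℝ → ℝ} {L b : ℝ}
    (S : Finset (Set ℝ)) (hS : ∀ F ∈ S, IsClosed F)
    (hg : ∀ F ∈ S, ∀ x ∈ F, ∀ y ∈ F, |g x - g y| ≤ L * |x - y|) {a : ℝ} (hab : a ≤ b)
    (hcov : Icc a b ⊆ ⋃ F ∈ S, F) : |g b - g a| ≤ L * (b - a) := by
  classical
  induction hn : S.card generalizing S a with
  | zero =>
    rw [Finset.card_eq_zero] at hn
    subst hn
    simpa using hcov (left_mem_Icc.2 hab)
  | succ n ih =>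
    obtain ⟨F, hF, haF⟩ : ∃ F ∈ S, a ∈ F := by simpa using hcov (left_mem_Icc.2 hab)
    have hcomp : IsCompact (F ∩ Icc a b) := isCompact_Icc.inter_left (hS F hF)
    obtain ⟨c, ⟨hcF, hc⟩, hmax⟩ := hcomp.exists_isGreatest ⟨a, haF, left_mem_Icc.2 hab⟩
    have h1 := hg F hF c hcF a haF
    rw [abs_of_nonneg (sub_nonneg.2 hc.1)] at h1
    have h2 : |g b - g c| ≤ L * (b - c) := by
      rcases hc.2.eq_or_lt with rfl | hcb
      · simp
      refine ih (S.erase F) (fun G hG => hS G (Finset.mem_of_mem_erase hG))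
        (fun G hG => hg G (Finset.mem_of_mem_erase hG)) hc.2 ?_
        (by rw [Finset.card_erase_of_mem hF, hn]; rfl)
      have hcl : IsClosed (⋃ G ∈ S.erase F, G) :=
        (S.erase F).finite_toSet.isClosed_biUnion fun G hG =>
          hS G (Finset.mem_of_mem_erase hG)
      have hsub : Ioc c b ⊆ ⋃ G ∈ S.erase F, G := by
        intro x hx
        obtain ⟨G, hG, hxG⟩ : ∃ G ∈ S, x ∈ G := by
          simpa using hcov ⟨hc.1.trans hx.1.le, hx.2⟩
        have hGF : G ≠ F := by
          rintro rfl
          exact absurd (hmax ⟨hxG, hc.1.trans hx.1.le, hx.2⟩) (not_le.2 hx.1)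
        exact mem_biUnion (Finset.mem_erase.2 ⟨hGF, hG⟩) hxG
      rw [← closure_Ioc hcb.ne]
      exact closure_minimal hsub hcl
    calc |g b - g a| ≤ |g b - g c| + |g c - g a| := abs_sub_le _ _ _
      _ ≤ L * (b - c) + L * (c - a) := add_le_add h2 h1
      _ = L * (b - a) := by ring

/-- A function that is Lipschitz on every set of a finite closed cover of a normed space is
Lipschitz. -/
theorem lipschitzWith_of_finite_closed_cover {E : Type*} [NormedAddCommGroup E] [NormedSpace ℝ E]
    {v : E → ℝ} {L : NNReal} (S : Finset (Set E)) (hS : ∀ F ∈ S, IsClosed F)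
    (hv : ∀ F ∈ S, LipschitzOnWith L v F) (hcov : ∀ x, ∃ F ∈ S, x ∈ F) : LipschitzWith L v := by
  classical
  refine LipschitzWith.of_dist_le_mul fun y x => ?_
  set γ : ℝ → E := fun t => x + t • (y - x) with hγ
  have hγc : Continuous γ := by fun_prop
  have hd : ∀ s t, dist (γ s) (γ t) = |s - t| * dist y x := by
    intro s t
    rw [dist_eq_norm, dist_eq_norm, ← Real.norm_eq_abs, ← norm_smul]
    congr 1
    simp only [hγ]; module
  have := abs_sub_le_of_finite_closed_cover (g := v ∘ γ) (a := 0) (b := 1)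
    (L := L * dist y x) (S.image fun F => γ ⁻¹' F) (by
      intro F hF
      obtain ⟨F', hF', rfl⟩ := Finset.mem_image.1 hF
      exact (hS F' hF').preimage hγc) (by
      intro F hF s hs t ht
      obtain ⟨F', hF', rfl⟩ := Finset.mem_image.1 hF
      have := (hv F' hF').dist_le_mul _ hs _ ht
      rw [Real.dist_eq, hd] at this
      simp only [Function.comp]
      linarith) zero_le_one (by
      intro t _
      obtain ⟨F, hF, ht⟩ := hcov (γ t)
      exact mem_biUnion (Finset.mem_image_of_mem _ hF) ht)
  have e0 : γ 0 = x := by simp [hγ]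
  have e1 : γ 1 = y := by simp [hγ]
  rw [Function.comp, Function.comp, e0, e1, sub_zero, mul_one] at this
  exact this

end Lipschitz

section FiniteElement

variable {d : ℕ} {Ω : Set (Sp d)} {K : Geometry.SimplicialComplex ℝ (Sp d)}

/-- The closed cover consists of the simplices, where v is affine, and the closure of the complement
of the mesh, where v vanishes by continuity. The Lipschitz property gives integrability of both
forms and differentiability almost everywhere. -/
theorem femSpace_lipschitz (hK : K.faces.Finite) {v : Sp d → ℝ} (hv : v ∈ femSpace Ω K) :
    ∃ L, LipschitzWith L v := by
  classical
  obtain ⟨hvc, haff, hzero⟩ := hv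
  choose! a ha using haff
  set N : Finset (Sp d) → NNReal := fun σ => ‖LinearMap.toContinuousLinearMap (a σ).linear‖₊
  have hclosed : IsClosed K.space := by
    have : K.space = ⋃ σ ∈ K.faces, convexHull ℝ (σ : Set (Sp d)) := rfl
    rw [this]
    exact hK.isClosed_biUnion fun σ _ => (σ.finite_toSet.isCompact_convexHull (𝕜 := ℝ)).isClosed
  refine ⟨∑ σ ∈ hK.toFinset, N σ, lipschitzWith_of_finite_closed_cover
    (insert (closure K.spaceᶜ) (hK.toFinset.image
      fun σ : Finset (Sp d) => convexHull ℝ (σ : Set (Sp d))) : Finset (Set (Sp d)))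
    ?_ ?_ ?_⟩
  · intro F hF
    rcases Finset.mem_insert.1 hF with rfl | hF
    · exact isClosed_closure
    · obtain ⟨σ, -, rfl⟩ := Finset.mem_image.1 hF
      exact (σ.finite_toSet.isCompact_convexHull (𝕜 := ℝ)).isClosed
  · intro F hF
    rcases Finset.mem_insert.1 hF with rfl | hF
    · have h0 : ∀ x ∈ closure K.spaceᶜ, v x = 0 := by
        intro x hx
        have hc : IsClosed {x | v x = 0} := isClosed_eq hvc continuous_const
        exact closure_minimal (fun z (hz : z ∈ K.spaceᶜ) => hzero z fun h => hz h.2) hc hx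
      refine LipschitzOnWith.of_dist_le_mul fun x hx y hy => ?_
      rw [h0 x hx, h0 y hy, dist_self]
      positivity
    · obtain ⟨σ, hσ, rfl⟩ := Finset.mem_image.1 hF
      have hσ' := hK.mem_toFinset.1 hσ
      refine LipschitzOnWith.of_dist_le_mul fun x hx y hy => ?_
      rw [ha σ hσ' x hx, ha σ hσ' y hy, Real.dist_eq, dist_eq_norm]
      have e : a σ x - a σ y = LinearMap.toContinuousLinearMap (a σ).linear (x - y) := by
        have := (a σ).linearMap_vsub x y
        simpa using this.symm
      rw [e]
      refine (ContinuousLinearMap.le_opNorm (LinearMap.toContinuousLinearMap (a σ).linear)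
        (x - y)).trans ?_
      refine mul_le_mul_of_nonneg_right ?_ (norm_nonneg _)
      exact_mod_cast Finset.single_le_sum (f := N) (fun _ _ => zero_le) hσ
  · intro x
    by_cases hx : x ∈ K.space
    · obtain ⟨σ, hσ, hxσ⟩ : ∃ σ ∈ K.faces, x ∈ convexHull ℝ (σ : Set (Sp d)) := by
        simpa [Geometry.SimplicialComplex.space] using hx
      exact ⟨_, Finset.mem_insert_of_mem (Finset.mem_image_of_mem _ (hK.mem_toFinset.2 hσ)), hxσ⟩
    · exact ⟨_, Finset.mem_insert_self _ _, subset_closure hx⟩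

/-- Nodal values determine v: on a simplex v is affine, and if it vanishes at the vertices its zero
set contains their convex hull. -/
theorem finiteDimensional_femSpace (hK : K.faces.Finite) :
    FiniteDimensional ℝ (femSpace Ω K) := by
  set V : Set (Sp d) := ⋃ σ ∈ K.faces, (σ : Set (Sp d)) with hV
  have hVf : V.Finite := hK.biUnion fun σ _ => σ.finite_toSet
  have := hVf.to_subtype
  set ev : femSpace Ω K →ₗ[ℝ] (V → ℝ) :=
    { toFun := fun v x => (v : Sp d → ℝ) x
      map_add' := fun u v => rfl
      map_smul' := fun c v => rfl } with hev
  refine FiniteDimensional.of_injective ev ?_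
  rw [← LinearMap.ker_eq_bot, LinearMap.ker_eq_bot']
  intro v hv
  obtain ⟨hvc, haff, hzero⟩ := v.2
  ext x
  change (v : Sp d → ℝ) x = 0
  by_cases hx : x ∈ K.space
  · obtain ⟨σ, hσ, hxσ⟩ : ∃ σ ∈ K.faces, x ∈ convexHull ℝ (σ : Set (Sp d)) := by
      simpa [Geometry.SimplicialComplex.space] using hx
    obtain ⟨a, ha⟩ := haff σ hσ
    have hsub : convexHull ℝ (σ : Set (Sp d)) ⊆ a ⁻¹' {0} := by
      refine convexHull_min (fun z hz => ?_) ((convex_singleton 0).affine_preimage a)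
      have h1 := congrFun hv ⟨z, mem_biUnion hσ hz⟩
      change (v : Sp d → ℝ) z = 0 at h1
      rw [mem_preimage, mem_singleton_iff, ← ha z (subset_convexHull ℝ _ hz), h1]
    rw [ha x hxσ]
    exact hsub hxσ
  · exact hzero x fun h => hx h.2

/-- Lipschitz functions that vanish outside `Ω`. -/
structure IsLipschitzOutside (Ω : Set (Sp d)) (v : Sp d → ℝ) : Prop where
  lipschitz : ∃ L, LipschitzWith L v
  eq_zero : ∀ x ∉ Ω, v x = 0

theorem femSpace_isLipschitzOutside (hK : K.faces.Finite) (v : femSpace Ω K) :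
    IsLipschitzOutside Ω (v : Sp d → ℝ) :=
  ⟨femSpace_lipschitz hK v.2, fun x hx => v.2.2.2 x fun h => hx h.1⟩

namespace IsLipschitzOutside

variable {u u' v : Sp d → ℝ}

theorem continuous (hv : IsLipschitzOutside Ω v) : Continuous v :=
  hv.lipschitz.choose_spec.continuous

theorem hasCompactSupport (hv : IsLipschitzOutside Ω v) (hΩ : Bornology.IsBounded Ω) :
    HasCompactSupport v := by
  refine HasCompactSupport.of_support_subset_isCompact (K := closure Ω)
    (Metric.isCompact_of_isClosed_isBounded isClosed_closure hΩ.closure) fun x hx => ?_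
  by_contra hcon
  exact hx (hv.eq_zero x fun h => hcon (subset_closure h))

theorem memLp (hv : IsLipschitzOutside Ω v) (hΩ : Bornology.IsBounded Ω) :
    MemLp v 2 (volume.restrict Ω) :=
  (hv.continuous.memLp_of_hasCompactSupport (hv.hasCompactSupport hΩ)).restrict Ω

theorem measurable_gradient : Measurable (gradient v) :=
  (LinearIsometryEquiv.continuous _).measurable.comp (measurable_fderiv ℝ v)

theorem integrable_inner_gradient (hu : IsLipschitzOutside Ω u) (hv : IsLipschitzOutside Ω v)
    (hΩ : Bornology.IsBounded Ω) :
    IntegrableOn (fun x => inner ℝ (gradient u x) (gradient v x)) Ω := by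
  obtain ⟨L, hL⟩ := hu.lipschitz
  obtain ⟨L', hL'⟩ := hv.lipschitz
  have hb : ∀ {w : Sp d → ℝ} {M : NNReal}, LipschitzWith M w → ∀ x, ‖gradient w x‖ ≤ M := by
    intro w M hw x
    rw [gradient, LinearIsometryEquiv.norm_map]
    exact norm_fderiv_le_of_lipschitz ℝ hw
  refine Integrable.mono' (g := fun _ => (L : ℝ) * L') ?_ ?_ ?_
  · have : IsFiniteMeasure (volume.restrict Ω) := ⟨by
      rw [Measure.restrict_apply_univ]; exact hΩ.measure_lt_top⟩
    exact integrable_const _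
  · exact (measurable_gradient.inner measurable_gradient).aestronglyMeasurable
  · filter_upwards with x
    exact (norm_inner_le_norm _ _).trans (mul_le_mul (hb hL x) (hb hL' x) (norm_nonneg _) L.2)

theorem ae_differentiableAt (hv : IsLipschitzOutside Ω v) :
    ∀ᵐ x ∂(volume.restrict Ω), DifferentiableAt ℝ v x :=
  ae_restrict_of_ae hv.lipschitz.choose_spec.ae_differentiableAt

/-- The gradient is additive at points where both functions are differentiable, which is almost
every point by Rademacher's theorem. -/
theorem gradForm_add_left (hu : IsLipschitzOutside Ω u) (hu' : IsLipschitzOutside Ω u')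
    (hv : IsLipschitzOutside Ω v) (hΩ : Bornology.IsBounded Ω) :
    gradForm Ω (u + u') v = gradForm Ω u v + gradForm Ω u' v := by
  unfold gradForm
  rw [← integral_add (hu.integrable_inner_gradient hv hΩ) (hu'.integrable_inner_gradient hv hΩ)]
  refine integral_congr_ae ?_
  filter_upwards [hu.ae_differentiableAt, hu'.ae_differentiableAt] with x h1 h2
  rw [gradient, fderiv_add h1 h2, map_add, inner_add_left]
  rfl

theorem gradForm_smul_left (hu : IsLipschitzOutside Ω u) (c : ℝ) :
    gradForm Ω (c • u) v = c * gradForm Ω u v := by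
  unfold gradForm
  rw [← integral_const_mul]
  refine integral_congr_ae ?_
  filter_upwards [hu.ae_differentiableAt] with x h1
  rw [gradient, fderiv_const_smul h1, map_smulₛₗ, inner_smul_left]
  rfl

/-- The radial majorant of the kernel of the fractional form. -/
theorem integrable_radial {s : ℝ} (hd : 1 ≤ d) (hs : s ∈ Ioo (0 : ℝ) 1) :
    Integrable fun z : Sp d => (min ‖z‖ 1) ^ 2 * ‖z‖ ^ (-((d : ℝ) + 2 * s)) := by
  have : Nonempty (Fin d) := ⟨⟨0, hd⟩⟩
  have : Nontrivial (Sp d) := inferInstance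
  refine (integrable_fun_norm_addHaar volume
    (f := fun r : ℝ => (min r 1) ^ 2 * r ^ (-((d : ℝ) + 2 * s)))).2 ?_
  rw [finrank_euclideanSpace_fin, ← Ioc_union_Ioi_eq_Ioi (zero_le_one (α := ℝ))]
  -- In polar coordinates the integrand is r^(1-2s) near 0 and r^(-1-2s) at infinity; the two ends
  -- need s < 1 and s > 0.
  have hpow : ∀ y : ℝ, 0 < y → y ^ (d - 1) * y ^ (-((d : ℝ) + 2 * s)) = y ^ (-1 - 2 * s) := by
    intro y hy
    rw [← Real.rpow_natCast, ← Real.rpow_add hy, Nat.cast_sub hd]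
    congr 1; push_cast; ring
  refine IntegrableOn.union ?_ ?_
  · have h1 := (intervalIntegral.intervalIntegrable_rpow' (a := 0) (b := 1) (r := 1 - 2 * s)
      (by linarith [hs.2]))
    rw [intervalIntegrable_iff_integrableOn_Ioc_of_le zero_le_one] at h1
    refine h1.congr_fun (fun y hy => ?_) measurableSet_Ioc
    simp only [smul_eq_mul]
    rw [min_eq_left hy.2, mul_left_comm, hpow y hy.1, ← Real.rpow_natCast, ← Real.rpow_add hy.1]
    congr 1; push_cast; ring
  · have h1 := integrableOn_Ioi_rpow_of_lt (a := -1 - 2 * s) (by linarith [hs.1]) zero_lt_one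
    refine h1.congr_fun (fun y hy => ?_) measurableSet_Ioi
    have hy1 : (1 : ℝ) < y := hy
    simp only [smul_eq_mul]
    rw [min_eq_right hy1.le, one_pow, one_mul, hpow y (by linarith)]

theorem exists_abs_sub_le (hv : IsLipschitzOutside Ω v) (hΩ : Bornology.IsBounded Ω) :
    ∃ C : ℝ, 0 ≤ C ∧ ∀ x y, |v x - v y| ≤ C * min ‖x - y‖ 1 := by
  obtain ⟨L, hL⟩ := hv.lipschitz
  obtain ⟨M, hM⟩ := (hv.hasCompactSupport hΩ).exists_bound_of_continuous hv.continuous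
  have hM0 : 0 ≤ M := (norm_nonneg _).trans (hM 0)
  refine ⟨max L (2 * M), le_max_of_le_left L.2, fun x y => ?_⟩
  have hm : 0 ≤ max (L : ℝ) (2 * M) := le_max_of_le_left L.2
  rw [mul_min_of_nonneg _ _ hm, mul_one]
  refine le_min ?_ ?_
  · have := hL.dist_le_mul x y
    rw [Real.dist_eq, dist_eq_norm] at this
    exact this.trans (mul_le_mul_of_nonneg_right (le_max_left _ _) (norm_nonneg _))
  · refine le_trans ?_ (le_max_right _ _)
    have h1 := hM x
    have h2 := hM y
    rw [Real.norm_eq_abs] at h1 h2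
    exact (abs_sub _ _).trans (by linarith)

/-- The integrand vanishes unless x or y lies in Ω, and each difference is O(min(|x - y|, 1)). It is
therefore dominated by (1_Ω(x) + 1_Ω(y)) times an integrable function of x - y. -/
theorem integrable_fracForm {s : ℝ} (hu : IsLipschitzOutside Ω u) (hv : IsLipschitzOutside Ω v)
    (hd : 1 ≤ d) (hs : s ∈ Ioo (0 : ℝ) 1) (hΩo : IsOpen Ω) (hΩ : Bornology.IsBounded Ω) :
    Integrable fun p : Sp d × Sp d =>
      (u p.1 - u p.2) * (v p.1 - v p.2) / ‖p.1 - p.2‖ ^ ((d : ℝ) + 2 * s) := by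
  obtain ⟨A, hA, hAu⟩ := hu.exists_abs_sub_le hΩ
  obtain ⟨B, hB, hBv⟩ := hv.exists_abs_sub_le hΩ
  set ψ : Sp d → ℝ := fun z => (min ‖z‖ 1) ^ 2 * ‖z‖ ^ (-((d : ℝ) + 2 * s)) with hψ
  have hψi : Integrable ψ := integrable_radial hd hs
  have hψ0 : ∀ z, 0 ≤ ψ z := fun z => by positivity
  have h1i : Integrable (Ω.indicator fun _ => (1 : ℝ)) :=
    (integrable_indicator_iff hΩo.measurableSet).2
      (integrableOn_const (hs := hΩ.measure_lt_top.ne))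
  have hI : Integrable fun p : Sp d × Sp d => Ω.indicator (fun _ => (1 : ℝ)) p.2 * ψ (p.1 - p.2) :=
    Integrable.convolution_integrand (ContinuousLinearMap.mul ℝ ℝ) h1i hψi
  have hI' : Integrable fun p : Sp d × Sp d =>
      Ω.indicator (fun _ => (1 : ℝ)) p.1 * ψ (p.1 - p.2) := by
    refine hI.swap.congr (Filter.Eventually.of_forall fun p => ?_)
    simp only [Function.comp, Prod.fst_swap, Prod.snd_swap, hψ]
    rw [norm_sub_rev p.2 p.1]
  refine Integrable.mono' ((hI.add hI').const_mul (A * B)) ?_ ?_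
  · have := hu.continuous
    have := hv.continuous
    exact ((by fun_prop : Measurable fun p : Sp d × Sp d => (u p.1 - u p.2) * (v p.1 - v p.2)).div
      (by fun_prop)).aestronglyMeasurable
  · refine Filter.Eventually.of_forall fun p => ?_
    have hn : 0 ≤ ‖p.1 - p.2‖ ^ (-((d : ℝ) + 2 * s)) := by positivity
    by_cases hp : p.1 ∈ Ω ∨ p.2 ∈ Ω
    · have hone : 1 ≤ Ω.indicator (fun _ => (1 : ℝ)) p.2 + Ω.indicator (fun _ => (1 : ℝ)) p.1 := by
        have n1 : ∀ x, 0 ≤ Ω.indicator (fun _ => (1 : ℝ)) x := fun x =>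
          indicator_nonneg (fun _ _ => zero_le_one) x
        rcases hp with hp | hp
        · have := n1 p.2
          rw [indicator_of_mem hp]; linarith
        · have := n1 p.1
          rw [indicator_of_mem hp]; linarith
      rw [div_eq_mul_inv, ← Real.rpow_neg (norm_nonneg _), norm_mul, norm_mul,
        Real.norm_of_nonneg hn, Real.norm_eq_abs, Real.norm_eq_abs]
      have hmin : 0 ≤ min ‖p.1 - p.2‖ 1 := le_min (norm_nonneg _) zero_le_one
      calc |u p.1 - u p.2| * |v p.1 - v p.2| * ‖p.1 - p.2‖ ^ (-((d : ℝ) + 2 * s))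
          ≤ (A * min ‖p.1 - p.2‖ 1) * (B * min ‖p.1 - p.2‖ 1) *
            ‖p.1 - p.2‖ ^ (-((d : ℝ) + 2 * s)) := by
            gcongr
            · exact hAu _ _
            · exact hBv _ _
        _ = A * B * (1 * ψ (p.1 - p.2)) := by rw [hψ]; ring
        _ ≤ A * B * ((Ω.indicator (fun _ => (1 : ℝ)) p.2 +
            Ω.indicator (fun _ => (1 : ℝ)) p.1) * ψ (p.1 - p.2)) := by
            have := hψ0 (p.1 - p.2)
            gcongr
        _ = _ := by simp only [Pi.add_apply]; ring
    · rw [not_or] at hp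
      rw [hu.eq_zero _ hp.1, hu.eq_zero _ hp.2]
      simp only [sub_self, zero_mul, zero_div, norm_zero, Pi.add_apply, indicator_of_notMem hp.1,
        indicator_of_notMem hp.2, add_zero, mul_zero, le_refl]

theorem fracForm_add_left {s : ℝ} (hu : IsLipschitzOutside Ω u) (hu' : IsLipschitzOutside Ω u')
    (hv : IsLipschitzOutside Ω v) (hd : 1 ≤ d) (hs : s ∈ Ioo (0 : ℝ) 1) (hΩo : IsOpen Ω)
    (hΩ : Bornology.IsBounded Ω) :
    fracForm Ω s (u + u') v = fracForm Ω s u v + fracForm Ω s u' v := by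
  unfold fracForm
  rw [← mul_add, ← integral_add (hu.integrable_fracForm hv hd hs hΩo hΩ).integrableOn
    (hu'.integrable_fracForm hv hd hs hΩo hΩ).integrableOn]
  refine congrArg (cConst d s / 2 * ·) (integral_congr_ae (Filter.Eventually.of_forall fun p => ?_))
  simp only [Pi.add_apply]
  ring

end IsLipschitzOutside

theorem fracForm_smul_left (s c : ℝ) (u v : Sp d → ℝ) :
    fracForm Ω s (c • u) v = c * fracForm Ω s u v := by
  unfold fracForm
  rw [mul_left_comm, ← integral_const_mul c]
  refine congrArg (cConst d s / 2 * ·) (integral_congr_ae (Filter.Eventually.of_forall fun p => ?_))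
  simp only [Pi.smul_apply, smul_eq_mul]
  ring

theorem fracForm_comm (s : ℝ) (u v : Sp d → ℝ) : fracForm Ω s u v = fracForm Ω s v u := by
  unfold fracForm
  simp only [mul_comm]

theorem fracForm_self_nonneg {s : ℝ} (hs : s ∈ Ioo (0 : ℝ) 1) (u : Sp d → ℝ) :
    0 ≤ fracForm Ω s u u := by
  have hc : 0 ≤ cConst d s := by
    have := hs.1
    have h1 := Real.Gamma_pos_of_pos (show 0 < (d : ℝ) / 2 + s by positivity)
    have h2 := Real.Gamma_pos_of_pos (show 0 < 1 - s by linarith [hs.2])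
    unfold cConst
    positivity
  exact mul_nonneg (by positivity) (integral_nonneg fun p =>
    div_nonneg (mul_self_nonneg _) (by positivity))

theorem gradForm_comm (u v : Sp d → ℝ) : gradForm Ω u v = gradForm Ω v u := by
  unfold gradForm
  simp only [real_inner_comm]

theorem gradForm_self_nonneg (u : Sp d → ℝ) : 0 ≤ gradForm Ω u u :=
  integral_nonneg fun _ => real_inner_self_nonneg

/-- The energy form of the problem as a bilinear form on the finite element space. -/
noncomputable def energyForm (hd : 1 ≤ d) {s : ℝ} (hs : s ∈ Ioo (0 : ℝ) 1) (hΩo : IsOpen Ω)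
    (hΩ : Bornology.IsBounded Ω) (hK : K.faces.Finite) :
    femSpace Ω K →ₗ[ℝ] femSpace Ω K →ₗ[ℝ] ℝ :=
  have hL := femSpace_isLipschitzOutside (Ω := Ω) hK
  have hadd : ∀ u u' v : femSpace Ω K,
      gradForm Ω (u + u' : femSpace Ω K) v + fracForm Ω s (u + u' : femSpace Ω K) v =
      (gradForm Ω u v + fracForm Ω s u v) + (gradForm Ω u' v + fracForm Ω s u' v) := by
    intro u u' v
    rw [Submodule.coe_add, (hL u).gradForm_add_left (hL u') (hL v) hΩ,
      (hL u).fracForm_add_left (hL u') (hL v) hd hs hΩo hΩ]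
    ring
  have hsmul : ∀ (c : ℝ) (u v : femSpace Ω K),
      gradForm Ω (c • u : femSpace Ω K) v + fracForm Ω s (c • u : femSpace Ω K) v =
      c • (gradForm Ω u v + fracForm Ω s u v) := by
    intro c u v
    rw [Submodule.coe_smul, (hL u).gradForm_smul_left c, fracForm_smul_left, smul_eq_mul]
    ring
  LinearMap.mk₂ ℝ (fun u v => gradForm Ω u v + fracForm Ω s u v) hadd hsmul
    (fun u v v' => by
      simp only [gradForm_comm (u : Sp d → ℝ), fracForm_comm s (u : Sp d → ℝ)]
      exact hadd v v' u)
    (fun c u v => by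
      simp only [gradForm_comm (u : Sp d → ℝ), fracForm_comm s (u : Sp d → ℝ)]
      exact hsmul c v u)

/-- The inclusion of the finite element space into `L²(Ω)`. -/
noncomputable def femToL2 (hΩ : Bornology.IsBounded Ω) (hK : K.faces.Finite) :
    femSpace Ω K →ₗ[ℝ] L2 Ω where
  toFun v := ((femSpace_isLipschitzOutside hK v).memLp hΩ).toLp v
  map_add' _ _ := rfl
  map_smul' _ _ := rfl

theorem coeFn_femToL2 (hΩ : Bornology.IsBounded Ω) (hK : K.faces.Finite) (v : femSpace Ω K) :
    femToL2 hΩ hK v =ᵐ[volume.restrict Ω] (v : Sp d → ℝ) :=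
  ((femSpace_isLipschitzOutside hK v).memLp hΩ).coeFn_toLp

theorem l2Inner_L2 (hΩ : Bornology.IsBounded Ω) (hK : K.faces.Finite) (g : L2 Ω)
    (v : femSpace Ω K) : l2Inner Ω g v = inner ℝ g (femToL2 hΩ hK v) := by
  rw [L2.inner_def, l2Inner]
  refine integral_congr_ae ?_
  filter_upwards [coeFn_femToL2 hΩ hK v] with x hx
  rw [hx]
  simp [mul_comm]

theorem l2Inner_eq_inner (hΩ : Bornology.IsBounded Ω) (hK : K.faces.Finite)
    (u v : femSpace Ω K) :
    l2Inner Ω u v = inner ℝ (femToL2 hΩ hK u) (femToL2 hΩ hK v) := by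
  rw [← l2Inner_L2]
  unfold l2Inner
  refine integral_congr_ae ?_
  filter_upwards [coeFn_femToL2 hΩ hK u] with x hx
  rw [hx]

theorem l2Norm_eq (hΩ : Bornology.IsBounded Ω) (hK : K.faces.Finite) (v : femSpace Ω K) :
    l2Norm Ω v = ‖femToL2 hΩ hK v‖ₑ := by
  rw [l2Norm, Lp.enorm_def]
  exact (eLpNorm_congr_ae (coeFn_femToL2 hΩ hK v)).symm

/-- A continuous function that vanishes almost everywhere on the open set Ω vanishes there, and
outside Ω it is zero by definition. -/
theorem femToL2_injective (hΩo : IsOpen Ω) (hΩ : Bornology.IsBounded Ω) (hK : K.faces.Finite) :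
    Function.Injective (femToL2 (Ω := Ω) (K := K) hΩ hK) := by
  rw [← LinearMap.ker_eq_bot, LinearMap.ker_eq_bot']
  intro v hv
  have h1 : (v : Sp d → ℝ) =ᵐ[volume.restrict Ω] fun _ => (0 : ℝ) := by
    refine (coeFn_femToL2 hΩ hK v).symm.trans ?_
    rw [hv]
    exact Lp.coeFn_zero _ _ _
  have h2 := Measure.eqOn_open_of_ae_eq h1 hΩo v.2.1.continuousOn continuousOn_const
  ext x
  by_cases hx : x ∈ Ω
  · exact h2 hx
  · exact v.2.2.2 x fun h => hx h.1

end FiniteElement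

end TwoScaleFPE

/-! ### Diagonalisation and transfer of scalar bounds to the Hilbert space. -/

namespace TwoScaleFPE

section Diagonalisation

/-- A symmetric bilinear form on a Euclidean space is diagonal in some orthonormal basis. -/
theorem exists_orthonormalBasis_diagonal {E : Type*} [NormedAddCommGroup E] [InnerProductSpace ℝ E]
    [FiniteDimensional ℝ E] (a : E →ₗ[ℝ] E →ₗ[ℝ] ℝ) (ha : ∀ u v, a u v = a v u) :
    ∃ (e : OrthonormalBasis (Fin (Module.finrank ℝ E)) ℝ E) (l : Fin (Module.finrank ℝ E) → ℝ),
      ∀ k v, a (e k) v = l k * inner ℝ (e k) v := by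
  have : CompleteSpace E := FiniteDimensional.complete ℝ E
  set A : E →ₗ[ℝ] E :=
    { toFun := fun u => (InnerProductSpace.toDual ℝ E).symm (LinearMap.toContinuousLinearMap (a u))
      map_add' := fun u v => by simp
      map_smul' := fun c v => by simp } with hA
  have hAi : ∀ u v, inner ℝ (A u) v = a u v := fun u v => by
    simp only [hA, LinearMap.coe_mk, AddHom.coe_mk, InnerProductSpace.toDual_symm_apply,
      LinearMap.coe_toContinuousLinearMap']
  have hsymm : A.IsSymmetric := fun u v => by
    rw [hAi, real_inner_comm, hAi, ha]
  refine ⟨hsymm.eigenvectorBasis rfl, hsymm.eigenvalues rfl, fun k v => ?_⟩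
  rw [← hAi, hsymm.apply_eigenvectorBasis, inner_smul_left]
  simp

/-- Simultaneous diagonalisation of a positive semidefinite symmetric bilinear form and the inner
product induced by an injective linear map into a Hilbert space. -/
theorem exists_diagonal_family {V H : Type*} [AddCommGroup V] [Module ℝ V] [FiniteDimensional ℝ V]
    [NormedAddCommGroup H] [InnerProductSpace ℝ H] (ι : V →ₗ[ℝ] H) (hι : Function.Injective ι)
    (a : V →ₗ[ℝ] V →ₗ[ℝ] ℝ) (ha : ∀ u v, a u v = a v u) (ha0 : ∀ v, 0 ≤ a v v) :
    ∃ (N : ℕ) (φ : Fin N → V) (l : Fin N → ℝ), Orthonormal ℝ (fun k => ι (φ k)) ∧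
      (∀ k, 0 ≤ l k) ∧ (∀ k v, a (φ k) v = l k * inner ℝ (ι (φ k)) (ι v)) ∧
      ∀ v, ι v = ∑ k, inner ℝ (ι (φ k)) (ι v) • ι (φ k) := by
  set j := LinearEquiv.ofInjective ι hι with hj
  have hjs : ∀ x : ι.range, ι (j.symm x) = x := fun x => by
    have := LinearEquiv.ofInjective_apply ι (h := hι) (j.symm x)
    rw [← this, ← hj, j.apply_symm_apply]
  obtain ⟨e, l, h⟩ := exists_orthonormalBasis_diagonal
    (a.compl₁₂ j.symm.toLinearMap j.symm.toLinearMap) (fun u v => ha _ _)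
  have hin : ∀ k v, a (j.symm (e k)) v = l k * inner ℝ (ι (j.symm (e k))) (ι v) := by
    intro k v
    have h1 := h k (j v)
    rw [LinearMap.compl₁₂_apply] at h1
    simp only [LinearEquiv.coe_coe, j.symm_apply_apply] at h1
    rw [h1, hjs]
    rfl
  refine ⟨_, fun k => j.symm (e k), l, ?_, fun k => ?_, hin, fun v => ?_⟩
  · simp only [hjs]
    exact e.orthonormal.comp_linearIsometry ι.range.subtypeₗᵢ
  · have h1 := ha0 (j.symm (e k))
    rw [hin, hjs, real_inner_self_eq_norm_sq] at h1
    have h2 : ‖((e k : ι.range) : H)‖ = 1 := e.orthonormal.1 k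
    rw [h2] at h1
    simpa using h1
  · have h1 := congrArg (fun x : ι.range => (x : H)) (e.sum_repr' (j v))
    have hjv : ((j v : ι.range) : H) = ι v := rfl
    simp only [hjs]
    simpa [hjv] using h1.symm

/-- A diagonal operator with entries bounded by `A` has norm at most `A`. -/
theorem abs_sum_mul_inner_mul_inner_le {H ι : Type*} [NormedAddCommGroup H] [InnerProductSpace ℝ H]
    [Fintype ι] {e : ι → H} (he : Orthonormal ℝ e) {c : ι → ℝ} {A : ℝ} (hA : 0 ≤ A)
    (hc : ∀ k, |c k| ≤ A) (x y : H) :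
    |∑ k, c k * inner ℝ (e k) x * inner ℝ (e k) y| ≤ A * ‖x‖ * ‖y‖ := by
  have hb : ∀ z : H, √(∑ k, |inner ℝ (e k) z| ^ 2) ≤ ‖z‖ := fun z => by
    refine Real.sqrt_le_iff.2 ⟨norm_nonneg _, ?_⟩
    simpa using he.sum_inner_products_le z (s := Finset.univ)
  calc |∑ k, c k * inner ℝ (e k) x * inner ℝ (e k) y|
      ≤ ∑ k, |c k * inner ℝ (e k) x * inner ℝ (e k) y| := Finset.abs_sum_le_sum_abs _ _
    _ ≤ ∑ k, A * (|inner ℝ (e k) x| * |inner ℝ (e k) y|) := by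
        refine Finset.sum_le_sum fun k _ => ?_
        rw [abs_mul, abs_mul, mul_assoc]
        exact mul_le_mul_of_nonneg_right (hc k) (by positivity)
    _ = A * ∑ k, |inner ℝ (e k) x| * |inner ℝ (e k) y| := by rw [Finset.mul_sum]
    _ ≤ A * (√(∑ k, |inner ℝ (e k) x| ^ 2) * √(∑ k, |inner ℝ (e k) y| ^ 2)) :=
        mul_le_mul_of_nonneg_left (Real.sum_mul_le_sqrt_mul_sqrt _ _ _) hA
    _ ≤ A * (‖x‖ * ‖y‖) := by
        gcongr
        · exact hb x
        · exact hb y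
    _ = A * ‖x‖ * ‖y‖ := by ring

/-- Norm estimate for a vector whose coordinates are given by an integral representation with
uniformly bounded multipliers and kernels. -/
theorem norm_le_of_forall_inner_eq {H ι : Type*} [NormedAddCommGroup H] [InnerProductSpace ℝ H]
    [Fintype ι] {e : ι → H} (he : Orthonormal ℝ e) {x u v : H} {f : ℝ → H}
    {c₁ c₂ : ι → ℝ} {κ : ι → ℝ → ℝ} {A B b : ℝ} {w : ℝ → ℝ} (hA : 0 ≤ A) (hB : 0 ≤ B)
    (hb : 0 ≤ b) (hx : x = ∑ k, inner ℝ (e k) x • e k) (hc₁ : ∀ k, |c₁ k| ≤ A)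
    (hc₂ : ∀ k, |c₂ k| ≤ B) (hκm : ∀ k, Measurable (κ k)) (hw : ∀ r ∈ Ioo 0 b, 0 ≤ w r)
    (hκ : ∀ k, ∀ r ∈ Ioo 0 b, |κ k r| ≤ w r)
    (hf : AEStronglyMeasurable f (volume.restrict (Ioo 0 b)))
    (hi : IntegrableOn (fun r => w r * ‖f r‖) (Ioo 0 b))
    (h : ∀ k, inner ℝ (e k) x = c₁ k * inner ℝ (e k) u + c₂ k * inner ℝ (e k) v +
      ∫ r in (0 : ℝ)..b, κ k r * inner ℝ (e k) (f r)) :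
    ‖x‖ ≤ A * ‖u‖ + B * ‖v‖ + ∫ r in Ioo 0 b, w r * ‖f r‖ := by
  have hae : ∀ᵐ r ∂(volume.restrict (Ioo 0 b)), r ∈ Ioo 0 b := ae_restrict_mem measurableSet_Ioo
  have hki : ∀ k, IntegrableOn (fun r => κ k r * inner ℝ (e k) (f r)) (Ioo 0 b) := by
    intro k
    refine hi.mono' ((hκm k).aestronglyMeasurable.mul (hf.const_inner)) ?_
    filter_upwards [hae] with r hr
    rw [norm_mul, Real.norm_eq_abs]
    refine mul_le_mul (hκ k r hr) ?_ (norm_nonneg _) (hw r hr)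
    simpa [he.1 k] using norm_inner_le_norm (𝕜 := ℝ) (e k) (f r)
  have hint : ∀ k, ∫ r in (0 : ℝ)..b, κ k r * inner ℝ (e k) (f r) =
      ∫ r in Ioo 0 b, κ k r * inner ℝ (e k) (f r) := fun k => by
    rw [intervalIntegral.integral_of_le hb, integral_Ioc_eq_integral_Ioo]
  -- The sum over modes is taken inside the integral and bounded for each r separately; otherwise
  -- the constant would depend on the number of modes.
  have h3 : |∑ k, (∫ r in Ioo 0 b, κ k r * inner ℝ (e k) (f r)) * inner ℝ (e k) x| ≤
      (∫ r in Ioo 0 b, w r * ‖f r‖) * ‖x‖ := by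
    simp only [← integral_mul_const]
    rw [← integral_finsetSum _ fun k _ => (hki k).mul_const _, ← Real.norm_eq_abs]
    refine norm_integral_le_of_norm_le (hi.mul_const _) ?_
    filter_upwards [hae] with r hr
    exact abs_sum_mul_inner_mul_inner_le he (hw r hr) (fun k => hκ k r hr) _ _
  -- The identity for the coordinates of x is tested with x itself, and one factor ‖x‖ is cancelled
  -- at the end.
  have hsq : ‖x‖ * ‖x‖ = ∑ k, inner ℝ (e k) x * inner ℝ (e k) x := by
    rw [← real_inner_self_eq_norm_mul_norm]
    nth_rewrite 1 [hx]
    rw [sum_inner]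
    exact Finset.sum_congr rfl fun k _ => by rw [inner_smul_left]; rfl
  have hsplit : ‖x‖ * ‖x‖ = (∑ k, c₁ k * inner ℝ (e k) u * inner ℝ (e k) x) +
      (∑ k, c₂ k * inner ℝ (e k) v * inner ℝ (e k) x) +
      ∑ k, (∫ r in Ioo 0 b, κ k r * inner ℝ (e k) (f r)) * inner ℝ (e k) x := by
    rw [hsq, ← Finset.sum_add_distrib, ← Finset.sum_add_distrib]
    refine Finset.sum_congr rfl fun k _ => ?_
    rw [← add_mul, ← add_mul, ← hint, ← h]
  rcases (norm_nonneg x).eq_or_lt with h0 | h0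
  · rw [← h0]
    have : 0 ≤ ∫ r in Ioo 0 b, w r * ‖f r‖ :=
      setIntegral_nonneg measurableSet_Ioo fun r hr => mul_nonneg (hw r hr) (norm_nonneg _)
    positivity
  · refine le_of_mul_le_mul_right ?_ h0
    rw [hsplit, add_mul, add_mul]
    exact add_le_add (add_le_add
      ((le_abs_self _).trans (abs_sum_mul_inner_mul_inner_le he hA hc₁ _ _))
      ((le_abs_self _).trans (abs_sum_mul_inner_mul_inner_le he hB hc₂ _ _)))
      ((le_abs_self _).trans h3)

end Diagonalisation

end TwoScaleFPE

/-! ### Assembly of the error estimate. -/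

namespace TwoScaleFPE

variable {d : ℕ} {Ω : Set (Sp d)} {K : Geometry.SimplicialComplex ℝ (Sp d)}

theorem IsL2Projection.inner_femToL2 (hΩ : Bornology.IsBounded Ω) (hK : K.faces.Finite)
    {p : femSpace Ω K} {g : L2 Ω} (hp : IsL2Projection p g) (v : femSpace Ω K) :
    inner ℝ (femToL2 hΩ hK v) (femToL2 hΩ hK p) = inner ℝ (femToL2 hΩ hK v) g := by
  rw [real_inner_comm, ← l2Inner_eq_inner, hp v, l2Inner_L2, real_inner_comm]

/-- The error estimate under the assumption that the data term is finite. -/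
theorem norm_femToL2_sub_le {s α T C τ : ℝ} (hd : 1 ≤ d) (hs : s ∈ Ioo (0 : ℝ) 1) (hΩo : IsOpen Ω)
    (hΩ : Bornology.IsBounded Ω) (hK : K.faces.Finite) (hT : 0 < T) (hC : 0 < C) (hτ : 0 < τ)
    {n : ℕ} (hn : 1 ≤ n) (hnT : n * τ ≤ T)
    (hrep : ∀ l : ℝ, 0 ≤ l →
      ∃ (e₁ e₂ : ℝ) (k : ℝ → ℝ), Measurable k ∧ |e₁| ≤ C * τ * (n * τ)⁻¹ ∧
      |e₂| ≤ C * τ * (n * τ) ^ (α - 1) ∧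
      (∀ r ∈ Ioo 0 (n * τ), |k r| ≤ C * τ * (n * τ - r) ^ (α - 1)) ∧
      ∀ (T : ℝ) (y g g' : ℝ → ℝ) (Y : ℕ → ℝ), n * τ ≤ T → ContinuousOn y (Icc 0 T) →
        IntervalIntegrable g' volume 0 T →
        (∀ t ∈ Icc 0 T, g t = g 0 + ∫ r in (0 : ℝ)..t, g' r) →
        (∀ t ∈ Ioc 0 T, HasRLDerivAt α T (fun ξ => y ξ - y 0) (g t - l * y t) t) →
        (∀ m : ℕ, 1 ≤ m → m ≤ n →
          ∑ j ∈ Finset.range m, dCoeff α τ j * (Y (m - j) - Y 0) + l * Y m = g (m * τ)) →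
        y 0 = Y 0 →
        y (n * τ) - Y n = e₁ * Y 0 + e₂ * g 0 + ∫ r in (0 : ℝ)..n * τ, k r * g' r)
    {u₀ : L2 Ω} {f f' : ℝ → L2 Ω} (hf' : IntervalIntegrable f' volume 0 T)
    (hf : ∀ t ∈ Icc 0 T, f t = f 0 + ∫ r in (0 : ℝ)..t, f' r)
    {uh : ℝ → femSpace Ω K} {fh0 : femSpace Ω K} (huh : IsSemidiscreteSolution s α T u₀ f uh)
    (hfh0 : IsL2Projection fh0 (f 0)) {U : ℕ → femSpace Ω K}
    (hU : IsFullyDiscreteSolution s α T τ u₀ f U)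
    (hi : IntegrableOn (fun r => C * τ * (n * τ - r) ^ (α - 1) * ‖f' r‖) (Ioo 0 (n * τ))) :
    ‖femToL2 hΩ hK (uh (n * τ) - U n)‖ ≤ C * τ * (n * τ)⁻¹ * ‖femToL2 hΩ hK (U 0)‖ +
      C * τ * (n * τ) ^ (α - 1) * ‖femToL2 hΩ hK fh0‖ +
      ∫ r in Ioo 0 (n * τ), C * τ * (n * τ - r) ^ (α - 1) * ‖f' r‖ := by
  have := finiteDimensional_femSpace (Ω := Ω) hK
  set ι := femToL2 (Ω := Ω) (K := K) hΩ hK with hι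
  have ht0 : 0 < (n : ℝ) * τ := mul_pos (by exact_mod_cast hn) hτ
  have ha : ∀ u v : femSpace Ω K, energyForm hd hs hΩo hΩ hK u v =
      gradForm Ω u v + fracForm Ω s u v := fun u v => rfl
  obtain ⟨N, φ, l, horth, hl, hdiag, hexp⟩ := exists_diagonal_family ι
    (femToL2_injective hΩo hΩ hK) (energyForm hd hs hΩo hΩ hK)
    (fun u v => by rw [ha, ha, gradForm_comm, fracForm_comm])
    (fun v => by
      rw [ha]; exact add_nonneg (gradForm_self_nonneg _) (fracForm_self_nonneg hs _))
  have hform : ∀ k (u : femSpace Ω K), gradForm Ω u (φ k) + fracForm Ω s u (φ k) =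
      l k * inner ℝ (ι (φ k)) (ι u) := fun k u => by
    rw [← hdiag, ha, gradForm_comm, fracForm_comm]
  have hinner : ∀ k (u : femSpace Ω K), l2Inner Ω u (φ k) = inner ℝ (ι (φ k)) (ι u) :=
    fun k u => by rw [l2Inner_eq_inner hΩ hK, real_inner_comm]
  have hinner' : ∀ k (g : L2 Ω), l2Inner Ω g (φ k) = inner ℝ (ι (φ k)) g :=
    fun k g => by rw [l2Inner_L2 hΩ hK, real_inner_comm]
  have hf'n : IntervalIntegrable f' volume 0 (n * τ) := by
    refine hf'.mono_set ?_
    rw [uIcc_of_le ht0.le, uIcc_of_le hT.le]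
    exact Icc_subset_Icc_right hnT
  -- One triple of multipliers and kernel per eigenvalue; their bounds do not depend on it.
  choose e₁ e₂ κ hκm he₁ he₂ hκ hmain using fun k => hrep (l k) (hl k)
  refine norm_le_of_forall_inner_eq horth (by positivity) (by positivity) ht0.le (hexp _) he₁ he₂
    hκm (fun r hr => ?_) hκ ?_ hi fun k => ?_
  · have : 0 ≤ (n : ℝ) * τ - r := (sub_pos.2 hr.2).le
    positivity
  · exact (((intervalIntegrable_iff_integrableOn_Ioo_of_le ht0.le).1 hf'n)).aestronglyMeasurable
  · set L : L2 Ω →L[ℝ] ℝ := innerSL ℝ (ι (φ k)) with hL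
    have hLapp : ∀ g, L g = inner ℝ (ι (φ k)) g := fun g => rfl
    have hcont : Continuous fun v : femSpace Ω K => inner ℝ (ι (φ k)) (ι v) :=
      LinearMap.continuous_of_finiteDimensional ((L : L2 Ω →ₗ[ℝ] ℝ) ∘ₗ ι)
    have h := hmain k T (fun t => inner ℝ (ι (φ k)) (ι (uh t))) (fun t => inner ℝ (ι (φ k)) (f t))
      (fun t => inner ℝ (ι (φ k)) (f' t)) (fun m => inner ℝ (ι (φ k)) (ι (U m))) hnT
      (hcont.comp_continuousOn huh.continuousOn) ?_ ?_ ?_ ?_ ?_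
    -- Basis vectors lie in the finite element space, so f(0) may be replaced by its projection.
    · rw [map_sub, inner_sub_right, h, hfh0.inner_femToL2 hΩ hK]
    · exact ⟨L.integrable_comp hf'.1, L.integrable_comp hf'.2⟩
    · intro t ht
      have hf't : IntervalIntegrable f' volume 0 t := by
        refine hf'.mono_set ?_
        rw [uIcc_of_le ht.1, uIcc_of_le hT.le]
        exact Icc_subset_Icc_right ht.2
      simp only [← hLapp]
      rw [L.intervalIntegral_comp_comm hf't, ← map_add, ← hf t ht]
    · intro t ht
      have h1 := huh.equation t ht (φ k)
      rw [sub_sub, hform, hinner'] at h1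
      simp only [hinner, map_sub, inner_sub_right] at h1
      exact h1
    · intro m hm hmn
      have hmT : (m : ℝ) * τ ≤ T :=
        (mul_le_mul_of_nonneg_right (by exact_mod_cast hmn) hτ.le).trans hnT
      have h1 := hU.equation m hm hmT (φ k)
      rw [add_assoc, hform, hinner', hinner, map_sum, inner_sum] at h1
      simp only [map_smul, map_sub, inner_smul_right, inner_sub_right] at h1
      exact h1
    · exact (huh.initial.inner_femToL2 hΩ hK _).trans (hU.initial.inner_femToL2 hΩ hK _).symm

end TwoScaleFPE

theorem theorem3 (d : ℕ) (hd : 1 ≤ d) (hd3 : d ≤ 3) (Ω : Set (TwoScaleFPE.Sp d))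
    (hΩ : IsOpen Ω) (hΩb : Bornology.IsBounded Ω)
    (s α T : ℝ) (hs : s ∈ Ioo (0 : ℝ) 1) (hα : α ∈ Ioo (0 : ℝ) 1) (hT : 0 < T) :
    ∃ C : ℝ, 0 < C ∧
      ∀ K : Geometry.SimplicialComplex ℝ (TwoScaleFPE.Sp d),
        K.faces.Finite → K.space ⊆ closure Ω →
      ∀ (u₀ : TwoScaleFPE.L2 Ω) (f f' : ℝ → TwoScaleFPE.L2 Ω),
        IntervalIntegrable f' volume 0 T →
        (∀ t ∈ Icc 0 T, f t = f 0 + ∫ r in (0 : ℝ)..t, f' r) →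
      ∀ (uh : ℝ → TwoScaleFPE.femSpace Ω K) (fh0 : TwoScaleFPE.femSpace Ω K),
        TwoScaleFPE.IsSemidiscreteSolution s α T u₀ f uh →
        TwoScaleFPE.IsL2Projection fh0 (f 0) →
      ∀ (τ : ℝ) (U : ℕ → TwoScaleFPE.femSpace Ω K), 0 < τ →
        TwoScaleFPE.IsFullyDiscreteSolution s α T τ u₀ f U →
      ∀ n : ℕ, 1 ≤ n → (n : ℝ) * τ ≤ T →
        TwoScaleFPE.l2Norm Ω (uh ((n : ℝ) * τ) - U n : TwoScaleFPE.femSpace Ω K) ≤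
          ENNReal.ofReal (C * τ * ((n : ℝ) * τ)⁻¹) * TwoScaleFPE.l2Norm Ω (U 0)
          + ENNReal.ofReal (C * τ * ((n : ℝ) * τ)⁻¹) * TwoScaleFPE.l2Norm Ω fh0
          + ENNReal.ofReal (C * τ) * ∫⁻ r in Ioo (0 : ℝ) ((n : ℝ) * τ),
              ENNReal.ofReal (((n : ℝ) * τ - r) ^ (α - 1)) * ‖f' r‖ₑ := by
  obtain ⟨C, hC, hrep⟩ := TwoScaleFPE.exists_error_representation hα
  have hTα : 0 < T ^ α := Real.rpow_pos_of_pos hT α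
  -- The factor 1 + T^α absorbs the passage from t^(α-1), natural for the term with f(0), to t^(-1).
  refine ⟨C * (1 + T ^ α), by positivity, fun K hK _ u₀ f f' hf' hf uh fh0 huh hfh0 τ U hτ hU n hn
    hnT => ?_⟩
  have ht0 : 0 < (n : ℝ) * τ := mul_pos (by exact_mod_cast hn) hτ
  set t : ℝ := (n : ℝ) * τ with ht
  set D : ℝ := C * (1 + T ^ α) with hD
  have hD0 : 0 < D := by positivity
  have hCD : C ≤ D := by
    rw [hD]; nlinarith
  set J := ∫⁻ r in Ioo (0 : ℝ) t, ENNReal.ofReal ((t - r) ^ (α - 1)) * ‖f' r‖ₑ with hJ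
  -- If the data integral is infinite, its coefficient is positive and the right-hand side is
  -- infinite.
  rcases eq_or_ne J ∞ with hJt | hJt
  · rw [hJt, ENNReal.mul_top (by rw [Ne, ENNReal.ofReal_eq_zero]; exact not_le.2 (by positivity))]
    simp
  have hf'm : AEStronglyMeasurable f' (volume.restrict (Ioo 0 t)) := by
    refine ((intervalIntegrable_iff_integrableOn_Ioo_of_le hT.le).1 hf').aestronglyMeasurable.mono_set
      (Ioo_subset_Ioo_right hnT)
  have hlin : ∫⁻ r in Ioo (0 : ℝ) t, ‖C * τ * (t - r) ^ (α - 1) * ‖f' r‖‖ₑ =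
      ENNReal.ofReal (C * τ) * J := by
    rw [hJ, ← lintegral_const_mul' _ _ ENNReal.ofReal_ne_top]
    refine setLIntegral_congr_fun measurableSet_Ioo fun r hr => ?_
    have hr' : 0 ≤ t - r := (sub_pos.2 hr.2).le
    rw [enorm_mul, enorm_mul, enorm_norm, mul_assoc, Real.enorm_of_nonneg (by positivity),
      Real.enorm_of_nonneg (by positivity)]
  have hi : IntegrableOn (fun r => C * τ * (t - r) ^ (α - 1) * ‖f' r‖) (Ioo 0 t) := by
    refine ⟨AEStronglyMeasurable.mul
      (by fun_prop : Measurable fun r => C * τ * (t - r) ^ (α - 1)).aestronglyMeasurable hf'm.norm, ?_⟩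
    rw [HasFiniteIntegral, hlin]
    exact ENNReal.mul_lt_top ENNReal.ofReal_lt_top hJt.lt_top
  have hest := TwoScaleFPE.norm_femToL2_sub_le hd hs hΩ hΩb hK hT hC hτ hn hnT
    (fun l hl => hrep l τ hl hτ n hn) hf' hf huh hfh0 hU hi
  have hI : ENNReal.ofReal (∫ r in Ioo 0 t, C * τ * (t - r) ^ (α - 1) * ‖f' r‖) ≤
      ENNReal.ofReal (D * τ) * J := by
    refine (ENNReal.ofReal_le_ofReal
      ((Real.le_norm_self _).trans (norm_integral_le_integral_norm _))).trans ?_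
    rw [ofReal_integral_norm_eq_lintegral_enorm hi, hlin]
    gcongr
  have hpow : t ^ (α - 1) ≤ T ^ α * t⁻¹ := by
    rw [Real.rpow_sub ht0, Real.rpow_one, div_eq_mul_inv]
    have := Real.rpow_le_rpow ht0.le hnT hα.1.le
    gcongr
  rw [TwoScaleFPE.l2Norm_eq hΩb hK, TwoScaleFPE.l2Norm_eq hΩb hK, TwoScaleFPE.l2Norm_eq hΩb hK,
    ← ofReal_norm, ← ofReal_norm, ← ofReal_norm,
    ← ENNReal.ofReal_mul (by positivity), ← ENNReal.ofReal_mul (by positivity)]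
  refine (ENNReal.ofReal_le_ofReal hest).trans ?_
  refine ENNReal.ofReal_add_le.trans (add_le_add (ENNReal.ofReal_add_le.trans (add_le_add ?_ ?_)) hI)
  · refine ENNReal.ofReal_le_ofReal ?_
    gcongr
  · refine ENNReal.ofReal_le_ofReal ?_
    refine mul_le_mul_of_nonneg_right ?_ (norm_nonneg _)
    calc C * τ * t ^ (α - 1) ≤ C * τ * (T ^ α * t⁻¹) := by gcongr
      _ ≤ D * τ * t⁻¹ := by
        rw [hD]
        have : 0 ≤ C * τ * t⁻¹ := by positivity
        linarith
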